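/- Let $k$ be an algebraically closed field and let $Q$ be a finite acyclic quiver (finitely many vertices and arrows, no oriented cycles) which is wild, i.e. some connected component of $Q$ has an underlying graph that is neither a Dynkin diagram $A_n$ ($n\ge 1$), $D_n$ ($n\ge 4$), $E_6,E_7,E_8$ nor a Euclidean diagram $\widetilde A_n$ ($n\ge 1$), $\widetilde D_n$ ($n\ge 4$), $\widetilde E_6,\widetilde E_7,\widetilde E_8$ (for connected $Q$: $Q$ is neither Dynkin nor Euclidean). For a finite-dimensional representation $M$ of $Q$ over $k$ and a dimension vector $\mathbf d\in\mathbb N^{Q_0}$, the quiver Grassmannian $\mathbb G_{\mathbf d}(M)$ is the set of all subrepresentations $U$ of $M$ with $\dim_k U_i=d_i$ for every vertex $i$; it is regarded as a variety in the classical sense, as a subset of $\prod_{i\in Q_0}\mathrm{Gr}(d_i,M_i)$ with its Plücker embedding into $\prod_{i\in Q_0}\mathbb P(\bigwedge^{d_i}M_i)$. Theorem. Every projective variety over $k$, that is, every Zariski-closed subset $V\subseteq\mathbb P^n(k)$, $n\ge 0$ (not necessarily irreducible), is isomorphic, as a variety, to a quiver Grassmannian $\mathbb G_{\mathbf d}(M)$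 for a suitable finite-dimensional representation $M$ of $Q$ and a suitable dimension vector $\mathbf d$. -/

import Mathlib

open scoped Topology LinearAlgebra.Projectivization

universe u

noncomputable section

/-! ### Quivers, their underlying graphs, and wildness -/

/-- A quiver is acyclic if it has no oriented cycles (loops included): every path from a vertex
to itself is trivial. -/
def IsAcyclicQuiver (Q : Type*) [Quiver Q] : Prop :=
  ∀ (i : Q) (p : Quiver.Path i i), p.length = 0

/-- Multiplicity of the edge `{a, b}` in the underlying (undirected) multigraph of a finite
quiver: the number of arrows between `a` and `b`, in either direction. -/
def edgeMultiplicity {Q : Type*} [Quiver Q] (a b : Q) : ℕ :=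
  Nat.card (a ⟶ b) + Nat.card (b ⟶ a)

/-- `HasShape E n L`: the multigraph on `T` with edge multiplicities `E` is isomorphic to the
multigraph with vertices `0, …, n - 1` whose edges are the entries of the list `L`. -/
def HasShape {T : Type*} (E : T → T → ℕ) (n : ℕ) (L : List (ℕ × ℕ)) : Prop :=
  ∃ e : T ≃ Fin n, ∀ a b : T,
    E a b = L.count ((e a : ℕ), (e b : ℕ)) + L.count ((e b : ℕ), (e a : ℕ))

/-- The edges `0 — 1 — ⋯ — (m - 1)` of a path with `m` vertices. -/
def pathEdges (m : ℕ) : List (ℕ × ℕ) :=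
  (List.range (m - 1)).map fun i => (i, i + 1)

/-- The (simply laced) Dynkin diagrams `A_n` (`n ≥ 1`), `D_n` (`n ≥ 4`), `E_6`, `E_7`, `E_8`. -/
def IsDynkin {T : Type*} (E : T → T → ℕ) : Prop :=
  (∃ n : ℕ, 1 ≤ n ∧ HasShape E n (pathEdges n)) ∨
  (∃ n : ℕ, 4 ≤ n ∧ HasShape E n ((n - 3, n - 1) :: pathEdges (n - 1))) ∨
  HasShape E 6 ((2, 5) :: pathEdges 5) ∨
  HasShape E 7 ((2, 6) :: pathEdges 6) ∨
  HasShape E 8 ((2, 7) :: pathEdges 7)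

/-- The (simply laced) Euclidean diagrams `Ã_n` (`n ≥ 1`, a cycle with `n + 1` vertices; `Ã_1` is
a double edge), `D̃_n` (`n ≥ 4`, with `n + 1` vertices), `Ẽ_6`, `Ẽ_7`, `Ẽ_8`. -/
def IsEuclidean {T : Type*} (E : T → T → ℕ) : Prop :=
  (∃ n : ℕ, 1 ≤ n ∧ HasShape E (n + 1) ((n, 0) :: pathEdges (n + 1))) ∨
  (∃ n : ℕ, 4 ≤ n ∧ HasShape E (n + 1) ((1, n - 1) :: (n - 3, n) :: pathEdges (n - 1))) ∨
  HasShape E 7 ((2, 5) :: (5, 6) :: pathEdges 5) ∨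
  HasShape E 8 ((3, 7) :: pathEdges 7) ∨
  HasShape E 9 ((2, 8) :: pathEdges 8)

/-- A quiver is wild if it has a connected component whose underlying graph is neither a Dynkin
nor a Euclidean diagram. (For a connected quiver there is just one component.) -/
def IsWildQuiver (Q : Type*) [Quiver Q] : Prop :=
  ∃ C : Quiver.WeaklyConnectedComponent Q,
    ¬ IsDynkin (fun a b : {i : Q // Quiver.WeaklyConnectedComponent.mk i = C} =>
        edgeMultiplicity a.1 b.1) ∧
    ¬ IsEuclidean (fun a b : {i : Q // Quiver.WeaklyConnectedComponent.mk i = C} =>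
        edgeMultiplicity a.1 b.1)

/-! ### Finite-dimensional representations and sets of subrepresentations -/

/-- A finite-dimensional representation of the quiver `Q` over the field `k`. -/
structure QuiverRep (k : Type u) [Field k] (Q : Type*) [Quiver Q] where
  obj : Q → Type u
  [addCommGroup : ∀ i, AddCommGroup (obj i)]
  [module : ∀ i, Module k (obj i)]
  [finite : ∀ i, Module.Finite k (obj i)]
  map : ∀ {i j : Q}, (i ⟶ j) → (obj i →ₗ[k] obj j)

attribute [instance] QuiverRep.addCommGroup QuiverRep.module QuiverRep.finite

/-- The underlying set of the quiver Grassmannian: all subrepresentations `U` of `M` with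
dimension vector `d`. -/
def QuiverGrassmannian {k : Type u} [Field k] {Q : Type*} [Quiver Q] (M : QuiverRep k Q)
    (d : Q → ℕ) : Type _ :=
  {U : ∀ i, Submodule k (M.obj i) //
    (∀ (i j : Q) (a : i ⟶ j), ∀ x ∈ U i, M.map a x ∈ U j) ∧
    ∀ i, Module.finrank k (U i) = d i}

/-! ### Subvarieties of products of projective spaces

Throughout, a family of maps `φ i : X → ℙ k (W i)` that are jointly injective is used to regard
`X` as a subset of the product of the projective spaces `ℙ k (W i)`. The homogeneous coordinate
functions on `ℙ k (W i)` are all linear forms on `W i`. -/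

section Varieties

variable {k : Type*} [Field k] {X : Type*} {ι : Type*} {W : ι → Type*}
  [∀ i, AddCommGroup (W i)] [∀ i, Module k (W i)]

/-- Polynomials in the linear forms on the spaces `W i`. -/
abbrev CoordPoly (k : Type*) [Field k] {ι : Type*} (W : ι → Type*)
    [∀ i, AddCommGroup (W i)] [∀ i, Module k (W i)] : Type _ :=
  MvPolynomial (Σ i, Module.Dual k (W i)) k

/-- `P` is multihomogeneous of multidegree `m`: homogeneous of degree `m i` in the linear forms on
`W i`, for every `i`. -/
def IsMultihomogeneous (P : CoordPoly k W) (m : ι →₀ ℕ) : Prop :=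
  MvPolynomial.IsWeightedHomogeneous
    (fun s : Σ i, Module.Dual k (W i) => Finsupp.single s.1 1) P m

/-- Value of `P` at the representatives of the points `φ i x`. For multihomogeneous `P` its
vanishing does not depend on the representatives, and neither does a quotient of two such values
in the same multidegree. -/
def coordEval (φ : ∀ i, X → ℙ k (W i)) (P : CoordPoly k W) (x : X) : k :=
  MvPolynomial.eval (fun s : Σ i, Module.Dual k (W i) => s.2 (φ s.1 x).rep) P

/-- The Zariski topology on `X`: the open sets are the unions of the nonvanishing loci of
multihomogeneous polynomials (these are stable under finite intersection). -/
abbrev zariskiTopology (φ : ∀ i, X → ℙ k (W i)) : TopologicalSpace X :=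
  TopologicalSpace.generateFrom
    {D | ∃ (m : ι →₀ ℕ) (P : CoordPoly k W), IsMultihomogeneous P m ∧
      D = {x | coordEval φ P x ≠ 0}}

/-- The function `f` is regular on the Zariski-open set `U`: locally on `U` it is a quotient of
multihomogeneous polynomials of the same multidegree. Only the values of `f` on `U` matter. -/
def IsRegularOn (φ : ∀ i, X → ℙ k (W i)) (U : Set X) (f : X → k) : Prop :=
  ∀ x ∈ U, ∃ N : Set X, IsOpen[zariskiTopology φ] N ∧ x ∈ N ∧ N ⊆ U ∧
    ∃ (m : ι →₀ ℕ) (P R : CoordPoly k W), IsMultihomogeneous P m ∧ IsMultihomogeneous R m ∧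
      ∀ y ∈ N, coordEval φ R y ≠ 0 ∧ f y = coordEval φ P y / coordEval φ R y

variable {Y : Type*} {κ : Type*} {Z : κ → Type*}
  [∀ j, AddCommGroup (Z j)] [∀ j, Module k (Z j)]

/-- The bijection `e` is an isomorphism of varieties: a homeomorphism of Zariski topologies which
identifies the regular functions on corresponding open sets. -/
def IsVarietyIso (φ : ∀ i, X → ℙ k (W i)) (ψ : ∀ j, Y → ℙ k (Z j)) (e : X ≃ Y) : Prop :=
  (∀ U : Set Y, IsOpen[zariskiTopology ψ] U ↔ IsOpen[zariskiTopology φ] (e ⁻¹' U)) ∧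
  ∀ U : Set Y, IsOpen[zariskiTopology ψ] U → ∀ f : Y → k,
    (IsRegularOn ψ U f ↔ IsRegularOn φ (e ⁻¹' U) (f ∘ e))

end Varieties

/-- `V` is a closed subvariety (not necessarily irreducible) of projective `n`-space: the set of
common zeros of a set of homogeneous polynomials. -/
def IsProjectiveVariety {k : Type*} [Field k] {n : ℕ} (V : Set (ℙ k (Fin (n + 1) → k))) : Prop :=
  ∃ S : Set (MvPolynomial (Fin (n + 1)) k), (∀ F ∈ S, ∃ r : ℕ, F.IsHomogeneous r) ∧
    V = {x | ∀ F ∈ S, MvPolynomial.eval x.rep F = 0}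

/-- The inclusion of `V` into projective `n`-space, as a family of maps with one member. -/
def projectiveInclusion {k : Type*} [Field k] {n : ℕ} (V : Set (ℙ k (Fin (n + 1) → k))) :
    ∀ _ : Unit, V → ℙ k (Fin (n + 1) → k) :=
  fun _ x => x.1

/-! ### The Plücker embedding -/

theorem ιMulti_ne_zero_of_linearIndependent {k : Type*} [Field k] {E : Type*} [AddCommGroup E]
    [Module k E] {d : ℕ} {v : Fin d → E} (hv : LinearIndependent k v) :
    exteriorPower.ιMulti k d v ≠ 0 := by
  have h := exteriorPower.ιMulti_family_linearIndependent_field (n := d) hv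
  have h1 := h.ne_zero ⟨Finset.univ, by simp⟩
  intro h0
  apply h1
  let f := Set.powersetCard.ofFinEmbEquiv.symm
    (⟨Finset.univ, by simp⟩ : Set.powersetCard (Fin d) d)
  let σ : Equiv.Perm (Fin d) :=
    Equiv.ofBijective f (Finite.injective_iff_bijective.mp f.injective)
  have h2 : exteriorPower.ιMulti k d (v ∘ σ) = 0 := by
    rw [AlternatingMap.map_perm, h0, smul_zero]
  exact h2

/-- The Plücker point of a `d`-dimensional subspace `U` of `E`: the line spanned by
`u_1 ∧ ⋯ ∧ u_d` in the `d`-th exterior power of `E`, for a basis `u_1, …, u_d` of `U`. -/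
def pluckerPoint {k : Type*} [Field k] {E : Type*} [AddCommGroup E] [Module k E]
    [Module.Finite k E] (d : ℕ) (U : Submodule k E) (hU : Module.finrank k U = d) :
    ℙ k (⋀[k]^d E) :=
  Projectivization.mk k
    (exteriorPower.ιMulti k d fun t => (Module.finBasisOfFinrankEq k U hU t : E))
    (ιMulti_ne_zero_of_linearIndependent
      ((Module.finBasisOfFinrankEq k U hU).linearIndependent.map' U.subtype U.ker_subtype))

/-- The embedding of the quiver Grassmannian into a product of projective spaces: at each vertex
the Plücker embedding. -/
def quiverPlucker {k : Type u} [Field k] {Q : Type*} [Quiver Q] (M : QuiverRep k Q) (d : Q → ℕ) :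
    ∀ i : Q, QuiverGrassmannian M d → ℙ k (⋀[k]^(d i) (M.obj i)) :=
  fun i U => pluckerPoint (d i) (U.1 i) (U.2.2 i)

end

/-!
The vertices of a representation of `Q` are filled with powers `N ^ z i` of one vector space `N`,
and the arrows act by matrices whose entries are linear combinations of the identity and of `r`
operators on `N` (`QuiverFamily`). An operator-invariant subspace `U₀` of `N` gives the
subrepresentation with the spaces `U₀ ^ z i`. The family is *full* for the operators
(`QuiverFamily.IsFullFor`) if every subrepresentation whose dimension vector is a multiple of `z`
arises in this way, so that the quiver Grassmannian for the multiple `c • z` is the set of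
invariant subspaces of dimension `c`.

**Two operators suffice.** Let `V` be closed in projective space, defined by forms of degree at most
`d + 1`, and let `A` be the span of the Veronese vectors of degree `d + 1` of the points of `V`. A
line in `A` spanned by a tensor `v` whose contractions with the coordinate forms are all multiples
of one vector `w` is spanned by a Veronese vector (`eq_smul_veronese`), hence by that of a point
of `V`. Such pairs of lines are the invariant subspaces of a suitable dimension of two operators on
`PencilSpace A`: one operator has distinct eigenvalues on the summands, and the other one maps
between the summands by the contractions and by identities (`exists_eq_pencilLine`). The Plücker
coordinates of the corresponding subrepresentations are forms in the coordinates of the point, and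
enough monomials are among them to recover the point. Thus a family which is full for two operators
realizes `V`, and the bijection is an isomorphism of varieties (`isVarietyIso_of_forms`,
`QuiverFamily.exists_isVarietyIso`). The operators may be shifted by scalars, so fullness is only
needed for generic pairs (`IsGoodPair`).

**Producing operators.** The starting point is a full family without operators. A vertex `v` outside
of its support, with maps from the space at `v` to `r + 1` of the summands `N` of the spaces
at other vertices, or in the other direction, acquires `r` operators: `N` is placed at `v`, with the
maps `1, T 0, …` (`extend_isFullFor_out`, `extend_isFullFor_in`). With three summands there are two
operators. With two summands there is one operator, and any further vertex joined to `v` or to the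
support yields two (`hasFullPairFamily_of_attach`): the one operator is used as a diagonal operator
on `N ^ 5`, and `N ^ 2` is placed at the new vertex, with the five subspaces `y = 0`, `x = 0`,
`x = y`, `y = T 0 x`, `y = T 1 x`. In this cyclic sequence neighbours are independent, so if a subspace
of dimension `2 c` meets the five subspaces in total dimension at least `5 c`, then all five
dimensions are `c`; the odd length of the cycle enters here (`exists_eq_pi_of_five`).

**Full families without operators.** One-dimensional spaces and identity maps on a connected set of
vertices do. Reflections at sinks preserve fullness (`HasFullRep.reflect`), so the highest roots
of `D₄`, `E₆`, `E₇` and `E₈` belong to full families for all orientations of these diagrams. Equal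
spaces joined by identities may be inserted (`exists_isFullRep_of_labels`), which gives the highest
roots of `Dₙ` as well. The vertex that extends such a diagram to the Euclidean one is adjacent to a
vertex where the highest root has the value two, and so has two summands; in a Euclidean cycle, a
source of the cycle has one summand at each of its neighbours.

**Wild quivers.** A component which is neither Dynkin nor Euclidean contains three parallel arrows,
or a Euclidean diagram and a further vertex joined to it (`hasFullPairFamily_of_isWildQuiver`). This
is seen from a multiple edge, or from a cycle of minimal length, or in a tree from the arms of stars
(`isDynkin_or_exists_config`).
-/

noncomputable section

/-! ### Morphisms given by multihomogeneous polynomials -/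

section Morphisms

variable {k : Type*} [Field k]

/-- Scaling the coordinates on `W i` by `c i` multiplies a multihomogeneous polynomial of
multidegree `m` by `∏ c i ^ m i`. -/
theorem eval_mul_of_isMultihomogeneous {ι : Type*} {W : ι → Type*}
    [∀ i, AddCommGroup (W i)] [∀ i, Module k (W i)] {P : CoordPoly k W} {m : ι →₀ ℕ}
    (hP : IsMultihomogeneous P m) (c : ι → k) (y : (Σ i, Module.Dual k (W i)) → k) :
    MvPolynomial.eval (fun s => c s.1 * y s) P =
      (m.prod fun i n => c i ^ n) * MvPolynomial.eval y P := by
  rw [MvPolynomial.eval_eq, MvPolynomial.eval_eq, Finset.mul_sum]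
  refine Finset.sum_congr rfl fun d hd => ?_
  have hw := hP (MvPolynomial.mem_support_iff.mp hd)
  have key : (∏ i ∈ d.support, c i.1 ^ d i) = m.prod fun i n => c i ^ n := by
    rw [← hw, Finsupp.weight_apply, Finsupp.sum, ← Finsupp.prod_finsetSum_index]
    · refine Finset.prod_congr rfl fun i _ => ?_
      rw [Finsupp.smul_single, Finsupp.prod_single_index] <;> simp
    · simp
    · intro a b₁ b₂; exact pow_add _ _ _
  simp only [mul_pow, Finset.prod_mul_distrib]
  rw [key]; ring

variable {X : Type*} {ι : Type*} {W : ι → Type*}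
  [∀ i, AddCommGroup (W i)] [∀ i, Module k (W i)]
  {Y : Type*} {κ : Type*} {Z : κ → Type*}
  [∀ j, AddCommGroup (Z j)] [∀ j, Module k (Z j)]

/-- The map `g` is locally given, in each factor of the target, by multihomogeneous polynomials of
the same multidegree, up to a common nonzero factor. -/
def IsPolyMorphism (φ : ∀ i, X → ℙ k (W i)) (ψ : ∀ j, Y → ℙ k (Z j)) (g : X → Y) : Prop :=
  ∀ x₀ : X, ∃ N : Set X, IsOpen[zariskiTopology φ] N ∧ x₀ ∈ N ∧
    ∃ (D : κ → ι →₀ ℕ) (p : ∀ j, Module.Dual k (Z j) → CoordPoly k W),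
      (∀ j s, IsMultihomogeneous (p j s) (D j)) ∧
      ∀ x ∈ N, ∃ c : κ → k, (∀ j, c j ≠ 0) ∧
        ∀ j s, s (ψ j (g x)).rep = c j * coordEval φ (p j s) x

theorem IsMultihomogeneous.bind {P : CoordPoly k Z} {m : κ →₀ ℕ}
    (hP : IsMultihomogeneous P m) {D : κ → ι →₀ ℕ}
    {p : ∀ j, Module.Dual k (Z j) → CoordPoly k W}
    (hp : ∀ j s, IsMultihomogeneous (p j s) (D j)) :
    IsMultihomogeneous (MvPolynomial.bind₁ (fun s : Σ j, Module.Dual k (Z j) => p s.1 s.2) P)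
      (m.sum fun j n => n • D j) := by
  unfold IsMultihomogeneous
  rw [MvPolynomial.bind₁, MvPolynomial.aeval_eq_eval₂Hom, MvPolynomial.coe_eval₂Hom,
    MvPolynomial.eval₂_eq]
  refine MvPolynomial.IsWeightedHomogeneous.sum _ _ _ fun d hd => ?_
  have hw := hP (MvPolynomial.mem_support_iff.mp hd)
  have key : (m.sum fun j n => n • D j) = ∑ i ∈ d.support, d i • D i.1 := by
    rw [← hw, Finsupp.weight_apply, Finsupp.sum.eq_1 d, ← Finsupp.sum_finsetSum_index]
    · refine Finset.sum_congr rfl fun i _ => ?_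
      rw [Finsupp.smul_single, Finsupp.sum_single_index] <;> simp
    · simp
    · intro a b₁ b₂; exact add_smul _ _ _
  rw [key, ← zero_add (∑ i ∈ d.support, d i • D i.1)]
  refine (MvPolynomial.isWeightedHomogeneous_C _ _).mul ?_
  exact MvPolynomial.IsWeightedHomogeneous.prod _ _ _ fun i _ => (hp _ _).pow _

/-- A multihomogeneous polynomial on the target pulls back to one on the source, up to a nonzero
factor that depends on its multidegree only. -/
theorem coordEval_comp {φ : ∀ i, X → ℙ k (W i)} {ψ : ∀ j, Y → ℙ k (Z j)} {g : X → Y}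
    {p : ∀ j, Module.Dual k (Z j) → CoordPoly k W} {x : X} {c : κ → k}
    (hc : ∀ j s, s (ψ j (g x)).rep = c j * coordEval φ (p j s) x)
    {P : CoordPoly k Z} {m : κ →₀ ℕ} (hP : IsMultihomogeneous P m) :
    coordEval ψ P (g x) = (m.prod fun j n => c j ^ n) *
      coordEval φ (MvPolynomial.bind₁ (fun s : Σ j, Module.Dual k (Z j) => p s.1 s.2) P) x := by
  unfold coordEval
  simp only [hc]
  rw [eval_mul_of_isMultihomogeneous hP c, MvPolynomial.bind₁, ← MvPolynomial.coe_aeval_eq_eval,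
    ← MvPolynomial.coe_aeval_eq_eval, RingHom.coe_coe, RingHom.coe_coe, ← AlgHom.comp_apply,
    MvPolynomial.comp_aeval]
  rfl

theorem isOpen_coordEval_ne_zero (φ : ∀ i, X → ℙ k (W i)) {P : CoordPoly k W} {m : ι →₀ ℕ}
    (hP : IsMultihomogeneous P m) : IsOpen[zariskiTopology φ] {x | coordEval φ P x ≠ 0} :=
  TopologicalSpace.isOpen_generateFrom_of_mem ⟨m, P, hP, rfl⟩

theorem IsPolyMorphism.isOpen_preimage {φ : ∀ i, X → ℙ k (W i)} {ψ : ∀ j, Y → ℙ k (Z j)}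
    {g : X → Y} (hg : IsPolyMorphism φ ψ g) {U : Set Y} (hU : IsOpen[zariskiTopology ψ] U) :
    IsOpen[zariskiTopology φ] (g ⁻¹' U) := by
  have hcont : Continuous[zariskiTopology φ, zariskiTopology ψ] g := by
    rw [continuous_generateFrom_iff]
    rintro _ ⟨m, P, hP, rfl⟩
    let _ := zariskiTopology φ
    rw [isOpen_iff_forall_mem_open]
    intro x₀ hx₀
    obtain ⟨N, hN, hxN, D, p, hp, hN'⟩ := hg x₀
    have key : ∀ x ∈ N, (coordEval ψ P (g x) ≠ 0 ↔
        coordEval φ (MvPolynomial.bind₁ (fun s : Σ j, Module.Dual k (Z j) => p s.1 s.2) P) x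
          ≠ 0) := by
      intro x hx
      obtain ⟨c, hc0, hc⟩ := hN' x hx
      rw [coordEval_comp hc hP, mul_ne_zero_iff, and_iff_right]
      exact Finset.prod_ne_zero_iff.mpr fun j _ => pow_ne_zero _ (hc0 j)
    refine ⟨N ∩ {x | coordEval φ (MvPolynomial.bind₁
      (fun s : Σ j, Module.Dual k (Z j) => p s.1 s.2) P) x ≠ 0}, ?_, ?_, hxN, ?_⟩
    · rintro x ⟨hx, hx'⟩
      exact (key x hx).2 hx'
    · exact IsOpen.inter hN (isOpen_coordEval_ne_zero φ (hP.bind hp))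
    · exact (key x₀ hxN).1 hx₀
  exact (@continuous_def _ _ (zariskiTopology φ) (zariskiTopology ψ) g).1 hcont U hU

theorem IsPolyMorphism.isRegularOn_comp {φ : ∀ i, X → ℙ k (W i)} {ψ : ∀ j, Y → ℙ k (Z j)}
    {g : X → Y} (hg : IsPolyMorphism φ ψ g) {U : Set Y} {f : Y → k} (hf : IsRegularOn ψ U f) :
    IsRegularOn φ (g ⁻¹' U) (f ∘ g) := by
  intro x₀ hx₀
  obtain ⟨N, hN, hxN, hNU, m, P, R, hP, hR, hPR⟩ := hf (g x₀) hx₀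
  obtain ⟨N', hN', hxN', D, p, hp, hc⟩ := hg x₀
  let _ := zariskiTopology φ
  refine ⟨N' ∩ g ⁻¹' N, IsOpen.inter hN' (hg.isOpen_preimage hN),
    ⟨hxN', hxN⟩, fun x hx => hNU hx.2, _, _, _, hP.bind hp, hR.bind hp, ?_⟩
  rintro x ⟨hx, hx'⟩
  obtain ⟨c, hc0, hc⟩ := hc x hx
  obtain ⟨h1, h2⟩ := hPR (g x) hx'
  have hne : (m.prod fun j n => c j ^ n) ≠ 0 :=
    Finset.prod_ne_zero_iff.mpr fun j _ => pow_ne_zero _ (hc0 j)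
  rw [coordEval_comp hc hR] at h1 h2
  rw [coordEval_comp hc hP] at h2
  refine ⟨right_ne_zero_of_mul h1, ?_⟩
  rw [Function.comp_apply, h2, mul_div_mul_left _ _ hne]

theorem IsPolyMorphism.isVarietyIso {φ : ∀ i, X → ℙ k (W i)} {ψ : ∀ j, Y → ℙ k (Z j)}
    {e : X ≃ Y} (he : IsPolyMorphism φ ψ e) (he' : IsPolyMorphism ψ φ e.symm) :
    IsVarietyIso φ ψ e := by
  refine ⟨fun U => ⟨fun h => he.isOpen_preimage h, fun h => ?_⟩, fun U _ f =>
    ⟨fun h => he.isRegularOn_comp h, fun h => ?_⟩⟩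
  · have := he'.isOpen_preimage h
    rwa [← Set.preimage_comp, e.self_comp_symm, Set.preimage_id] at this
  · have := he'.isRegularOn_comp h
    rwa [← Set.preimage_comp, Function.comp_assoc, e.self_comp_symm, Set.preimage_id,
      Function.comp_id] at this

end Morphisms

/-! ### Families of representations over modules with operators -/

/-- A representation of `Q` by matrices over the free algebra in `r` letters: `G i` indexes the
basis at the vertex `i`, and `coeff a` lists the entries of the matrix at the arrow `a`, which are
required to be linear combinations of `1` (the index `none`) and of the letters. -/
structure QuiverFamily (k : Type u) [Field k] (Q : Type*) [Quiver Q] (r : ℕ) where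
  G : Q → Type
  [fintype : ∀ i, Fintype (G i)]
  coeff : ∀ {i j : Q}, (i ⟶ j) → G j → G i → Option (Fin r) → k

attribute [instance] QuiverFamily.fintype

namespace QuiverFamily

variable {k : Type u} [Field k] {Q : Type*} [Quiver Q] {r : ℕ} (F : QuiverFamily k Q r)
  {N : Type u} [AddCommGroup N] [Module k N]

/-- The linear map at the arrow `a` when the letters act on `N` by the operators `T`. -/
def map (T : Fin r → Module.End k N) {i j : Q} (a : i ⟶ j) : (F.G i → N) →ₗ[k] (F.G j → N) :=
  LinearMap.pi fun g => ∑ g', ∑ t : Option (Fin r),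
    F.coeff a g g' t • (t.elim 1 T ∘ₗ LinearMap.proj g')

theorem map_apply (T : Fin r → Module.End k N) {i j : Q} (a : i ⟶ j) (u : F.G i → N)
    (g : F.G j) : F.map T a u g = ∑ g', (F.coeff a g g' none • u g' +
      ∑ t, F.coeff a g g' (some t) • T t (u g')) := by
  simp [map, LinearMap.pi_apply, Fintype.sum_option]

/-- The subspaces `U i` form a subrepresentation. -/
def IsStable (T : Fin r → Module.End k N) (U : ∀ i, Submodule k (F.G i → N)) : Prop :=
  ∀ ⦃i j : Q⦄ (a : i ⟶ j), ∀ x ∈ U i, F.map T a x ∈ U j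

/-- All subrepresentations whose dimension vector is a multiple of that of the family come from
invariant subspaces of `N`. -/
def IsFullFor (T : Fin r → Module.End k N) : Prop :=
  ∀ (c : ℕ) (U : ∀ i, Submodule k (F.G i → N)), F.IsStable T U →
    (∀ i, Module.finrank k (U i) = Fintype.card (F.G i) * c) →
    ∃ U₀ : Submodule k N, (∀ t, ∀ x ∈ U₀, T t x ∈ U₀) ∧
      ∀ i, U i = Submodule.pi Set.univ fun _ => U₀

/-- An invariant subspace of `N` gives a subrepresentation. -/
theorem isStable_pi {T : Fin r → Module.End k N} {U₀ : Submodule k N}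
    (h : ∀ t, ∀ x ∈ U₀, T t x ∈ U₀) :
    F.IsStable T fun i => Submodule.pi (Set.univ : Set (F.G i)) fun _ => U₀ := by
  intro i j a x hx g _
  rw [map_apply]
  refine U₀.sum_mem fun g' _ => U₀.add_mem (U₀.smul_mem _ (hx g' trivial)) ?_
  exact U₀.sum_mem fun t _ => U₀.smul_mem _ (h t _ (hx g' trivial))

/-- The representation of `Q` on the spaces `G i → N`. -/
def rep [Module.Finite k N] (T : Fin r → Module.End k N) : QuiverRep k Q where
  obj i := F.G i → N
  map a := F.map T a

end QuiverFamily

/-! ### Linear algebra of powers of a vector space -/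

section PowerSpaces

variable {k : Type*} [Field k] {N : Type*} [AddCommGroup N] [Module k N]

/-- The power `U₀ ^ G` as a subspace of `N ^ G`. -/
def piConstEquiv (G : Type*) (U₀ : Submodule k N) :
    (Submodule.pi (Set.univ : Set G) fun _ => U₀) ≃ₗ[k] (G → U₀) where
  toFun u g := ⟨u.1 g, u.2 g trivial⟩
  invFun u := ⟨fun g => (u g).1, fun g _ => (u g).2⟩
  map_add' _ _ := rfl
  map_smul' _ _ := rfl
  left_inv _ := rfl
  right_inv _ := rfl

theorem finrank_pi_const (G : Type*) [Fintype G] (U₀ : Submodule k N) [Module.Finite k U₀] :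
    Module.finrank k (Submodule.pi (Set.univ : Set G) fun _ => U₀) =
      Fintype.card G * Module.finrank k U₀ := by
  rw [(piConstEquiv G U₀).finrank_eq, Module.finrank_pi_fintype]
  simp

/-- If the `p i` are jointly injective and diagonalise `T` with distinct eigenvalues, a `T`-stable
subspace contains, with a vector `u`, each component of `u`. -/
theorem mem_of_distinct_eigenvalues {ι : Type*} [Fintype ι] [DecidableEq ι] {M : ι → Type*}
    [∀ i, AddCommGroup (M i)] [∀ i, Module k (M i)] (p : ∀ i, N →ₗ[k] M i)
    (hp : ∀ u v : N, (∀ i, p i u = p i v) → u = v) {T : Module.End k N} {μ : ι → k}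
    (hμ : Function.Injective μ) (hT : ∀ i u, p i (T u) = μ i • p i u) {U : Submodule k N}
    (hU : ∀ u ∈ U, T u ∈ U) {u v : N} (hu : u ∈ U) (i : ι) (hi : p i v = p i u)
    (hv : ∀ j, j ≠ i → p j v = 0) : v ∈ U := by
  have h1 : ∀ q : Polynomial k, Polynomial.aeval T q u ∈ U ∧
      ∀ j, p j (Polynomial.aeval T q u) = q.eval (μ j) • p j u := by
    intro q
    induction q using Polynomial.induction_on' with
    | add q₁ q₂ h₁ h₂ =>
      refine ⟨by simpa using U.add_mem h₁.1 h₂.1, fun j => ?_⟩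
      rw [map_add, LinearMap.add_apply, map_add, h₁.2, h₂.2, Polynomial.eval_add, add_smul]
    | monomial n c =>
      have h2 : (T ^ n) u ∈ U ∧ ∀ j, p j ((T ^ n) u) = μ j ^ n • p j u := by
        induction n with
        | zero => simpa using hu
        | succ n ih =>
          rw [pow_succ', Module.End.mul_apply]
          refine ⟨hU _ ih.1, fun j => ?_⟩
          rw [hT, ih.2, smul_smul, pow_succ']
      rw [Polynomial.aeval_monomial, ← Algebra.smul_def, LinearMap.smul_apply]
      refine ⟨U.smul_mem _ h2.1, fun j => ?_⟩
      rw [map_smul, h2.2, smul_smul, Polynomial.eval_monomial]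
  obtain ⟨h2, h3⟩ := h1 (Lagrange.basis Finset.univ μ i)
  convert h2 using 1
  refine hp _ _ fun j => ?_
  rw [h3]
  by_cases hj : j = i
  · subst hj
    rw [Lagrange.eval_basis_self hμ.injOn (Finset.mem_univ _), one_smul, hi]
  · rw [Lagrange.eval_basis_of_ne (Ne.symm hj) (Finset.mem_univ _), zero_smul, hv j hj]

/-- Adding a suitable scalar to an endomorphism avoids a finite set of eigenvalues. -/
theorem finite_not_injective_add_smul [Module.Finite k N] (f : Module.End k N) :
    {c : k | ¬ Function.Injective (f + c • (1 : Module.End k N))}.Finite := by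
  refine ((Module.End.finite_hasEigenvalue f).preimage
    (neg_injective (G := k)).injOn).subset fun c hc => ?_
  rw [Set.mem_ofPred_eq, ← LinearMap.ker_eq_bot, Submodule.eq_bot_iff] at hc
  push Not at hc
  obtain ⟨x, hx, hx0⟩ := hc
  refine Module.End.hasEigenvalue_of_hasEigenvector (x := x)
    ⟨Module.End.mem_eigenspace_iff.2 ?_, hx0⟩
  have : f x + c • x = 0 := by simpa using hx
  rw [neg_smul, eq_neg_iff_add_eq_zero, this]

end PowerSpaces

/-! ### Veronese vectors and the pencil of contractions -/

section Veronese

variable {k : Type*} [Field k] {ν : Type*}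

/-- The vector of all monomials of degree `d` in the coordinates of `x`. -/
def veronese (d : ℕ) (x : ν → k) : Sym ν d → k := fun s => ((s : Multiset ν).map x).prod

/-- The contraction `v ↦ v (j, -)`, dual to multiplication of forms with the variable `j`. -/
def contract (d : ℕ) (j : ν) : (Sym ν (d + 1) → k) →ₗ[k] (Sym ν d → k) :=
  LinearMap.funLeft k k fun s => j ::ₛ s

@[simp] theorem contract_apply (d : ℕ) (j : ν) (v : Sym ν (d + 1) → k) (s : Sym ν d) :
    contract d j v s = v (j ::ₛ s) := rfl

theorem contract_veronese (d : ℕ) (j : ν) (x : ν → k) :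
    contract d j (veronese (d + 1) x) = x j • veronese d x := by
  ext s
  rw [contract_apply, veronese, Sym.coe_cons, Multiset.map_cons, Multiset.prod_cons]
  rfl

theorem veronese_ne_zero (d : ℕ) {x : ν → k} (hx : x ≠ 0) : veronese d x ≠ 0 := by
  obtain ⟨j, hj⟩ := Function.ne_iff.mp hx
  intro h
  have := congrFun h (Sym.replicate d j)
  rw [veronese, Sym.coe_replicate, Multiset.map_replicate, Multiset.prod_replicate] at this
  exact pow_ne_zero _ hj this

theorem veronese_smul (d : ℕ) (c : k) (x : ν → k) :
    veronese d (c • x) = c ^ d • veronese d x := by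
  ext s
  simp [veronese, Multiset.prod_map_mul]

theorem exists_contract_ne_zero {d : ℕ} {v : Sym ν (d + 1) → k} (hv : v ≠ 0) :
    ∃ j, contract d j v ≠ 0 := by
  obtain ⟨s, hs⟩ := Function.ne_iff.mp hv
  obtain ⟨j, t, rfl⟩ := Sym.exists_eq_cons_of_succ s
  exact ⟨j, fun h => hs (congrFun h t)⟩

/-- A symmetric tensor all of whose contractions are proportional is a multiple of a Veronese
vector. -/
theorem eq_smul_veronese {d : ℕ} {v : Sym ν (d + 1) → k} {w : Sym ν d → k} {x : ν → k}
    (h : ∀ j, contract d j v = x j • w) {l : ν} (hl : x l ≠ 0) :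
    ∃ c : k, v = c • veronese (d + 1) x := by
  have key : ∀ (s t : Multiset ν) (hs : (s + t).card = d + 1)
      (hs' : (Multiset.replicate s.card l + t).card = d + 1),
      x l ^ s.card * v ⟨s + t, hs⟩ =
        (s.map x).prod * v ⟨Multiset.replicate s.card l + t, hs'⟩ := by
    intro s
    induction s using Multiset.induction_on with
    | empty => intro t hs hs'; simp
    | cons j s ih =>
      intro t hs hs'
      have hst : (s + t).card = d := by simpa [add_right_comm] using hs
      have hst' : s.card + t.card = d := by simpa using hst
      have hcons : ∀ i : ν, ∀ hi, v ⟨i ::ₘ (s + t), hi⟩ = x i * w ⟨s + t, hst⟩ := fun i hi =>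
        congrFun (h i) ⟨s + t, hst⟩
      have e1 := ih (l ::ₘ t) (by simp; omega) (by simp; omega)
      have e2 : v ⟨s + l ::ₘ t, by simp; omega⟩ = x l * w ⟨s + t, hst⟩ := by
        rw [← hcons l (by simp; omega)]
        congr 2
        simp
      have e3 : v ⟨j ::ₘ s + t, hs⟩ = x j * w ⟨s + t, hst⟩ := by
        rw [← hcons j (by simp; omega)]
        congr 2
        simp
      have e4 : (⟨Multiset.replicate (j ::ₘ s).card l + t, hs'⟩ : Sym ν (d + 1)) =
          ⟨Multiset.replicate s.card l + l ::ₘ t, by simp; omega⟩ := by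
        apply Subtype.ext
        simp [Multiset.replicate_succ]
      rw [e4, e3, Multiset.map_cons, Multiset.prod_cons, Multiset.card_cons, pow_succ, mul_assoc,
        mul_assoc, ← e1, e2]
      ring
  refine ⟨v (Sym.replicate (d + 1) l) / x l ^ (d + 1), ?_⟩
  ext s
  have h1 := key s 0 (by simp) (by simp)
  have h2 : (⟨(s : Multiset ν) + 0, by simp⟩ : Sym ν (d + 1)) = s :=
    Subtype.ext (by simp)
  have h3 : (⟨Multiset.replicate (s : Multiset ν).card l + 0, by simp⟩ :
      Sym ν (d + 1)) = Sym.replicate (d + 1) l :=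
    Subtype.ext (by simp [Sym.coe_replicate])
  rw [h2, h3] at h1
  have h4 : (s : Multiset ν).card = d + 1 := s.2
  rw [h4] at h1
  rw [Pi.smul_apply, smul_eq_mul, div_mul_eq_mul_div, eq_div_iff (pow_ne_zero _ hl)]
  rw [veronese, mul_comm, h1, mul_comm]

/-- A form of degree `d` is a linear form in the monomials of degree `d`. -/
theorem exists_linear_eval_veronese {d : ℕ} {G : MvPolynomial ν k} (hG : G.IsHomogeneous d) :
    ∃ Λ : Module.Dual k (Sym ν d → k), ∀ x : ν → k,
      Λ (veronese d x) = MvPolynomial.eval x G := by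
  classical
  have hcard : ∀ e ∈ G.support, (Finsupp.toMultiset e).card = d := fun e he => by
    rw [Finsupp.card_toMultiset]
    have := hG (MvPolynomial.mem_support_iff.mp he)
    rwa [Finsupp.weight_apply, Finsupp.sum_congr (g2 := fun _ n => n) (by simp)] at this
  refine ⟨∑ e ∈ G.support.attach, MvPolynomial.coeff e.1 G •
    LinearMap.proj (R := k) (φ := fun _ : Sym ν d => k) ⟨Finsupp.toMultiset e.1, hcard e.1 e.2⟩,
    fun x => ?_⟩
  rw [MvPolynomial.eval_eq, LinearMap.sum_apply, ← Finset.sum_attach G.support]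
  refine Finset.sum_congr rfl fun e _ => ?_
  refine congrArg (MvPolynomial.coeff e.1 G * ·) ?_
  change (Multiset.map x (Finsupp.toMultiset e.1)).prod = _
  rw [Finsupp.toMultiset_map, Finsupp.prod_toMultiset,
    Finsupp.prod_mapDomain_index (by simp) (by simp [pow_add])]
  rfl

/-- In a suitable degree `d + 1`, a projective variety is cut out from the Veronese variety by the
linear span of its image. -/
theorem exists_degree_veronese_span {n : ℕ} {V : Set (ℙ k (Fin (n + 1) → k))}
    (hV : IsProjectiveVariety V) :
    ∃ d : ℕ, ∀ x : ℙ k (Fin (n + 1) → k), veronese (d + 1) x.rep ∈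
      Submodule.span k ((fun y : ℙ k (Fin (n + 1) → k) => veronese (d + 1) y.rep) '' V) →
      x ∈ V := by
  obtain ⟨S, hS, rfl⟩ := hV
  obtain ⟨S₀, hS₀, hspan⟩ := Submodule.fg_span_iff_fg_span_finset_subset S |>.1
    ((isNoetherianRing_iff_ideal_fg _).1 inferInstance (Ideal.span S))
  choose! r hr using hS
  refine ⟨∑ F ∈ S₀, r F, fun x hx => ?_⟩
  have h0 : ∀ F ∈ S₀, MvPolynomial.eval x.rep F = 0 := by
    intro F hF
    obtain ⟨l, hl⟩ := Function.ne_iff.mp x.rep_nonzero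
    have hle : r F ≤ ∑ F ∈ S₀, r F := Finset.single_le_sum (f := r) (fun _ _ => Nat.zero_le _) hF
    have hG : (MvPolynomial.X l ^ (∑ F ∈ S₀, r F + 1 - r F) * F).IsHomogeneous
        (∑ F ∈ S₀, r F + 1) := by
      have := ((MvPolynomial.isHomogeneous_X k l).pow (∑ F ∈ S₀, r F + 1 - r F)).mul
        (hr F (hS₀ hF))
      rwa [one_mul, Nat.sub_add_cancel (by omega)] at this
    obtain ⟨Λ, hΛ⟩ := exists_linear_eval_veronese hG
    have h1 : Λ (veronese _ x.rep) = 0 := by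
      refine Submodule.span_induction (p := fun v _ => Λ v = 0) ?_ (map_zero _) ?_ ?_ hx
      · rintro _ ⟨y, hy, rfl⟩
        simp only [hΛ, map_mul, hy F (hS₀ hF), mul_zero]
      · intro a b _ _ ha hb; rw [map_add, ha, hb, add_zero]
      · intro c a _ ha; rw [map_smul, ha, smul_zero]
    rw [hΛ, map_mul, map_pow, MvPolynomial.eval_X] at h1
    exact (mul_eq_zero.mp h1).resolve_left (pow_ne_zero _ hl)
  intro F hF
  have h2 : F ∈ Ideal.span (S₀ : Set (MvPolynomial (Fin (n + 1)) k)) := by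
    have : F ∈ Submodule.span (MvPolynomial (Fin (n + 1)) k) S := Submodule.subset_span hF
    rwa [hspan] at this
  refine Submodule.span_induction (p := fun F _ => MvPolynomial.eval x.rep F = 0) h0
    (map_zero _) ?_ ?_ h2
  · intro a b _ _ ha hb; rw [map_add, ha, hb, add_zero]
  · intro c a _ ha; rw [smul_eq_mul, map_mul, ha, mul_zero]

end Veronese

/-! ### Invariant lines of the pencil as invariant subspaces of a pair of operators -/

/-- The conditions on a pair of operators under which, in the cyclic sequence of the subspaces
`y = 0`, `x = 0`, `x = y`, `y = T 0 x`, `y = T 1 x` of `N × N`, any two neighbours are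
independent. -/
def IsGoodPair {k : Type*} [Field k] {N : Type*} [AddCommGroup N] [Module k N]
    (T : Fin 2 → Module.End k N) : Prop :=
  Function.Injective ⇑(T 0 - 1) ∧ Function.Injective ⇑(T 1 - T 0) ∧ Function.Injective (T 1)

theorem exists_isGoodPair_shift {k : Type*} [Field k] [Infinite k] {N : Type*} [AddCommGroup N]
    [Module k N] [Module.Finite k N] (B C : Module.End k N) :
    ∃ b c : k, IsGoodPair ![B + b • (1 : Module.End k N), C + c • (1 : Module.End k N)] := by
  obtain ⟨b, hb⟩ := (finite_not_injective_add_smul (B - 1)).exists_notMem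
  obtain ⟨c, hc⟩ := ((finite_not_injective_add_smul C).union
    (finite_not_injective_add_smul (C - (B + b • (1 : Module.End k N))))).exists_notMem
  simp only [Set.mem_union, Set.mem_ofPred_eq, not_or, not_not] at hb hc
  refine ⟨b, c, ?_, ?_, hc.1⟩
  · convert hb using 2; simp; abel
  · convert hc.2 using 2; simp; abel

section PencilModule

variable {k : Type*} [Field k] {ν : Type*} {d : ℕ}

/-- The vector space on which the pair of operators encoding the pencil of contractions acts:
a space `A` of vectors of degree `d + 1`, and copies of the space of vectors of degree `d`, one for
each contraction and one more. -/
abbrev PencilSpace (A : Submodule k (Sym ν (d + 1) → k)) : Type _ :=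
  A × (Option ν → Sym ν d → k)

variable (A : Submodule k (Sym ν (d + 1) → k))

/-- The operator that separates the summands of `PencilSpace A` by its eigenvalues `μ`. -/
def pencilDiag (μ : Option (Option ν) → k) : Module.End k (PencilSpace A) :=
  LinearMap.prod (μ none • LinearMap.fst k _ _)
    (LinearMap.pi fun j => μ (some j) • (LinearMap.proj j ∘ₗ LinearMap.snd k _ _))

/-- The operator whose block in the copy of index `some j` is the contraction with `j`, plus the
sum of all copies. -/
def pencilMix [Fintype ν] : Module.End k (PencilSpace A) :=
  LinearMap.prod 0 (LinearMap.pi fun j => (j.elim 0 (contract d) ∘ₗ A.subtype) ∘ₗ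
    LinearMap.fst k _ _ + ∑ j' : Option ν, LinearMap.proj j' ∘ₗ LinearMap.snd k _ _)

variable {A}

theorem pencilDiag_apply (μ : Option (Option ν) → k) (u : PencilSpace A) :
    pencilDiag A μ u = (μ none • u.1, fun j => μ (some j) • u.2 j) := rfl

theorem pencilMix_apply [Fintype ν] (u : PencilSpace A) :
    pencilMix A u = (0, fun j => j.elim 0 (contract d) (u.1 : Sym ν (d + 1) → k) +
      ∑ j', u.2 j') := by
  refine Prod.ext rfl (funext fun j => ?_)
  change _ + (∑ j' : Option ν, LinearMap.proj j' ∘ₗ LinearMap.snd k A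
    (Option ν → Sym ν d → k)) u = _
  rw [LinearMap.sum_apply]
  rfl

/-- The line through `v` in `A`, and the line through `w` in each copy. -/
def pencilLine (v : A) (w : Sym ν d → k) : Submodule k (PencilSpace A) :=
  (Submodule.span k {v}).prod (Submodule.pi Set.univ fun _ => Submodule.span k {w})

/-- A product of submodules, as a module, is the product of these modules. -/
def prodSubmoduleEquiv {M N : Type*} [AddCommGroup M] [Module k M] [AddCommGroup N] [Module k N]
    (p : Submodule k M) (q : Submodule k N) : p.prod q ≃ₗ[k] p × q where
  toFun u := (⟨u.1.1, u.2.1⟩, ⟨u.1.2, u.2.2⟩)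
  invFun u := ⟨(u.1, u.2), u.1.2, u.2.2⟩
  map_add' _ _ := rfl
  map_smul' _ _ := rfl
  left_inv _ := rfl
  right_inv _ := rfl

theorem finrank_prod_pi {M N : Type*} [AddCommGroup M] [Module k M] [Module.Finite k M]
    [AddCommGroup N] [Module k N] [Module.Finite k N] [Fintype ν] (p : Submodule k M)
    (q : Submodule k N) :
    Module.finrank k (p.prod (Submodule.pi (Set.univ : Set (Option ν)) fun _ => q)) =
      Module.finrank k p + (Fintype.card ν + 1) * Module.finrank k q := by
  rw [(prodSubmoduleEquiv _ _).finrank_eq, Module.finrank_prod, finrank_pi_const,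
    Fintype.card_option]

theorem exists_eq_span_singleton {M : Type*} [AddCommGroup M] [Module k M] {p : Submodule k M}
    (hp : Module.finrank k p = 1) : ∃ v : M, v ≠ 0 ∧ p = Submodule.span k {v} := by
  obtain ⟨⟨v, hvp⟩, hv0, hv⟩ := finrank_eq_one_iff'.mp hp
  refine ⟨v, fun h => hv0 (Subtype.ext h), le_antisymm (fun w hw => ?_) ?_⟩
  · obtain ⟨c, hc⟩ := hv ⟨w, hw⟩
    exact Submodule.mem_span_singleton.mpr ⟨c, congrArg Subtype.val hc⟩
  · rwa [Submodule.span_singleton_le_iff_mem]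

theorem finrank_pencilLine [Fintype ν] {v : A} {w : Sym ν d → k} (hv : v ≠ 0) (hw : w ≠ 0) :
    Module.finrank k (pencilLine v w) = Fintype.card ν + 2 := by
  rw [pencilLine, finrank_prod_pi, finrank_span_singleton hv, finrank_span_singleton hw]
  ring

theorem pencilLine_invariant [Fintype ν] {v : A} {w : Sym ν d → k} {x : ν → k}
    (h : ∀ j, contract d j v = x j • w) (μ : Option (Option ν) → k) :
    (∀ u ∈ pencilLine v w, pencilDiag A μ u ∈ pencilLine v w) ∧
      ∀ u ∈ pencilLine v w, pencilMix A u ∈ pencilLine v w := by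
  refine ⟨fun u hu => ⟨Submodule.smul_mem _ _ hu.1, fun j hj => Submodule.smul_mem _ _
    (hu.2 j hj)⟩, fun u hu => ?_⟩
  rw [pencilMix_apply]
  refine ⟨Submodule.zero_mem _, fun j _ => Submodule.add_mem _ ?_
    (Submodule.sum_mem _ fun j' _ => hu.2 j' trivial)⟩
  obtain ⟨c, hc⟩ := Submodule.mem_span_singleton.mp hu.1
  rcases j with _ | j
  · exact Submodule.zero_mem _
  · change contract d j (u.1 : Sym ν (d + 1) → k) ∈ _
    rw [← hc, Submodule.coe_smul, map_smul, h]
    exact Submodule.smul_mem _ _ (Submodule.smul_mem _ _ (Submodule.mem_span_singleton_self w))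

/-- An invariant subspace of dimension `card ν + 2` of `PencilSpace A` is a `pencilLine`. -/
theorem exists_eq_pencilLine [Fintype ν] [Nonempty ν] {μ : Option (Option ν) → k}
    (hμ : Function.Injective μ) {U : Submodule k (PencilSpace A)}
    (h₁ : ∀ u ∈ U, pencilDiag A μ u ∈ U) (h₂ : ∀ u ∈ U, pencilMix A u ∈ U)
    (hU : Module.finrank k U = Fintype.card ν + 2) :
    ∃ (v : A) (w : Sym ν d → k) (x : ν → k), v ≠ 0 ∧ w ≠ 0 ∧
      (∀ j, contract d j v = x j • w) ∧ U = pencilLine v w := by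
  classical
  -- the summands, indexed so that `mem_of_distinct_eigenvalues` applies
  let p : ∀ o : Option (Option ν), PencilSpace A →ₗ[k] PencilSpace A := fun o =>
    o.elim (LinearMap.prod (LinearMap.fst k _ _) 0)
      fun j => LinearMap.prod 0 (LinearMap.single k _ j ∘ₗ LinearMap.proj j ∘ₗ LinearMap.snd k _ _)
  have hp0 : ∀ u, p none u = (u.1, 0) := fun u => rfl
  have hps : ∀ j u, p (some j) u = (0, Pi.single j (u.2 j)) := fun j u => rfl
  have hp : ∀ u v : PencilSpace A, (∀ o, p o u = p o v) → u = v := by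
    intro u v h
    have h0 := h none
    rw [hp0, hp0] at h0
    refine Prod.ext (Prod.mk.inj h0).1 (funext fun j => ?_)
    have := congrFun (congrArg Prod.snd (h (some j))) j
    simpa [hps] using this
  have hT : ∀ o u, p o (pencilDiag A μ u) = μ o • p o u := by
    rintro (_ | j) u
    · rw [hp0, hp0, pencilDiag_apply, Prod.smul_mk, smul_zero]
    · rw [hps, hps, pencilDiag_apply, Prod.smul_mk, smul_zero, ← Pi.single_smul]
  have hcomp : ∀ o, ∀ u ∈ U, p o u ∈ U := by
    intro o u hu
    refine mem_of_distinct_eigenvalues (M := fun _ => PencilSpace A) p hp hμ hT h₁ hu o ?_ ?_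
    · rcases o with _ | j
      · rfl
      · simp [hps]
    · rintro o' ho'
      rcases o with _ | j <;> rcases o' with _ | j'
      · exact absurd rfl ho'
      · simp [hps, hp0]
      · simp [hps, hp0]
      · have : j' ≠ j := fun h => ho' (by rw [h])
        simp [hps, Pi.single_eq_of_ne this]
  let UA : Submodule k A := U.comap (LinearMap.inl k _ _)
  let W : Submodule k (Sym ν d → k) :=
    U.comap (LinearMap.inr k _ _ ∘ₗ LinearMap.single k (fun _ => Sym ν d → k) none)
  have hconst : ∀ (j : Option ν) (w : Sym ν d → k),
      ((0, Pi.single j w) : PencilSpace A) ∈ U → ∀ j', ((0, Pi.single j' w) : PencilSpace A) ∈ U := by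
    intro j w hw j'
    have h3 := hcomp (some j') _ (h₂ _ hw)
    rw [hps, pencilMix_apply] at h3
    convert h3 using 3
    rcases j' with _ | j' <;> simp
  have hUeq : U = UA.prod (Submodule.pi (Set.univ : Set (Option ν)) fun _ => W) := by
    apply le_antisymm
    · intro u hu
      exact ⟨hcomp none u hu, fun j _ => hconst j _ (hcomp (some j) u hu) none⟩
    · intro u hu
      have h4 : u = (u.1, 0) + ∑ j, ((0, Pi.single j (u.2 j)) : PencilSpace A) := by
        refine Prod.ext ?_ ?_
        · simp [Prod.fst_sum]
        · simp only [Prod.snd_add, Prod.snd_sum, zero_add, Finset.univ_sum_single]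
      rw [h4]
      exact U.add_mem hu.1 (U.sum_mem fun j _ => hconst none _ (hu.2 j trivial) j)
  have hcontr : ∀ a ∈ UA, ∀ j, contract d j (a : Sym ν (d + 1) → k) ∈ W := by
    intro a ha j
    have h3 := hcomp (some (some j)) _ (h₂ _ ha)
    rw [hps, pencilMix_apply] at h3
    refine hconst (some j) _ ?_ none
    convert h3 using 3
    simp
  rw [hUeq, finrank_prod_pi] at hU
  have hcard : 0 < Fintype.card ν := Fintype.card_pos
  have hW0 : Module.finrank k W ≠ 0 := by
    intro h0
    have hWbot : W = ⊥ := Submodule.finrank_eq_zero.mp h0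
    have hUA : UA = ⊥ := by
      rw [Submodule.eq_bot_iff]
      intro a ha
      by_contra hne
      obtain ⟨j, hj⟩ := exists_contract_ne_zero (v := (a : Sym ν (d + 1) → k))
        (fun h => hne (Subtype.ext h))
      have := hcontr a ha j
      rw [hWbot, Submodule.mem_bot] at this
      exact hj this
    rw [h0, hUA, finrank_bot] at hU
    omega
  have hW1 : Module.finrank k W = 1 := by
    by_contra hne
    have h2 : 2 ≤ Module.finrank k W := by omega
    have : (Fintype.card ν + 1) * 2 ≤ (Fintype.card ν + 1) * Module.finrank k W :=
      Nat.mul_le_mul_left _ h2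
    omega
  have hA1 : Module.finrank k UA = 1 := by rw [hW1] at hU; omega
  obtain ⟨w, hw0, hWs⟩ := exists_eq_span_singleton hW1
  obtain ⟨v, hv0, hAs⟩ := exists_eq_span_singleton hA1
  have hvA : v ∈ UA := by rw [hAs]; exact Submodule.mem_span_singleton_self v
  have hx : ∀ j, ∃ c : k, contract d j (v : Sym ν (d + 1) → k) = c • w := by
    intro j
    have := hcontr v hvA j
    rw [hWs, Submodule.mem_span_singleton] at this
    obtain ⟨c, hc⟩ := this
    exact ⟨c, hc.symm⟩
  choose x hx using hx
  refine ⟨v, w, x, hv0, hw0, hx, ?_⟩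
  rw [hUeq, hWs, hAs, pencilLine]

end PencilModule

/-! ### Plücker coordinates of a family of subspaces -/

section Plucker

variable {k : Type*} [Field k]

/-- Any basis of a subspace computes its Plücker point. -/
theorem exists_rep_pluckerPoint {E : Type*} [AddCommGroup E] [Module k E] [Module.Finite k E]
    {d : ℕ} {U : Submodule k E} (hU : Module.finrank k U = d) {v : Fin d → E}
    (hvU : ∀ t, v t ∈ U) (hv : LinearIndependent k v) :
    ∃ c : k, c ≠ 0 ∧ (pluckerPoint d U hU).rep = c • exteriorPower.ιMulti k d v := by
  let b := Module.finBasisOfFinrankEq k U hU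
  let v' : Fin d → U := fun t => ⟨v t, hvU t⟩
  have h1 : exteriorPower.ιMulti k d v =
      b.det v' • exteriorPower.ιMulti k d fun t => (b t : E) := by
    rw [← sub_eq_zero, ← Module.forall_dual_apply_eq_zero_iff k]
    intro s
    have h := AlternatingMap.congr_fun (AlternatingMap.eq_smul_basis_det b
      ((s.compAlternatingMap (exteriorPower.ιMulti k d)).compLinearMap U.subtype)) v'
    rw [map_sub, sub_eq_zero, map_smul, smul_eq_mul, mul_comm]
    exact h
  have h0 := ιMulti_ne_zero_of_linearIndependent hv
  have hdet : b.det v' ≠ 0 := fun h => h0 (by rw [h1, h, zero_smul])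
  obtain ⟨a, ha⟩ := Projectivization.exists_smul_eq_mk_rep k
    (exteriorPower.ιMulti k d fun t => (b t : E))
    (ιMulti_ne_zero_of_linearIndependent
      (b.linearIndependent.map' U.subtype U.ker_subtype))
  refine ⟨a * (b.det v')⁻¹, mul_ne_zero a.ne_zero (inv_ne_zero hdet), ?_⟩
  rw [h1, smul_smul, inv_mul_cancel_right₀ hdet]
  exact ha.symm

theorem linearIndependent_of_dual {ι E : Type*} [AddCommGroup E] [Module k E] {v : ι → E}
    (f : ι → Module.Dual k E) (hne : ∀ t, f t (v t) ≠ 0) (h0 : ∀ r t, r ≠ t → f r (v t) = 0) :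
    LinearIndependent k v := by
  rw [linearIndependent_iff']
  intro s g hg i hi
  have h := congrArg (f i) hg
  rw [map_sum, map_zero, Finset.sum_eq_single_of_mem i hi] at h
  · rw [map_smul, smul_eq_mul] at h
    exact (mul_eq_zero.mp h).resolve_right (hne i)
  · intro t _ ht
    rw [map_smul, h0 i t ht.symm, smul_zero]

/-- The linear form on the exterior power that sends `u₁ ∧ ⋯ ∧ u_d` to the determinant of the
values `f r (u t)`. -/
def minorForm {E : Type*} [AddCommGroup E] [Module k E] {d : ℕ} (f : Fin d → Module.Dual k E) :
    Module.Dual k (⋀[k]^d E) :=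
  exteriorPower.alternatingMapLinearEquiv
    (Matrix.detRowAlternating.compLinearMap (LinearMap.pi f))

theorem minorForm_ιMulti_of_diagonal {E : Type*} [AddCommGroup E] [Module k E] {d : ℕ}
    (f : Fin d → Module.Dual k E) {v : Fin d → E} (h : ∀ r t, r ≠ t → f r (v t) = 0) :
    minorForm f (exteriorPower.ιMulti k d v) = ∏ t, f t (v t) := by
  rw [minorForm, exteriorPower.alternatingMapLinearEquiv_apply_ιMulti]
  change Matrix.det (Matrix.of fun t r => f r (v t)) = _
  rw [← Matrix.det_diagonal]
  congr 1
  ext t r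
  by_cases hrt : t = r
  · subst hrt; simp
  · rw [Matrix.diagonal_apply_ne _ hrt]
    exact h r t (Ne.symm hrt)

/-- The function `f` of the vector `x` is given by a form of degree `D`. -/
def IsFormOfDegree {ν : Type*} (D : ℕ) (f : (ν → k) → k) : Prop :=
  ∃ P : CoordPoly k (fun _ : Unit => ν → k), IsMultihomogeneous P (Finsupp.single () D) ∧
    ∀ x, MvPolynomial.eval (fun s : Σ _ : Unit, Module.Dual k (ν → k) => s.2 x) P = f x

variable {ν : Type*}

theorem IsFormOfDegree.prod {ι : Type*} (s : Finset ι) {D : ι → ℕ} {f : ι → (ν → k) → k}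
    (h : ∀ i ∈ s, IsFormOfDegree (D i) (f i)) :
    IsFormOfDegree (∑ i ∈ s, D i) fun x => ∏ i ∈ s, f i x := by
  choose! P hP hPf using h
  refine ⟨∏ i ∈ s, P i, ?_, fun x => ?_⟩
  · have := MvPolynomial.IsWeightedHomogeneous.prod s P _ hP
    rw [← Finsupp.single_finsetSum] at this
    exact this
  · rw [map_prod]
    exact Finset.prod_congr rfl fun i hi => hPf i hi x

theorem IsFormOfDegree.sum {ι : Type*} (s : Finset ι) {D : ℕ} {f : ι → (ν → k) → k}
    (h : ∀ i ∈ s, IsFormOfDegree D (f i)) :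
    IsFormOfDegree D fun x => ∑ i ∈ s, f i x := by
  choose! P hP hPf using h
  refine ⟨∑ i ∈ s, P i, MvPolynomial.IsWeightedHomogeneous.sum s P _ hP, fun x => ?_⟩
  rw [map_sum]
  exact Finset.sum_congr rfl fun i hi => hPf i hi x

theorem IsFormOfDegree.mul_const {D : ℕ} {f : (ν → k) → k} (h : IsFormOfDegree D f) (c : k) :
    IsFormOfDegree D fun x => f x * c := by
  obtain ⟨P, hP, hPf⟩ := h
  refine ⟨P * MvPolynomial.C c, ?_, fun x => by rw [map_mul, hPf, MvPolynomial.eval_C]⟩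
  have := MvPolynomial.IsWeightedHomogeneous.mul hP (MvPolynomial.isWeightedHomogeneous_C _ c)
  rwa [add_zero] at this

theorem isFormOfDegree_veronese (d : ℕ) (s : Sym ν d) :
    IsFormOfDegree d fun x : ν → k => veronese d x s := by
  obtain ⟨s, rfl⟩ := s
  induction s using Multiset.induction_on with
  | empty =>
    refine ⟨1, ?_, fun x => ?_⟩
    · rw [Multiset.card_zero, Finsupp.single_zero]
      exact MvPolynomial.isWeightedHomogeneous_one _ _
    · change _ = (Multiset.map x 0).prod
      rw [map_one, Multiset.map_zero, Multiset.prod_zero]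
  | cons j s ih =>
    obtain ⟨P, hP, hPf⟩ := ih
    refine ⟨MvPolynomial.X ⟨(), LinearMap.proj j⟩ * P, ?_, fun x => ?_⟩
    · have := (MvPolynomial.isWeightedHomogeneous_X k
        (fun s : Σ _ : Unit, Module.Dual k (ν → k) => Finsupp.single s.1 1)
        ⟨(), LinearMap.proj j⟩).mul hP
      rw [← Finsupp.single_add] at this
      rwa [Multiset.card_cons, add_comm]
    · rw [map_mul, hPf, MvPolynomial.eval_X]
      simp [veronese]

/-- A multilinear function of linear images of Veronese vectors is a form. -/
theorem isFormOfDegree_multilinear [Fintype ν] {E : Type*} [AddCommGroup E] [Module k E]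
    {ι : Type*} [Fintype ι] (m : MultilinearMap k (fun _ : ι => E) k) (δ : ι → ℕ)
    (L : ∀ t, (Sym ν (δ t) → k) →ₗ[k] E) :
    IsFormOfDegree (∑ t, δ t) fun x => m fun t => L t (veronese (δ t) x) := by
  classical
  have h : ∀ x : ν → k, (m fun t => L t (veronese (δ t) x)) =
      ∑ s : ∀ t, Sym ν (δ t), (∏ t, veronese (δ t) x (s t)) *
        m fun t => L t (Pi.single (s t) 1) := by
    intro x
    have h1 : ∀ t, L t (veronese (δ t) x) =
        ∑ s, veronese (δ t) x s • L t (Pi.single s 1) := by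
      intro t
      conv_lhs => rw [pi_eq_sum_univ' (veronese (δ t) x), map_sum]
      refine Finset.sum_congr rfl fun s _ => ?_
      rw [map_smul]
    simp_rw [h1]
    rw [MultilinearMap.map_sum]
    refine Finset.sum_congr rfl fun s _ => ?_
    rw [MultilinearMap.map_smul_univ, smul_eq_mul]
  simp_rw [h]
  refine IsFormOfDegree.sum _ fun s _ => IsFormOfDegree.mul_const ?_ _
  exact IsFormOfDegree.prod _ fun t _ => isFormOfDegree_veronese _ _

end Plucker

/-! ### Parametrisation of a variety by forms -/

section Parametrisation

variable {k : Type*} [Field k] {n : ℕ} {V : Set (ℙ k (Fin (n + 1) → k))} {Y : Type*} {κ : Type*}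
  {Z : κ → Type*} [∀ j, AddCommGroup (Z j)] [∀ j, Module k (Z j)]
  {ψ : ∀ j, Y → ℙ k (Z j)} {col : ∀ j, (Fin (n + 1) → k) → Z j} {i₀ : κ}

theorem injective_of_coordinates {E : V → Y}
    (hrep : ∀ (x : V) j, ∃ c : k, c ≠ 0 ∧ (ψ j (E x)).rep = c • col j x.1.rep)
    (hcoord : ∀ l, ∃ s : Fin (n + 1) → Module.Dual k (Z i₀), ∀ x : V, ∃ q : k,
      (x.1.rep l ≠ 0 → q ≠ 0) ∧ ∀ j, s j (col i₀ x.1.rep) = x.1.rep j * q) :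
    Function.Injective E := by
  intro x y hxy
  obtain ⟨l, hl⟩ := Function.ne_iff.mp x.1.rep_nonzero
  obtain ⟨s, hs⟩ := hcoord l
  obtain ⟨q, hq, hsq⟩ := hs x
  obtain ⟨q', -, hsq'⟩ := hs y
  obtain ⟨c, hc, hcx⟩ := hrep x i₀
  obtain ⟨c', -, hcy⟩ := hrep y i₀
  have hcq : c * q ≠ 0 := mul_ne_zero hc (hq hl)
  have h : ∀ j, c * (x.1.rep j * q) = c' * (y.1.rep j * q') := by
    intro j
    have h1 := congrArg (s j) (hcx.symm.trans ((congrArg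
      (fun e => (ψ i₀ e).rep) hxy).trans hcy))
    rwa [map_smul, map_smul, smul_eq_mul, smul_eq_mul, hsq, hsq'] at h1
  apply Subtype.ext
  rw [← x.1.mk_rep, ← y.1.mk_rep, Projectivization.mk_eq_mk_iff']
  refine ⟨(c * q)⁻¹ * (c' * q'), funext fun j => ?_⟩
  rw [Pi.smul_apply, smul_eq_mul, mul_assoc, inv_mul_eq_iff_eq_mul₀ hcq]
  linear_combination -h j

/-- A bijection that is given by forms in the homogeneous coordinates, and such that these
coordinates are, up to a common factor, linear functions of the values in one of the projective
spaces, is an isomorphism of varieties. -/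
theorem isVarietyIso_of_forms {e : V ≃ Y}
    (hform : ∀ j, ∃ N : ℕ, ∀ s : Module.Dual k (Z j), IsFormOfDegree N fun x => s (col j x))
    (hrep : ∀ (x : V) j, ∃ c : k, c ≠ 0 ∧ (ψ j (e x)).rep = c • col j x.1.rep)
    (hcoord : ∀ l, ∃ s : Fin (n + 1) → Module.Dual k (Z i₀), ∀ x : V, ∃ q : k,
      (x.1.rep l ≠ 0 → q ≠ 0) ∧ ∀ j, s j (col i₀ x.1.rep) = x.1.rep j * q) :
    IsVarietyIso (projectiveInclusion V) ψ e := by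
  refine IsPolyMorphism.isVarietyIso ?_ ?_
  · intro _
    choose N P hP hPe using hform
    refine ⟨Set.univ, @isOpen_univ _ (zariskiTopology _), trivial,
      fun i => Finsupp.single () (N i), P, hP, fun x _ => ?_⟩
    choose c hc hcx using hrep x
    refine ⟨c, hc, fun i s => ?_⟩
    rw [coordEval, hcx, map_smul, smul_eq_mul]
    congr 1
    exact (hPe i s x.1.rep).symm
  · intro y₀
    obtain ⟨x₀, rfl⟩ := e.surjective y₀
    obtain ⟨l, hl⟩ := Function.ne_iff.mp x₀.1.rep_nonzero
    obtain ⟨s, hs⟩ := hcoord l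
    let X : Fin (n + 1) → CoordPoly k Z := fun j => MvPolynomial.X ⟨i₀, s j⟩
    have hX : ∀ j, IsMultihomogeneous (X j) (Finsupp.single i₀ 1) := fun j =>
      MvPolynomial.isWeightedHomogeneous_X _ _ _
    have hXe : ∀ x : V, ∃ q : k, (x.1.rep l ≠ 0 → q ≠ 0) ∧
        ∀ j, coordEval ψ (X j) (e x) = q * x.1.rep j := by
      intro x
      obtain ⟨q, hq, hsq⟩ := hs x
      obtain ⟨c, hc, hcx⟩ := hrep x i₀
      refine ⟨c * q, fun h => mul_ne_zero hc (hq h), fun j => ?_⟩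
      rw [coordEval, MvPolynomial.eval_X, hcx, map_smul, hsq, smul_eq_mul]
      ring
    refine ⟨{y | coordEval ψ (X l) y ≠ 0},
      isOpen_coordEval_ne_zero _ (hX l), ?_, fun _ => Finsupp.single i₀ 1,
      fun _ ξ => ∑ j, X j * MvPolynomial.C (ξ (Pi.single j 1)), ?_, ?_⟩
    · obtain ⟨q, hq, hqx⟩ := hXe x₀
      change coordEval _ (X l) (e x₀) ≠ 0
      rw [hqx]
      exact mul_ne_zero (hq hl) hl
    · intro _ ξ
      refine MvPolynomial.IsWeightedHomogeneous.sum _ _ _ fun j _ => ?_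
      have h := MvPolynomial.IsWeightedHomogeneous.mul (hX j)
        (MvPolynomial.isWeightedHomogeneous_C _ (ξ (Pi.single j 1)))
      rwa [add_zero] at h
    · intro y hy
      obtain ⟨x, rfl⟩ := e.surjective y
      obtain ⟨q, hq, hqx⟩ := hXe x
      have hy' : q * x.1.rep l ≠ 0 := by rw [← hqx]; exact hy
      have hq0 : q ≠ 0 := left_ne_zero_of_mul hy'
      refine ⟨fun _ => q⁻¹, fun _ => inv_ne_zero hq0, fun _ ξ => ?_⟩
      rw [e.symm_apply_apply]
      have h1 : coordEval ψ (∑ j, X j * MvPolynomial.C (ξ (Pi.single j 1))) (e x) =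
          ∑ j, (q * x.1.rep j) * ξ (Pi.single j 1) := by
        rw [coordEval, map_sum]
        refine Finset.sum_congr rfl fun j _ => ?_
        rw [map_mul, MvPolynomial.eval_C, ← hqx]
        rfl
      rw [h1, eq_inv_mul_iff_mul_eq₀ hq0]
      change q * ξ x.1.rep = _
      conv_lhs => rw [pi_eq_sum_univ' x.1.rep, map_sum, Finset.mul_sum]
      refine Finset.sum_congr rfl fun j _ => ?_
      rw [map_smul, smul_eq_mul, mul_assoc]

end Parametrisation

/-! ### From full families to quiver Grassmannians -/

section FullFamily

variable {k : Type u} [Field k] {n d : ℕ} {A : Submodule k (Sym (Fin (n + 1)) (d + 1) → k)}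
  {G : Type}

@[simp] theorem veronese_replicate {ν : Type*} (d : ℕ) (x : ν → k) (l : ν) :
    veronese d x (Sym.replicate d l) = x l ^ d := by
  rw [veronese, Sym.coe_replicate, Multiset.map_replicate, Multiset.prod_replicate]

/-- The standard basis of `G → pencilLine v w` for the Veronese vectors `v`, `w` of `x`; the vector
`v` is moved into `A` by the projection `ρ`. -/
def pencilColumn (G : Type) (ρ : (Sym (Fin (n + 1)) (d + 1) → k) →ₗ[k] A)
    (x : Fin (n + 1) → k) :
    G × Option (Option (Fin (n + 1))) → G → PencilSpace A := by
  classical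
  exact fun t => Pi.single t.1
    (t.2.elim (ρ (veronese (d + 1) x), 0) fun j => (0, Pi.single j (veronese d x)))

/-- The coordinate functional of degree `d + 1` or `d` that reads off the vector of index `t`: the
entry at `s` of the component in `A`, and the entry at `l ^ d` of the other components. -/
def pencilCoord (A : Submodule k (Sym (Fin (n + 1)) (d + 1) → k)) (l : Fin (n + 1))
    (s : Sym (Fin (n + 1)) (d + 1)) (t : G × Option (Option (Fin (n + 1)))) :
    Module.Dual k (G → PencilSpace A) :=
  (t.2.elim (LinearMap.proj s ∘ₗ A.subtype ∘ₗ LinearMap.fst k _ _)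
    fun j => LinearMap.proj (Sym.replicate d l) ∘ₗ LinearMap.proj j ∘ₗ LinearMap.snd k _ _) ∘ₗ
      LinearMap.proj t.1

theorem pencilCoord_column_of_ne (ρ : (Sym (Fin (n + 1)) (d + 1) → k) →ₗ[k] A)
    (x : Fin (n + 1) → k) (l : Fin (n + 1)) (s : Sym (Fin (n + 1)) (d + 1))
    {r t : G × Option (Option (Fin (n + 1)))} (h : r ≠ t) :
    pencilCoord A l s r (pencilColumn G ρ x t) = 0 := by
  classical
  obtain ⟨g, o⟩ := r
  obtain ⟨g', o'⟩ := t
  by_cases hg : g = g'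
  · subst hg
    have ho : o ≠ o' := fun h' => h (by rw [h'])
    rcases o with _ | j <;> rcases o' with _ | j'
    · exact absurd rfl ho
    · simp [pencilCoord, pencilColumn]
    · simp [pencilCoord, pencilColumn]
    · have hj : j ≠ j' := fun h' => ho (by rw [h'])
      simp [pencilCoord, pencilColumn, Pi.single_eq_of_ne hj]
  · rcases o with _ | j <;> simp [pencilCoord, pencilColumn, Pi.single_eq_of_ne hg]

theorem pencilCoord_column_none (ρ : (Sym (Fin (n + 1)) (d + 1) → k) →ₗ[k] A)
    (hρ : ∀ a : A, ρ a = a) {x : Fin (n + 1) → k} (hx : veronese (d + 1) x ∈ A)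
    (l : Fin (n + 1)) (s : Sym (Fin (n + 1)) (d + 1)) (g : G) :
    pencilCoord A l s (g, none) (pencilColumn G ρ x (g, none)) = veronese (d + 1) x s := by
  classical
  have h : ρ (veronese (d + 1) x) = ⟨_, hx⟩ := hρ ⟨_, hx⟩
  simp [pencilCoord, pencilColumn, h]

theorem pencilCoord_column_some (ρ : (Sym (Fin (n + 1)) (d + 1) → k) →ₗ[k] A)
    (x : Fin (n + 1) → k) (l : Fin (n + 1)) (s : Sym (Fin (n + 1)) (d + 1)) (g : G)
    (j : Option (Fin (n + 1))) :
    pencilCoord A l s (g, some j) (pencilColumn G ρ x (g, some j)) = x l ^ d := by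
  classical
  simp [pencilCoord, pencilColumn]

theorem linearIndependent_pencilColumn (ρ : (Sym (Fin (n + 1)) (d + 1) → k) →ₗ[k] A)
    (hρ : ∀ a : A, ρ a = a) {x : Fin (n + 1) → k} (hx0 : x ≠ 0)
    (hx : veronese (d + 1) x ∈ A) : LinearIndependent k (pencilColumn G ρ x) := by
  obtain ⟨l, hl⟩ := Function.ne_iff.mp hx0
  refine linearIndependent_of_dual (pencilCoord A l (Sym.replicate (d + 1) l)) ?_
    fun r t h => pencilCoord_column_of_ne ρ x l _ h
  rintro ⟨g, _ | j⟩
  · rw [pencilCoord_column_none ρ hρ hx]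
    simpa [veronese] using hl
  · rw [pencilCoord_column_some]
    exact pow_ne_zero _ hl

theorem pencilColumn_mem (ρ : (Sym (Fin (n + 1)) (d + 1) → k) →ₗ[k] A)
    (hρ : ∀ a : A, ρ a = a) {x : Fin (n + 1) → k} (hx : veronese (d + 1) x ∈ A)
    (t : G × Option (Option (Fin (n + 1)))) :
    pencilColumn G ρ x t ∈ Submodule.pi (Set.univ : Set G)
      fun _ => pencilLine (⟨_, hx⟩ : A) (veronese d x) := by
  classical
  have h : ρ (veronese (d + 1) x) = ⟨_, hx⟩ := hρ ⟨_, hx⟩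
  obtain ⟨g, o⟩ := t
  intro g' _
  by_cases hg : g' = g
  · subst hg
    rcases o with _ | j
    · simp only [pencilColumn, Pi.single_eq_same, Option.elim_none, h]
      exact ⟨Submodule.mem_span_singleton_self _, fun _ _ => Submodule.zero_mem _⟩
    · simp only [pencilColumn, Pi.single_eq_same, Option.elim_some]
      refine ⟨Submodule.zero_mem _, fun j' _ => ?_⟩
      by_cases hj : j' = j
      · subst hj
        simp
      · simp [Pi.single_eq_of_ne hj]
  · simp [pencilColumn, Pi.single_eq_of_ne hg]

/-- The Plücker coordinates of the span of the columns are forms in `x`. -/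
theorem exists_isFormOfDegree_pencilColumn (ρ : (Sym (Fin (n + 1)) (d + 1) → k) →ₗ[k] A)
    {D : ℕ} (τ : Fin D → G × Option (Option (Fin (n + 1)))) :
    ∃ N : ℕ, ∀ s : Module.Dual k (⋀[k]^D (G → PencilSpace A)), IsFormOfDegree N fun x =>
      s (exteriorPower.ιMulti k D fun t => pencilColumn G ρ x (τ t)) := by
  classical
  have h : ∀ t, ∃ (δ : ℕ) (L : (Sym (Fin (n + 1)) δ → k) →ₗ[k] (G → PencilSpace A)),
      ∀ x, pencilColumn G ρ x (τ t) = L (veronese δ x) := by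
    intro t
    obtain ⟨g, _ | j⟩ := τ t
    · exact ⟨d + 1, LinearMap.single k (fun _ => PencilSpace A) g ∘ₗ LinearMap.inl k _ _ ∘ₗ ρ,
        fun x => by simp [pencilColumn]⟩
    · exact ⟨d, LinearMap.single k (fun _ => PencilSpace A) g ∘ₗ LinearMap.inr k _ _ ∘ₗ
        LinearMap.single k (fun _ => Sym (Fin (n + 1)) d → k) j,
        fun x => by simp [pencilColumn]⟩
  choose δ L hL using h
  refine ⟨∑ t, δ t, fun s => ?_⟩
  simp_rw [hL]
  exact isFormOfDegree_multilinear
    (s.compAlternatingMap (exteriorPower.ιMulti k D)).toMultilinearMap δ L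

/-- The coordinates of `x`, multiplied with a common factor, are Plücker coordinates of the span of
the columns. -/
theorem exists_form_eq_coordinate (ρ : (Sym (Fin (n + 1)) (d + 1) → k) →ₗ[k] A)
    (hρ : ∀ a : A, ρ a = a) {D : ℕ} (τ : Fin D ≃ G × Option (Option (Fin (n + 1)))) [Nonempty G]
    (l : Fin (n + 1)) :
    ∃ s : Fin (n + 1) → Module.Dual k (⋀[k]^D (G → PencilSpace A)),
      ∀ x : Fin (n + 1) → k, veronese (d + 1) x ∈ A →
        ∃ q : k, (x l ≠ 0 → q ≠ 0) ∧ ∀ j,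
          s j (exteriorPower.ιMulti k D fun t => pencilColumn G ρ x (τ t)) = x j * q := by
  classical
  obtain ⟨g₀⟩ := ‹Nonempty G›
  -- replace one of the factors `x l ^ (d + 1)` of the diagonal minor by `x j * x l ^ d`
  let t₀ : Fin D := τ.symm (g₀, none)
  let f : Fin (n + 1) → Fin D → Module.Dual k (G → PencilSpace A) := fun j t =>
    pencilCoord A l (if t = t₀ then j ::ₛ Sym.replicate d l else Sym.replicate (d + 1) l) (τ t)
  refine ⟨fun j => minorForm (f j), fun x hx => ?_⟩
  refine ⟨x l ^ d * ∏ t ∈ Finset.univ.erase t₀,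
    pencilCoord A l (Sym.replicate (d + 1) l) (τ t) (pencilColumn G ρ x (τ t)), fun hl => ?_,
    fun j => ?_⟩
  · refine mul_ne_zero (pow_ne_zero _ hl) (Finset.prod_ne_zero_iff.mpr fun t _ => ?_)
    obtain ⟨g, _ | j⟩ := τ t
    · rw [pencilCoord_column_none ρ hρ hx]
      simpa [veronese] using hl
    · rw [pencilCoord_column_some]
      exact pow_ne_zero _ hl
  · rw [minorForm_ιMulti_of_diagonal]
    · rw [← Finset.mul_prod_erase Finset.univ _ (Finset.mem_univ t₀), ← mul_assoc]
      congr 1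
      · simp only [f, if_true, t₀, Equiv.apply_symm_apply]
        rw [pencilCoord_column_none ρ hρ hx]
        refine (congrFun (contract_veronese d j x) (Sym.replicate d l)).trans ?_
        simp
      · refine Finset.prod_congr rfl fun t ht => ?_
        simp only [f, if_neg (Finset.ne_of_mem_erase ht)]
    · intro r t hrt
      exact pencilCoord_column_of_ne ρ x l _ fun h => hrt (τ.injective h)

/-- A family that is full for all good pairs of operators realizes every projective variety as a
quiver Grassmannian. -/
theorem QuiverFamily.exists_isVarietyIso [Infinite k] {Q : Type*} [Quiver Q]
    (F : QuiverFamily k Q 2)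
    (hF : ∀ (N : Type u) [AddCommGroup N] [Module k N] [Module.Finite k N]
      (T : Fin 2 → Module.End k N), IsGoodPair T → F.IsFullFor T)
    (i₀ : Q) [Nonempty (F.G i₀)]
    {V : Set (ℙ k (Fin (n + 1) → k))} (hV : IsProjectiveVariety V) :
    ∃ (M : QuiverRep k Q) (d : Q → ℕ) (e : V ≃ QuiverGrassmannian M d),
      IsVarietyIso (projectiveInclusion V) (quiverPlucker M d) e := by
  classical
  obtain ⟨d, hd⟩ := exists_degree_veronese_span hV
  let A := Submodule.span k
    ((fun y : ℙ k (Fin (n + 1) → k) => veronese (d + 1) y.rep) '' V)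
  have hA : ∀ x : V, veronese (d + 1) x.1.rep ∈ A := fun x =>
    Submodule.subset_span ⟨x.1, x.2, rfl⟩
  obtain ⟨ρ, hρ'⟩ := A.subtype.exists_leftInverse_of_injective A.ker_subtype
  have hρ : ∀ a : A, ρ a = a := fun a => LinearMap.congr_fun hρ' a
  obtain ⟨μ, hμ⟩ : ∃ μ : Option (Option (Fin (n + 1))) → k, Function.Injective μ :=
    ⟨fun o => Infinite.natEmbedding k (Fintype.equivFin _ o),
      (Infinite.natEmbedding k).injective.comp
        (Fin.val_injective.comp (Fintype.equivFin _).injective)⟩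
  obtain ⟨b, c, hT⟩ := exists_isGoodPair_shift (pencilDiag A μ) (pencilMix A)
  set T : Fin 2 → Module.End k (PencilSpace A) := ![pencilDiag A μ + b • 1, pencilMix A + c • 1]
    with hTdef
  let D : Q → ℕ := fun i => Fintype.card (F.G i) * (n + 3)
  let line : V → Submodule k (PencilSpace A) := fun x =>
    pencilLine (⟨_, hA x⟩ : A) (veronese d x.1.rep)
  have hline : ∀ x t, ∀ u ∈ line x, T t u ∈ line x := by
    intro x t u hu
    have h := pencilLine_invariant (v := (⟨_, hA x⟩ : A)) (w := veronese d x.1.rep)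
      (x := x.1.rep) (fun j => contract_veronese d j _) μ
    fin_cases t
    · exact Submodule.add_mem _ (h.1 u hu) (Submodule.smul_mem _ _ hu)
    · exact Submodule.add_mem _ (h.2 u hu) (Submodule.smul_mem _ _ hu)
  have hfin : ∀ x, Module.finrank k (line x) = n + 3 := by
    intro x
    have h := finrank_pencilLine (A := A) (v := (⟨_, hA x⟩ : A)) (w := veronese d x.1.rep)
      (fun h => veronese_ne_zero (d + 1) x.1.rep_nonzero (congrArg Subtype.val h))
      (veronese_ne_zero d x.1.rep_nonzero)
    rw [Fintype.card_fin] at h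
    exact h
  let E : V → QuiverGrassmannian (F.rep T) D := fun x =>
    ⟨fun i => Submodule.pi Set.univ fun _ => line x, fun i j a => F.isStable_pi (hline x) a,
      fun i => by
        change Module.finrank k (Submodule.pi (Set.univ : Set (F.G i)) fun _ => line x) = _
        rw [finrank_pi_const, hfin]⟩
  have hcard : ∀ i, Fintype.card (Fin (D i)) =
      Fintype.card (F.G i × Option (Option (Fin (n + 1)))) := by
    intro i; simp [D]
  let τ : ∀ i, Fin (D i) ≃ F.G i × Option (Option (Fin (n + 1))) := fun i =>
    Fintype.equivOfCardEq (hcard i)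
  -- the Plücker point of `E x` is computed by the columns
  have hplucker : ∀ (x : V) (i : Q), ∃ c : k, c ≠ 0 ∧ (quiverPlucker (F.rep T) D i (E x)).rep =
      c • exteriorPower.ιMulti k (D i) fun t => pencilColumn (F.G i) ρ x.1.rep (τ i t) :=
    fun x i => exists_rep_pluckerPoint ((E x).2.2 i)
      (fun t => pencilColumn_mem ρ hρ (hA x) (τ i t))
      ((linearIndependent_pencilColumn ρ hρ x.1.rep_nonzero (hA x)).comp _ (τ i).injective)
  have hcoord : ∀ l, ∃ s : Fin (n + 1) → Module.Dual k (⋀[k]^(D i₀) ((F.rep T).obj i₀)),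
      ∀ x : V, ∃ q : k, (x.1.rep l ≠ 0 → q ≠ 0) ∧ ∀ j, s j (exteriorPower.ιMulti k (D i₀)
        fun t => pencilColumn (F.G i₀) ρ x.1.rep (τ i₀ t)) = x.1.rep j * q := fun l =>
    (exists_form_eq_coordinate ρ hρ (τ i₀) l).imp fun s hs x => hs x.1.rep (hA x)
  have hinj : Function.Injective E := injective_of_coordinates (col := fun i x =>
    exteriorPower.ιMulti k (D i) fun t => pencilColumn (F.G i) ρ x (τ i t)) hplucker hcoord
  have hsurj : Function.Surjective E := by
    intro U
    obtain ⟨U₀, hU₀, hU⟩ := hF (PencilSpace A) T hT (n + 3) U.1 (fun i j a => U.2.1 i j a) U.2.2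
    have hdim : Module.finrank k U₀ = Fintype.card (Fin (n + 1)) + 2 := by
      have h : Module.finrank k (Submodule.pi (Set.univ : Set (F.G i₀)) fun _ => U₀) = D i₀ :=
        (congrArg (fun W : Submodule k (F.G i₀ → PencilSpace A) => Module.finrank k W)
          (hU i₀).symm).trans (U.2.2 i₀)
      rw [finrank_pi_const] at h
      rw [Fintype.card_fin]
      exact Nat.eq_of_mul_eq_mul_left Fintype.card_pos h
    obtain ⟨v, w, x, hv, hw, hx, rfl⟩ := exists_eq_pencilLine hμ
      (fun u hu => by
        have h := Submodule.sub_mem _ (hU₀ 0 u hu) (Submodule.smul_mem _ b hu)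
        simpa [hTdef] using h)
      (fun u hu => by
        have h := Submodule.sub_mem _ (hU₀ 1 u hu) (Submodule.smul_mem _ c hu)
        simpa [hTdef] using h) hdim
    obtain ⟨l, hl⟩ := exists_contract_ne_zero (v := (v : Sym (Fin (n + 1)) (d + 1) → k))
      (fun h => hv (Subtype.ext h))
    have hl' : x l ≠ 0 := fun h => hl (by rw [hx, h, zero_smul])
    have hx0 : x ≠ 0 := fun h => hl' (by rw [h]; rfl)
    obtain ⟨a, ha⟩ := eq_smul_veronese hx hl'
    have ha0 : a ≠ 0 := fun h => hv (Subtype.ext (by rw [ha, h, zero_smul]; rfl))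
    have hwv : w = a • veronese d x := by
      have h := hx l
      rw [ha, map_smul, contract_veronese, smul_comm] at h
      exact (smul_right_injective _ hl' h).symm
    obtain ⟨r, hr⟩ := Projectivization.exists_smul_eq_mk_rep k x hx0
    have hr0 : (r : k) ≠ 0 := r.ne_zero
    have hr' : (Projectivization.mk k x hx0).rep = (r : k) • x := hr.symm
    have hmem : Projectivization.mk k x hx0 ∈ V := by
      apply hd
      rw [hr', veronese_smul]
      refine Submodule.smul_mem _ _ ?_
      have h := A.smul_mem a⁻¹ v.2
      rwa [ha, inv_smul_smul₀ ha0] at h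
    refine ⟨⟨_, hmem⟩, Subtype.ext (funext fun i => ?_)⟩
    rw [hU i]
    change (Submodule.pi Set.univ fun _ => line ⟨_, hmem⟩) = _
    congr 1
    ext1 _
    change (Submodule.span k {_}).prod (Submodule.pi _ fun _ => Submodule.span k {_}) = _
    have e1 : Submodule.span k {(⟨_, hA ⟨_, hmem⟩⟩ : A)} = Submodule.span k {v} := by
      have h2 : (⟨_, hA ⟨_, hmem⟩⟩ : A) = ((r : k) ^ (d + 1) * a⁻¹) • v := by
        apply Subtype.ext
        rw [Submodule.coe_smul, ha, smul_smul, inv_mul_cancel_right₀ ha0, ← veronese_smul, ← hr']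
      rw [h2]
      exact Submodule.span_singleton_smul_eq
        (IsUnit.mk0 _ (mul_ne_zero (pow_ne_zero _ hr0) (inv_ne_zero ha0))) v
    have e2 : Submodule.span k {veronese d (Projectivization.mk k x hx0).rep} =
        Submodule.span k {w} := by
      rw [hr', veronese_smul, hwv, Submodule.span_singleton_smul_eq (IsUnit.mk0 _ ha0),
        Submodule.span_singleton_smul_eq (IsUnit.mk0 _ (pow_ne_zero _ hr0))]
    rw [e1, e2, pencilLine]
  exact ⟨F.rep T, D, Equiv.ofBijective E ⟨hinj, hsurj⟩, isVarietyIso_of_forms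
    (col := fun i x => exteriorPower.ιMulti k (D i) fun t => pencilColumn (F.G i) ρ x (τ i t))
    (fun i => exists_isFormOfDegree_pencilColumn (A := A) (G := F.G i) ρ (τ i))
    hplucker hcoord⟩

end FullFamily

/-! ### Linear combinations of operators -/

section OpEval

variable {k : Type*} [Field k] {N : Type*} [AddCommGroup N] [Module k N] {r : ℕ}

/-- The value at the operators `T` of the linear combination of `1` and the letters with
coefficients `c`. -/
def opEval (T : Fin r → Module.End k N) : (Option (Fin r) → k) →ₗ[k] Module.End k N :=
  Fintype.linearCombination k fun t => t.elim 1 T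

theorem opEval_apply (T : Fin r → Module.End k N) (c : Option (Fin r) → k) (x : N) :
    opEval T c x = c none • x + ∑ t, c (some t) • T t x := by
  simp [opEval, Fintype.linearCombination_apply, Fintype.sum_option]

theorem opEval_single (T : Fin r → Module.End k N) (t : Option (Fin r)) :
    opEval T (Pi.single t 1) = t.elim 1 T := by
  classical
  rw [opEval, Fintype.linearCombination_apply_single, one_smul]

theorem opEval_single_none (T : Fin r → Module.End k N) (c : k) :
    opEval T (Pi.single none c) = c • 1 := by
  classical
  rw [opEval, Fintype.linearCombination_apply_single]
  rfl

theorem QuiverFamily.map_apply_opEval {k : Type u} [Field k] {Q : Type*} [Quiver Q]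
    (F : QuiverFamily k Q r) {N : Type u} [AddCommGroup N] [Module k N]
    (T : Fin r → Module.End k N) {i j : Q} (a : i ⟶ j) (u : F.G i → N) (g : F.G j) :
    F.map T a u g = ∑ g', opEval T (F.coeff a g g') (u g') := by
  rw [F.map_apply]
  exact Finset.sum_congr rfl fun g' _ => (opEval_apply _ _ _).symm

end OpEval

/-! ### Five subspaces -/

section FiveSubspaces

variable {k : Type*} [Field k] {N : Type*} [AddCommGroup N] [Module k N]

/-- The coefficients of the linear equations `y = 0`, `x = 0`, `x - y = 0`, `y - B x = 0`,
`y - C x = 0` of five subspaces of `N × N`. -/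
def fiveEq (k : Type*) [Field k] : Fin 5 → Fin 2 → Option (Fin 2) → k :=
  ![![0, Pi.single none 1], ![Pi.single none 1, 0], ![Pi.single none 1, -Pi.single none 1],
    ![-Pi.single (some 0) 1, Pi.single none 1], ![-Pi.single (some 1) 1, Pi.single none 1]]

/-- The coefficients of the parametrisations `(x, 0)`, `(0, x)`, `(x, x)`, `(x, B x)`, `(x, C x)`
of the subspaces with the equations `fiveEq`. -/
def fivePar (k : Type*) [Field k] : Fin 5 → Fin 2 → Option (Fin 2) → k :=
  ![![Pi.single none 1, 0], ![0, Pi.single none 1], ![Pi.single none 1, Pi.single none 1],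
    ![Pi.single none 1, Pi.single (some 0) 1], ![Pi.single none 1, Pi.single (some 1) 1]]

/-- The left hand sides of the equations `fiveEq`. -/
def fiveEqMap (T : Fin 2 → Module.End k N) (l : Fin 5) : (Fin 2 → N) →ₗ[k] N :=
  ∑ t, opEval T (fiveEq k l t) ∘ₗ LinearMap.proj t

/-- The parametrisations `fivePar`. -/
def fiveParMap (T : Fin 2 → Module.End k N) (l : Fin 5) : N →ₗ[k] (Fin 2 → N) :=
  LinearMap.pi fun t => opEval T (fivePar k l t)

theorem fiveEqMap_apply (T : Fin 2 → Module.End k N) (u : Fin 2 → N) :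
    fiveEqMap T 0 u = u 1 ∧ fiveEqMap T 1 u = u 0 ∧ fiveEqMap T 2 u = u 0 - u 1 ∧
      fiveEqMap T 3 u = u 1 - T 0 (u 0) ∧ fiveEqMap T 4 u = u 1 - T 1 (u 0) := by
  refine ⟨?_, ?_, ?_, ?_, ?_⟩ <;>
  simp [fiveEqMap, fiveEq, opEval_single] <;> abel

theorem fiveParMap_apply (T : Fin 2 → Module.End k N) (x : N) :
    fiveParMap T 0 x = ![x, 0] ∧ fiveParMap T 1 x = ![0, x] ∧ fiveParMap T 2 x = ![x, x] ∧
      fiveParMap T 3 x = ![x, T 0 x] ∧ fiveParMap T 4 x = ![x, T 1 x] := by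
  refine ⟨?_, ?_, ?_, ?_, ?_⟩ <;> ext t <;> fin_cases t <;>
  simp [fiveParMap, fivePar, opEval_single]

theorem ker_fiveEqMap (T : Fin 2 → Module.End k N) (l : Fin 5) :
    LinearMap.ker (fiveEqMap T l) = LinearMap.range (fiveParMap T l) := by
  ext u
  obtain ⟨e0, e1, e2, e3, e4⟩ := fiveEqMap_apply T u
  rw [LinearMap.mem_ker, LinearMap.mem_range]
  have hx := fun x => fiveParMap_apply T x
  fin_cases l
  · simp only [Fin.zero_eta, e0, (hx _).1]
    refine ⟨fun h => ⟨u 0, ?_⟩, ?_⟩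
    · ext t; fin_cases t <;> simp [h]
    · rintro ⟨x, rfl⟩; simp
  · simp only [Fin.mk_one, e1, (hx _).2.1]
    refine ⟨fun h => ⟨u 1, ?_⟩, ?_⟩
    · ext t; fin_cases t <;> simp [h]
    · rintro ⟨x, rfl⟩; simp
  · simp only [Fin.reduceFinMk, e2, (hx _).2.2.1]
    refine ⟨fun h => ⟨u 0, ?_⟩, ?_⟩
    · ext t; fin_cases t <;> simp [sub_eq_zero.mp h]
    · rintro ⟨x, rfl⟩; simp
  · simp only [Fin.reduceFinMk, e3, (hx _).2.2.2.1]
    refine ⟨fun h => ⟨u 0, ?_⟩, ?_⟩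
    · ext t; fin_cases t <;> simp [sub_eq_zero.mp h]
    · rintro ⟨x, rfl⟩; simp
  · simp only [Fin.reduceFinMk, e4, (hx _).2.2.2.2]
    refine ⟨fun h => ⟨u 0, ?_⟩, ?_⟩
    · ext t; fin_cases t <;> simp [sub_eq_zero.mp h]
    · rintro ⟨x, rfl⟩; simp

theorem fiveParMap_injective (T : Fin 2 → Module.End k N) (l : Fin 5) :
    Function.Injective (fiveParMap T l) := by
  intro x y h
  obtain ⟨e0, e1, e2, e3, e4⟩ := fiveParMap_apply T x
  obtain ⟨f0, f1, f2, f3, f4⟩ := fiveParMap_apply T y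
  fin_cases l
  · simpa [e0, f0] using congrFun h 0
  · simpa [e1, f1] using congrFun h 1
  · simpa [e2, f2] using congrFun h 0
  · simpa [e3, f3] using congrFun h 0
  · simpa [e4, f4] using congrFun h 0

theorem finrank_inf_ker_fiveEqMap (T : Fin 2 → Module.End k N) (l : Fin 5)
    (U : Submodule k (Fin 2 → N)) :
    Module.finrank k (U ⊓ LinearMap.ker (fiveEqMap T l) : Submodule k (Fin 2 → N)) =
      Module.finrank k (U.comap (fiveParMap T l)) := by
  rw [ker_fiveEqMap, inf_comm, ← Submodule.map_comap_eq]
  exact (Submodule.equivMapOfInjective _ (fiveParMap_injective T l) _).finrank_eq.symm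

theorem finrank_comap_add_le [Module.Finite k N] {T : Fin 2 → Module.End k N}
    {U : Submodule k (Fin 2 → N)} {l l' : Fin 5}
    (h : ∀ x y, fiveParMap T l x = fiveParMap T l' y → x = 0) :
    Module.finrank k (U.comap (fiveParMap T l)) + Module.finrank k (U.comap (fiveParMap T l')) ≤
      Module.finrank k U := by
  rw [(Submodule.equivMapOfInjective _ (fiveParMap_injective T l) _).finrank_eq,
    (Submodule.equivMapOfInjective _ (fiveParMap_injective T l') (U.comap _)).finrank_eq,
    ← Submodule.finrank_sup_add_finrank_inf_eq]
  have h0 : (U.comap (fiveParMap T l)).map (fiveParMap T l) ⊓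
      (U.comap (fiveParMap T l')).map (fiveParMap T l') = ⊥ := by
    rw [Submodule.eq_bot_iff]
    rintro _ ⟨⟨x, -, rfl⟩, ⟨y, -, hy⟩⟩
    rw [h x y hy.symm, map_zero]
  rw [h0, finrank_bot, add_zero]
  exact Submodule.finrank_mono (sup_le (Submodule.map_comap_le _ _) (Submodule.map_comap_le _ _))

theorem eq_of_finrank_eq {M : Type*} [AddCommGroup M] [Module k M] [Module.Finite k M]
    {p q : Submodule k M} (h : p ≤ q) (hd : Module.finrank k q ≤ Module.finrank k p) : p = q :=
  Submodule.eq_of_le_of_finrank_le h hd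

/-- If the five subspaces meet `U` in dimension at least `c` on average, where `dim U = 2 c`, then
`U = U₀ × U₀` for an invariant subspace `U₀`. The sum of the dimensions of the intersections
of `U` with neighbours in the cyclic sequence of subspaces is at most `2 c`, which forces equality;
the cycle has odd length, so all five dimensions are `c`. -/
theorem exists_eq_pi_of_five [Module.Finite k N] {T : Fin 2 → Module.End k N}
    (hT : IsGoodPair T) {U : Submodule k (Fin 2 → N)} {c : ℕ}
    (hU : Module.finrank k U = 2 * c)
    (h5 : 5 * c ≤ ∑ l, Module.finrank k (U.comap (fiveParMap T l))) :
    ∃ U₀ : Submodule k N, (∀ t, ∀ x ∈ U₀, T t x ∈ U₀) ∧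
      U = Submodule.pi Set.univ (fun _ => U₀) ∧ Module.finrank k U₀ = c ∧
      ∀ l, U.comap (fiveParMap T l) = U₀ := by
  have hx := fiveParMap_apply T
  have p01 : Module.finrank k (U.comap (fiveParMap T 0)) +
      Module.finrank k (U.comap (fiveParMap T 1)) ≤ Module.finrank k U := by
    refine finrank_comap_add_le fun x y h => ?_
    rw [(hx x).1, (hx y).2.1] at h
    simpa using congrFun h 0
  have p12 : Module.finrank k (U.comap (fiveParMap T 1)) +
      Module.finrank k (U.comap (fiveParMap T 2)) ≤ Module.finrank k U := by
    refine finrank_comap_add_le fun x y h => ?_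
    rw [(hx x).2.1, (hx y).2.2.1] at h
    have h0 : 0 = y := by simpa using congrFun h 0
    have h1 : x = y := by simpa using congrFun h 1
    rw [h1, h0]
  have p23 : Module.finrank k (U.comap (fiveParMap T 2)) +
      Module.finrank k (U.comap (fiveParMap T 3)) ≤ Module.finrank k U := by
    refine finrank_comap_add_le fun x y h => ?_
    rw [(hx x).2.2.1, (hx y).2.2.2.1] at h
    have h0 : x = y := by simpa using congrFun h 0
    have h1 : x = T 0 y := by simpa using congrFun h 1
    refine hT.1 ?_
    rw [map_zero, LinearMap.sub_apply, Module.End.one_apply, sub_eq_zero]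
    nth_rewrite 1 [h0]
    exact h1.symm
  have p34 : Module.finrank k (U.comap (fiveParMap T 3)) +
      Module.finrank k (U.comap (fiveParMap T 4)) ≤ Module.finrank k U := by
    refine finrank_comap_add_le fun x y h => ?_
    rw [(hx x).2.2.2.1, (hx y).2.2.2.2] at h
    have h0 : x = y := by simpa using congrFun h 0
    have h1 : T 0 x = T 1 y := by simpa using congrFun h 1
    refine hT.2.1 ?_
    rw [map_zero, LinearMap.sub_apply, sub_eq_zero, h1, h0]
  have p40 : Module.finrank k (U.comap (fiveParMap T 4)) +
      Module.finrank k (U.comap (fiveParMap T 0)) ≤ Module.finrank k U := by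
    refine finrank_comap_add_le fun x y h => ?_
    rw [(hx x).2.2.2.2, (hx y).1] at h
    have h1 : T 1 x = 0 := by simpa using congrFun h 1
    exact hT.2.2 (by rw [h1, map_zero])
  simp only [Fin.sum_univ_five] at h5
  have m : ∀ l x, x ∈ U.comap (fiveParMap T l) ↔ fiveParMap T l x ∈ U := fun _ _ => Iff.rfl
  have hsplit : ∀ u : Fin 2 → N, u = fiveParMap T 0 (u 0) + fiveParMap T 1 (u 1) := by
    intro u
    rw [(hx _).1, (hx _).2.1]
    ext t; fin_cases t <;> simp
  have hsup : (U.comap (fiveParMap T 0)).map (fiveParMap T 0) ⊔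
      (U.comap (fiveParMap T 1)).map (fiveParMap T 1) = U := by
    refine eq_of_finrank_eq (sup_le (Submodule.map_comap_le _ _) (Submodule.map_comap_le _ _)) ?_
    have h0 : (U.comap (fiveParMap T 0)).map (fiveParMap T 0) ⊓
        (U.comap (fiveParMap T 1)).map (fiveParMap T 1) = ⊥ := by
      rw [Submodule.eq_bot_iff]
      rintro _ ⟨⟨x, -, rfl⟩, ⟨y, -, hy⟩⟩
      rw [(hx y).2.1, (hx x).1] at hy
      have : x = 0 := by simpa using (congrFun hy 0).symm
      rw [this, map_zero]
    have h1 := Submodule.finrank_sup_add_finrank_inf_eq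
      ((U.comap (fiveParMap T 0)).map (fiveParMap T 0))
      ((U.comap (fiveParMap T 1)).map (fiveParMap T 1))
    rw [h0, finrank_bot, add_zero,
      ← (Submodule.equivMapOfInjective _ (fiveParMap_injective T 0) _).finrank_eq,
      ← (Submodule.equivMapOfInjective _ (fiveParMap_injective T 1) _).finrank_eq] at h1
    omega
  have hcomp : ∀ u ∈ U, u 0 ∈ U.comap (fiveParMap T 0) ∧ u 1 ∈ U.comap (fiveParMap T 1) := by
    intro u hu
    rw [← hsup] at hu
    obtain ⟨_, ⟨x, hx', rfl⟩, _, ⟨y, hy', rfl⟩, rfl⟩ := Submodule.mem_sup.mp hu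
    rw [(hx _).1, (hx _).2.1]
    simpa using ⟨hx', hy'⟩
  have e02 : U.comap (fiveParMap T 2) = U.comap (fiveParMap T 0) := by
    refine eq_of_finrank_eq (fun x hx' => ?_) (by omega)
    have := (hcomp _ hx').1
    rwa [(hx _).2.2.1] at this
  have e12 : U.comap (fiveParMap T 2) = U.comap (fiveParMap T 1) := by
    refine eq_of_finrank_eq (fun x hx' => ?_) (by omega)
    have := (hcomp _ hx').2
    rwa [(hx _).2.2.1] at this
  have e03 : U.comap (fiveParMap T 3) = U.comap (fiveParMap T 0) := by
    refine eq_of_finrank_eq (fun x hx' => ?_) (by omega)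
    have := (hcomp _ hx').1
    rwa [(hx _).2.2.2.1] at this
  have e04 : U.comap (fiveParMap T 4) = U.comap (fiveParMap T 0) := by
    refine eq_of_finrank_eq (fun x hx' => ?_) (by omega)
    have := (hcomp _ hx').1
    rwa [(hx _).2.2.2.2] at this
  refine ⟨U.comap (fiveParMap T 0), ?_, ?_, by omega, ?_⟩
  · intro t x hx'
    fin_cases t
    · have h3 := (hcomp _ ((m 3 x).1 (e03.symm ▸ hx'))).2
      rw [← e12, e02, (hx _).2.2.2.1] at h3
      exact h3
    · have h4 := (hcomp _ ((m 4 x).1 (e04.symm ▸ hx'))).2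
      rw [← e12, e02, (hx _).2.2.2.2] at h4
      exact h4
  · ext u
    refine ⟨fun hu t _ => ?_, fun hu => ?_⟩
    · fin_cases t
      · exact (hcomp u hu).1
      · have := (hcomp u hu).2
        rwa [← e12, e02] at this
    · rw [hsplit u]
      have h1 : u 1 ∈ U.comap (fiveParMap T 1) := by
        rw [← e12, e02]; exact hu 1 trivial
      exact U.add_mem (hu 0 trivial) h1
  · intro l
    fin_cases l
    · rfl
    · exact e12.symm.trans e02
    · exact e02
    · exact e03
    · exact e04

end FiveSubspaces

/-! ### Attaching a vertex to a one-parameter family -/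

section Attach

variable {k : Type u} [Field k] {Q : Type*} [Quiver Q]

open Classical in
/-- From a family with one operator, a family with two operators: the operator of `F` becomes the
diagonal operator with eigenvalues `μ` on `Fin 5 → N`, and at the vertex `ω` the space
`Fin 2 → N` is added, with the maps `fiveEqMap` into and `fiveParMap` out of the components. The
functions `sIn` and `sOut` select the arrows at `ω` which are used. -/
def QuiverFamily.attach (F : QuiverFamily k Q 1) (μ : Fin 5 → k) (ω : Q)
    (sIn : ∀ {i j : Q}, (i ⟶ j) → F.G j → k) (sOut : ∀ {i j : Q}, (i ⟶ j) → F.G i → k) :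
    QuiverFamily k Q 2 where
  G i := (F.G i × Fin 5) ⊕ {_t : Fin 2 // i = ω}
  coeff a x y := match x, y with
    | .inl (g, l), .inl (g', l') => if l = l' then
        Pi.single none (F.coeff a g g' none + μ l * F.coeff a g g' (some 0)) else 0
    | .inl (g, l), .inr t => sIn a g • fiveEq k l t.1
    | .inr t, .inl (g, l) => sOut a g • fivePar k l t.1
    | .inr _, .inr _ => 0

variable {F : QuiverFamily k Q 1} {μ : Fin 5 → k} {ω : Q}
  {sIn : ∀ {i j : Q}, (i ⟶ j) → F.G j → k} {sOut : ∀ {i j : Q}, (i ⟶ j) → F.G i → k}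
  {N : Type u} [AddCommGroup N] [Module k N]

/-- The diagonal operator on `Fin 5 → N` with eigenvalues `μ`. -/
def fiveDiag (N : Type u) [AddCommGroup N] [Module k N] (μ : Fin 5 → k) :
    Fin 1 → Module.End k (Fin 5 → N) :=
  fun _ => LinearMap.pi fun l => μ l • LinearMap.proj l

open Classical in
theorem attach_map_inl (T : Fin 2 → Module.End k N) {i j : Q} (a : i ⟶ j)
    (u : (F.attach μ ω sIn sOut).G i → N) (g : F.G j) (l : Fin 5) :
    (F.attach μ ω sIn sOut).map T a u (.inl (g, l)) =
      F.map (fiveDiag N μ) a (fun g l => u (.inl (g, l))) g l +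
      sIn a g • ∑ t : {_t : Fin 2 // i = ω}, opEval T (fiveEq k l t.1) (u (.inr t)) := by
  classical
  refine (QuiverFamily.map_apply_opEval _ T a u _).trans
    ((Fintype.sum_sum_type _).trans (congrArg₂ (· + ·) ?_ ?_))
  · rw [QuiverFamily.map_apply, Fintype.sum_prod_type, Finset.sum_apply]
    refine Finset.sum_congr rfl fun g' _ => ?_
    rw [Finset.sum_eq_single l]
    · simp only [QuiverFamily.attach, if_true, opEval_single_none]
      simp [fiveDiag, add_smul, mul_smul, smul_comm (μ l)]
    · intro l' _ hl'
      simp [QuiverFamily.attach, hl'.symm]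
    · simp
  · rw [Finset.smul_sum]
    convert Finset.sum_congr rfl fun t _ => ?_
    simp [QuiverFamily.attach]

theorem attach_map_inr (T : Fin 2 → Module.End k N) {i j : Q} (a : i ⟶ j)
    (u : (F.attach μ ω sIn sOut).G i → N) (t : {_t : Fin 2 // j = ω}) :
    (F.attach μ ω sIn sOut).map T a u (.inr t) =
      ∑ g, sOut a g • ∑ l, opEval T (fivePar k l t.1) (u (.inl (g, l))) := by
  classical
  refine (QuiverFamily.map_apply_opEval _ T a u _).trans ((Fintype.sum_sum_type _).trans ?_)
  rw [Fintype.sum_prod_type]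
  simp [QuiverFamily.attach, Finset.smul_sum]

/-- Away from the attached vertex, a subrepresentation of the correct dimension comes from five
subspaces of `N`. -/
theorem attach_exists_five [Module.Finite k N] (hμ : Function.Injective μ)
    (hF : F.IsFullFor (fiveDiag N μ)) (hω : IsEmpty (F.G ω)) {p : Q} (hp : Nonempty (F.G p))
    {T : Fin 2 → Module.End k N} {c : ℕ}
    {U : ∀ i, Submodule k ((F.attach μ ω sIn sOut).G i → N)}
    (hU : (F.attach μ ω sIn sOut).IsStable T U)
    (hd : ∀ i, Module.finrank k (U i) = Fintype.card ((F.attach μ ω sIn sOut).G i) * c) :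
    ∃ W : Fin 5 → Submodule k N, ∑ l, Module.finrank k (W l) = 5 * c ∧
      ∀ i, i ≠ ω → ∀ u, u ∈ U i ↔ ∀ g l, u (.inl (g, l)) ∈ W l := by
  classical
  let r : ∀ i, ((F.attach μ ω sIn sOut).G i → N) →ₗ[k] (F.G i → Fin 5 → N) := fun i =>
    LinearMap.pi fun g => LinearMap.pi fun l => LinearMap.proj (Sum.inl (g, l))
  let V : ∀ i, Submodule k (F.G i → Fin 5 → N) := fun i => (U i).map (r i)
  have hinj : ∀ i, i ≠ ω → Function.Injective (r i) := by
    intro i hi u v h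
    funext x
    rcases x with ⟨g, l⟩ | ⟨t, ht⟩
    · exact congrFun (congrFun h g) l
    · exact absurd ht hi
  have hV : F.IsStable (fiveDiag N μ) V := by
    rintro i j a _ ⟨u, hu, rfl⟩
    by_cases hi : i = ω
    · subst hi
      have : r i u = 0 := funext fun g => (hω.false g).elim
      rw [this, map_zero]
      exact Submodule.zero_mem _
    · refine ⟨_, hU a u hu, ?_⟩
      ext g l
      have : IsEmpty {_t : Fin 2 // i = ω} := ⟨fun t => hi t.2⟩
      refine (attach_map_inl T a u g l).trans ?_
      rw [Finset.univ_eq_empty, Finset.sum_empty, smul_zero, add_zero]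
      rfl
  have hcard : ∀ i, i ≠ ω → Fintype.card ((F.attach μ ω sIn sOut).G i) =
      Fintype.card (F.G i) * 5 := by
    intro i hi
    have : IsEmpty {_t : Fin 2 // i = ω} := ⟨fun t => hi t.2⟩
    refine (Fintype.card_congr (Equiv.sumEmpty (F.G i × Fin 5) {_t : Fin 2 // i = ω})).trans ?_
    simp
  have hVd : ∀ i, Module.finrank k (V i) = Fintype.card (F.G i) * (5 * c) := by
    intro i
    by_cases hi : i = ω
    · subst hi
      rw [Fintype.card_eq_zero (α := F.G i), zero_mul]
      have : Subsingleton (V i) := ⟨fun a b => Subtype.ext (funext fun g => (hω.false g).elim)⟩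
      exact Module.finrank_zero_of_subsingleton
    · rw [← (Submodule.equivMapOfInjective _ (hinj i hi) _).finrank_eq, hd, hcard i hi, mul_assoc]
  obtain ⟨U₁, hU₁, hVU⟩ := hF (5 * c) V hV hVd
  have hpω : p ≠ ω := by
    rintro rfl
    exact hω.false hp.some
  have hdim : Module.finrank k U₁ = 5 * c := by
    have h := hVd p
    rw [hVU p, finrank_pi_const] at h
    exact Nat.eq_of_mul_eq_mul_left Fintype.card_pos h
  let W : Fin 5 → Submodule k N := fun l => U₁.comap (LinearMap.single k (fun _ => N) l)
  have hW : ∀ x, x ∈ U₁ ↔ ∀ l, x l ∈ W l := by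
    intro x
    constructor
    · intro hx l
      refine mem_of_distinct_eigenvalues (M := fun _ => N) (fun l => LinearMap.proj l)
        (fun u v h => funext h) hμ (T := fiveDiag N μ 0) (fun l u => rfl) (hU₁ 0) hx l ?_ ?_
      · simp
      · intro j hj; simp [Pi.single_eq_of_ne hj]
    · intro hx
      rw [← Finset.univ_sum_single x]
      exact U₁.sum_mem fun l _ => hx l
  refine ⟨W, ?_, fun i hi u => ?_⟩
  · have e : U₁ ≃ₗ[k] ∀ l, W l :=
      { toFun := fun x l => ⟨x.1 l, (hW _).1 x.2 l⟩
        invFun := fun x => ⟨fun l => (x l).1, (hW _).2 fun l => (x l).2⟩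
        map_add' := fun _ _ => rfl
        map_smul' := fun _ _ => rfl
        left_inv := fun _ => rfl
        right_inv := fun _ => rfl }
    rw [← hdim, e.finrank_eq, Module.finrank_pi_fintype]
  · have h1 : u ∈ U i ↔ r i u ∈ V i := by
      constructor
      · intro h; exact ⟨u, h, rfl⟩
      · rintro ⟨v, hv, h⟩
        rwa [← hinj i hi h]
    rw [h1, hVU i]
    exact ⟨fun h g l => (hW _).1 (h g trivial) l, fun h g _ => (hW _).2 (h g)⟩

/-- The equivalence of index types at the attached vertex. -/
def attachEquiv (hω : IsEmpty (F.G ω)) : Fin 2 ≃ (F.attach μ ω sIn sOut).G ω where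
  toFun t := .inr ⟨t, rfl⟩
  invFun x := match x with
    | .inl (g, _) => (hω.false g).elim
    | .inr t => t.1
  left_inv _ := rfl
  right_inv x := match x with
    | .inl (g, _) => (hω.false g).elim
    | .inr _ => rfl

/-- The subspace at the attached vertex, as a subspace of `Fin 2 → N`. -/
theorem attach_vertex_finrank (hω : IsEmpty (F.G ω)) {c : ℕ}
    {U : ∀ i, Submodule k ((F.attach μ ω sIn sOut).G i → N)}
    (hd : ∀ i, Module.finrank k (U i) = Fintype.card ((F.attach μ ω sIn sOut).G i) * c) :
    Module.finrank k ((U ω).map (LinearEquiv.funCongrLeft k N (attachEquiv hω)).toLinearMap) =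
      2 * c := by
  rw [LinearEquiv.finrank_map_eq, hd, ← Fintype.card_congr (attachEquiv hω), Fintype.card_fin]

/-- The last step: if `W l` is the same subspace for all `l`. -/
theorem attach_conclude (hω : IsEmpty (F.G ω)) {T : Fin 2 → Module.End k N}
    {U : ∀ i, Submodule k ((F.attach μ ω sIn sOut).G i → N)} {W : Fin 5 → Submodule k N}
    (hW : ∀ i, i ≠ ω → ∀ u, u ∈ U i ↔ ∀ g l, u (.inl (g, l)) ∈ W l) {U₀ : Submodule k N}
    (h₀ : ∀ t, ∀ x ∈ U₀, T t x ∈ U₀)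
    (hω' : (U ω).map (LinearEquiv.funCongrLeft k N (attachEquiv hω)).toLinearMap =
      Submodule.pi Set.univ (fun _ => U₀)) (hWU : ∀ l, W l = U₀) :
    ∃ U₀ : Submodule k N, (∀ t, ∀ x ∈ U₀, T t x ∈ U₀) ∧
      ∀ i, U i = Submodule.pi Set.univ fun _ => U₀ := by
  refine ⟨U₀, h₀, fun i => ?_⟩
  ext u
  by_cases hi : i = ω
  · subst hi
    have h1 : u ∈ U i ↔ LinearEquiv.funCongrLeft k N (attachEquiv hω) u ∈
        (U i).map (LinearEquiv.funCongrLeft k N (attachEquiv hω)).toLinearMap := by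
      constructor
      · intro h; exact ⟨u, h, rfl⟩
      · rintro ⟨v, hv, h⟩
        rwa [← (LinearEquiv.funCongrLeft k N (attachEquiv hω)).injective h]
    rw [h1, hω']
    refine ⟨fun h x _ => ?_, fun h t _ => h _ trivial⟩
    have := h ((attachEquiv hω).symm x) trivial
    rwa [LinearEquiv.funCongrLeft_apply, LinearMap.funLeft_apply, Equiv.apply_symm_apply] at this
  · rw [hW i hi]
    constructor
    · rintro h (⟨g, l⟩ | t) _
      · rw [← hWU l]; exact h g l
      · exact absurd t.2 hi
    · intro h g l
      rw [hWU l]; exact h _ trivial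

theorem attach_isFullFor_of_in [Module.Finite k N] (hμ : Function.Injective μ)
    (hF : F.IsFullFor (fiveDiag N μ)) (hω : IsEmpty (F.G ω)) {p : Q} {g₀ : F.G p} {a₀ : ω ⟶ p}
    (h₀ : sIn a₀ g₀ = 1) {T : Fin 2 → Module.End k N} (hT : IsGoodPair T) :
    (F.attach μ ω sIn sOut).IsFullFor T := by
  classical
  intro c U hU hd
  obtain ⟨W, hWd, hW⟩ := attach_exists_five hμ hF hω ⟨g₀⟩ hU hd
  have hpω : p ≠ ω := by
    rintro rfl
    exact hω.false g₀
  set X := (U ω).map (LinearEquiv.funCongrLeft k N (attachEquiv hω)).toLinearMap with hX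
  have hXd : Module.finrank k X = 2 * c := attach_vertex_finrank hω hd
  have hmap : ∀ l, X.map (fiveEqMap T l) ≤ W l := by
    rintro l _ ⟨_, ⟨u, hu, rfl⟩, rfl⟩
    have h1 := (hW p hpω _).1 (hU a₀ u hu) g₀ l
    have h2 : (fun g l => u (.inl (g, l)) : F.G ω → Fin 5 → N) = 0 :=
      funext fun g => (hω.false g).elim
    rw [attach_map_inl, h2, map_zero, h₀, one_smul, Pi.zero_apply, Pi.zero_apply, zero_add] at h1
    convert h1
    rw [fiveEqMap, LinearMap.sum_apply]
    let e : Fin 2 ≃ {_t : Fin 2 // ω = ω} :=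
      ⟨fun t => ⟨t, rfl⟩, fun t => t.1, fun _ => rfl, fun _ => rfl⟩
    exact e.sum_comp (fun t => opEval T (fiveEq k l t.1) (u (.inr t)))
  have hker : ∀ l, 2 * c ≤ Module.finrank k (X.comap (fiveParMap T l)) +
      Module.finrank k (X.map (fiveEqMap T l)) := by
    intro l
    have h := LinearMap.finrank_range_add_finrank_ker ((fiveEqMap T l).domRestrict X)
    rw [LinearMap.range_domRestrict, LinearMap.ker_domRestrict, hXd] at h
    have h2 := finrank_inf_ker_fiveEqMap T l X
    have h3 := (Submodule.equivMapOfInjective X.subtype X.injective_subtype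
      ((LinearMap.ker (fiveEqMap T l)).comap X.subtype)).finrank_eq
    rw [Submodule.map_comap_subtype, h2] at h3
    rw [← h, ← h3, add_comm]
  have hle : ∀ l, Module.finrank k (X.map (fiveEqMap T l)) ≤ Module.finrank k (W l) := fun l =>
    Submodule.finrank_mono (hmap l)
  obtain ⟨U₀, hinv, hXU, hcU, hcomap⟩ := exists_eq_pi_of_five hT hXd (by
    simp only [Fin.sum_univ_five] at hWd ⊢
    have := hker 0; have := hker 1; have := hker 2; have := hker 3; have := hker 4
    have := hle 0; have := hle 1; have := hle 2; have := hle 3; have := hle 4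
    omega)
  have hge : ∀ l, c ≤ Module.finrank k (W l) := by
    intro l
    have h1 := hker l
    have h2 := hle l
    rw [hcomap l, hcU] at h1
    omega
  refine attach_conclude hω hW hinv (hX.symm.trans hXU) fun l => ?_
  have hUW : U₀ ≤ W l := by
    intro x hx
    obtain ⟨u, hu, rfl⟩ : ∃ u ∈ X, fiveEqMap T l u = x := by
      rw [hXU]
      obtain ⟨e0, e1, e2, e3, e4⟩ := fiveEqMap_apply T ![x, 0]
      obtain ⟨f0, -⟩ := fiveEqMap_apply T ![0, x]
      have f3 := (fiveEqMap_apply T ![0, x]).2.2.2.1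
      have f4 := (fiveEqMap_apply T ![0, x]).2.2.2.2
      have hx0 : (![x, 0] : Fin 2 → N) ∈ Submodule.pi Set.univ fun _ => U₀ := by
        intro t _; fin_cases t
        · exact hx
        · exact U₀.zero_mem
      have h0x : (![0, x] : Fin 2 → N) ∈ Submodule.pi Set.univ fun _ => U₀ := by
        intro t _; fin_cases t
        · exact U₀.zero_mem
        · exact hx
      fin_cases l
      · exact ⟨_, h0x, f0⟩
      · exact ⟨_, hx0, e1⟩
      · exact ⟨_, hx0, by simpa using e2⟩
      · exact ⟨_, h0x, by simpa using f3⟩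
      · exact ⟨_, h0x, by simpa using f4⟩
    exact hmap l ⟨u, hu, rfl⟩
  refine (eq_of_finrank_eq hUW ?_).symm
  have := hge 0; have := hge 1; have := hge 2; have := hge 3; have := hge 4
  simp only [Fin.sum_univ_five] at hWd
  rw [hcU]
  fin_cases l <;> simp only [Fin.zero_eta, Fin.mk_one, Fin.reduceFinMk] <;> omega

theorem attach_isFullFor_of_out [Module.Finite k N] (hμ : Function.Injective μ)
    (hF : F.IsFullFor (fiveDiag N μ)) (hω : IsEmpty (F.G ω)) {p : Q} {g₀ : F.G p} {a₀ : p ⟶ ω}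
    (h₀ : sOut a₀ g₀ = 1) {T : Fin 2 → Module.End k N} (hT : IsGoodPair T) :
    (F.attach μ ω sIn sOut).IsFullFor T := by
  classical
  intro c U hU hd
  obtain ⟨W, hWd, hW⟩ := attach_exists_five hμ hF hω ⟨g₀⟩ hU hd
  have hpω : p ≠ ω := by
    rintro rfl
    exact hω.false g₀
  set X := (U ω).map (LinearEquiv.funCongrLeft k N (attachEquiv hω)).toLinearMap with hX
  have hXd : Module.finrank k X = 2 * c := attach_vertex_finrank hω hd
  have hmap : ∀ l, W l ≤ X.comap (fiveParMap T l) := by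
    intro l x hx
    let u : (F.attach μ ω sIn sOut).G p → N := fun y => match y with
      | .inl (g, l') => if g = g₀ ∧ l' = l then x else 0
      | .inr _ => 0
    have hu : u ∈ U p := by
      rw [hW p hpω]
      intro g l'
      by_cases h : g = g₀ ∧ l' = l
      · obtain ⟨rfl, rfl⟩ := h
        simpa [u] using hx
      · simp only [u, if_neg h]; exact Submodule.zero_mem _
    refine ⟨_, hU a₀ u hu, ?_⟩
    funext t
    refine (attach_map_inr T a₀ u ⟨t, rfl⟩).trans ?_
    rw [Finset.sum_eq_single g₀]
    · rw [h₀, one_smul, Finset.sum_eq_single l]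
      · simp [u, fiveParMap]
      · intro l' _ hl'; simp [u, hl']
      · simp
    · intro g _ hg; simp [u, hg]
    · simp
  have hle : ∀ l, Module.finrank k (W l) ≤ Module.finrank k (X.comap (fiveParMap T l)) := fun l =>
    Submodule.finrank_mono (hmap l)
  obtain ⟨U₀, hinv, hXU, hcU, hcomap⟩ := exists_eq_pi_of_five hT hXd (by
    rw [← hWd]; exact Finset.sum_le_sum fun l _ => hle l)
  refine attach_conclude hω hW hinv (hX.symm.trans hXU) fun l => ?_
  have hUW : W l ≤ U₀ := hcomap l ▸ hmap l
  refine eq_of_finrank_eq hUW ?_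
  have hle : ∀ l, Module.finrank k (W l) ≤ c := fun l => by
    rw [← hcU, ← hcomap l]; exact hle l
  have := hle 0; have := hle 1; have := hle 2; have := hle 3; have := hle 4
  simp only [Fin.sum_univ_five] at hWd
  rw [hcU]
  fin_cases l <;> simp only [Fin.zero_eta, Fin.mk_one, Fin.reduceFinMk] <;> omega

/-- The quiver `Q` carries a family with two operators that is full for all good pairs. -/
def HasFullPairFamily (k : Type u) [Field k] (Q : Type*) [Quiver Q] : Prop :=
  ∃ F : QuiverFamily k Q 2, (∃ i, Nonempty (F.G i)) ∧
    ∀ (N : Type u) [AddCommGroup N] [Module k N] [Module.Finite k N]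
      (T : Fin 2 → Module.End k N), IsGoodPair T → F.IsFullFor T

theorem hasFullPairFamily_of_attach [Infinite k] (F : QuiverFamily k Q 1)
    (hF : ∀ (N : Type u) [AddCommGroup N] [Module k N] [Module.Finite k N]
      (T : Fin 1 → Module.End k N), F.IsFullFor T) {ω p : Q} (hω : IsEmpty (F.G ω))
    (hp : Nonempty (F.G p)) (a : (ω ⟶ p) ⊕ (p ⟶ ω)) : HasFullPairFamily k Q := by
  classical
  obtain ⟨g₀⟩ := hp
  let μ : Fin 5 → k := fun l => Infinite.natEmbedding k l
  have hμ : Function.Injective μ := (Infinite.natEmbedding k).injective.comp Fin.val_injective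
  rcases a with a₀ | a₀
  · refine ⟨F.attach μ ω (fun {i j} a g => if
      (⟨i, j, a, g⟩ : Σ (i j : Q) (_ : i ⟶ j), F.G j) = ⟨ω, p, a₀, g₀⟩ then 1 else 0)
      (fun _ _ => 0), ⟨p, ⟨.inl (g₀, 0)⟩⟩, fun N _ _ _ T hT =>
      attach_isFullFor_of_in hμ (hF _ _) hω (a₀ := a₀) (g₀ := g₀) (if_pos rfl) hT⟩
  · refine ⟨F.attach μ ω (fun _ _ => 0) (fun {i j} a g => if
      (⟨i, j, a, g⟩ : Σ (i j : Q) (_ : i ⟶ j), F.G i) = ⟨p, ω, a₀, g₀⟩ then 1 else 0),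
      ⟨p, ⟨.inl (g₀, 0)⟩⟩, fun N _ _ _ T hT =>
      attach_isFullFor_of_out hμ (hF _ _) hω (a₀ := a₀) (g₀ := g₀) (if_pos rfl) hT⟩

end Attach

/-! ### Operators from several arrows at a vertex -/

section Extend

variable {k : Type u} [Field k] {Q : Type*} [Quiver Q] {r : ℕ}

/-- The family without operators is full: every subrepresentation of `Z ⊗ N` whose dimension
vector is a multiple of that of `Z` is of the form `Z ⊗ N'`. -/
def IsFullRep (F : QuiverFamily k Q 0) : Prop :=
  ∀ (N : Type u) [AddCommGroup N] [Module k N] [Module.Finite k N]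
    (T : Fin 0 → Module.End k N), F.IsFullFor T

open Classical in
/-- The family with `r` operators that adds the space `N` at the vertex `v` to a family without
operators. The maps `1, T 0, T 1, …` from `N` to the components selected by `σ`, or from
the components selected by `τ` to `N`, are added. -/
def QuiverFamily.extend (F : QuiverFamily k Q 0) (v : Q)
    (σ : Option (Fin r) → Option (Σ (j : Q) (_ : v ⟶ j), F.G j))
    (τ : Option (Fin r) → Option (Σ (j : Q) (_ : j ⟶ v), F.G j)) : QuiverFamily k Q r where
  G i := F.G i ⊕ {_t : Unit // i = v}
  coeff {i j} a x y t := match x, y with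
    | .inl g, .inl g' => if t = none then F.coeff a g g' none else 0
    | .inl g, .inr _ => if (σ t).map (fun s => (⟨v, s⟩ : Σ (i j : Q) (_ : i ⟶ j), F.G j)) =
        some ⟨i, j, a, g⟩ then 1 else 0
    | .inr _, .inl g => if (τ t).map (fun s =>
        (⟨s.1, v, s.2⟩ : Σ (i j : Q) (_ : i ⟶ j), F.G i)) = some ⟨i, j, a, g⟩ then 1 else 0
    | .inr _, .inr _ => 0

variable {F : QuiverFamily k Q 0} {v : Q}
  {σ : Option (Fin r) → Option (Σ (j : Q) (_ : v ⟶ j), F.G j)}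
  {τ : Option (Fin r) → Option (Σ (j : Q) (_ : j ⟶ v), F.G j)}
  {N : Type u} [AddCommGroup N] [Module k N]

open Classical in
theorem extend_map_inl (T : Fin r → Module.End k N) {i j : Q} (a : i ⟶ j)
    (u : (F.extend v σ τ).G i → N) (g : F.G j) :
    (F.extend v σ τ).map T a u (.inl g) =
      F.map (fun t => t.elim0) a (fun g => u (.inl g)) g +
      ∑ y : {_t : Unit // i = v}, opEval T (fun t =>
        if (σ t).map (fun s => (⟨v, s⟩ : Σ (i j : Q) (_ : i ⟶ j), F.G j)) =
          some ⟨i, j, a, g⟩ then 1 else 0) (u (.inr y)) := by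
  refine (QuiverFamily.map_apply_opEval _ T a u _).trans
    ((Fintype.sum_sum_type _).trans (congrArg₂ (· + ·) ?_ ?_))
  · rw [QuiverFamily.map_apply]
    refine Finset.sum_congr rfl fun g' _ => ?_
    rw [opEval_apply]
    simp [QuiverFamily.extend]
  · convert Finset.sum_congr rfl fun t _ => ?_
    rfl

open Classical in
theorem extend_map_inr (T : Fin r → Module.End k N) {i j : Q} (a : i ⟶ j)
    (u : (F.extend v σ τ).G i → N) (y : {_t : Unit // j = v}) :
    (F.extend v σ τ).map T a u (.inr y) =
      ∑ g : F.G i, opEval T (fun t => if (τ t).map (fun s =>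
        (⟨s.1, v, s.2⟩ : Σ (i j : Q) (_ : i ⟶ j), F.G i)) = some ⟨i, j, a, g⟩ then 1 else 0)
        (u (.inl g)) := by
  refine (QuiverFamily.map_apply_opEval _ T a u _).trans ((Fintype.sum_sum_type _).trans ?_)
  rw [add_eq_left.mpr]
  · rfl
  · refine Finset.sum_eq_zero fun y _ => ?_
    have : ((F.extend v σ τ).coeff a (.inr ‹_›) (.inr y) : Option (Fin r) → k) = 0 := rfl
    refine (congrArg (fun c => opEval T c (u (.inr y))) this).trans ?_
    rw [map_zero]; rfl

/-- Away from the added vertex, a subrepresentation of the correct dimension comes from a subspace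
of `N`. -/
theorem extend_exists_base [Module.Finite k N] (hF : IsFullRep F) (hv : IsEmpty (F.G v)) {p : Q}
    (hp : Nonempty (F.G p)) {T : Fin r → Module.End k N} {c : ℕ}
    {U : ∀ i, Submodule k ((F.extend v σ τ).G i → N)} (hU : (F.extend v σ τ).IsStable T U)
    (hd : ∀ i, Module.finrank k (U i) = Fintype.card ((F.extend v σ τ).G i) * c) :
    ∃ U₁ : Submodule k N, Module.finrank k U₁ = c ∧
      ∀ i, i ≠ v → ∀ u, u ∈ U i ↔ ∀ g, u (.inl g) ∈ U₁ := by
  classical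
  let ρ : ∀ i, ((F.extend v σ τ).G i → N) →ₗ[k] (F.G i → N) := fun i =>
    LinearMap.pi fun g => LinearMap.proj (Sum.inl g)
  let V : ∀ i, Submodule k (F.G i → N) := fun i => (U i).map (ρ i)
  have hinj : ∀ i, i ≠ v → Function.Injective (ρ i) := by
    intro i hi u u' h
    funext x
    rcases x with g | ⟨t, ht⟩
    · exact congrFun h g
    · exact absurd ht hi
  have hV : F.IsStable (fun t => t.elim0) V := by
    rintro i j a _ ⟨u, hu, rfl⟩
    by_cases hi : i = v
    · subst hi
      have : ρ i u = 0 := funext fun g => (hv.false g).elim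
      rw [this, map_zero]
      exact Submodule.zero_mem _
    · refine ⟨_, hU a u hu, ?_⟩
      ext g
      have : IsEmpty {_t : Unit // i = v} := ⟨fun t => hi t.2⟩
      refine (extend_map_inl T a u g).trans ?_
      rw [Finset.univ_eq_empty, Finset.sum_empty, add_zero]
      rfl
  have hcard : ∀ i, i ≠ v → Fintype.card ((F.extend v σ τ).G i) = Fintype.card (F.G i) := by
    intro i hi
    have : IsEmpty {_t : Unit // i = v} := ⟨fun t => hi t.2⟩
    exact Fintype.card_congr (Equiv.sumEmpty (F.G i) {_t : Unit // i = v})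
  have hVd : ∀ i, Module.finrank k (V i) = Fintype.card (F.G i) * c := by
    intro i
    by_cases hi : i = v
    · subst hi
      rw [Fintype.card_eq_zero (α := F.G i), zero_mul]
      have : Subsingleton (V i) := ⟨fun a b => Subtype.ext (funext fun g => (hv.false g).elim)⟩
      exact Module.finrank_zero_of_subsingleton
    · rw [← (Submodule.equivMapOfInjective _ (hinj i hi) _).finrank_eq, hd, hcard i hi]
  obtain ⟨U₁, -, hVU⟩ := hF N _ c V hV hVd
  refine ⟨U₁, ?_, fun i hi u => ?_⟩
  · have h := hVd p
    rw [hVU p, finrank_pi_const] at h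
    exact Nat.eq_of_mul_eq_mul_left Fintype.card_pos h
  · have h1 : u ∈ U i ↔ ρ i u ∈ V i := by
      constructor
      · intro h; exact ⟨u, h, rfl⟩
      · rintro ⟨u', hu', h⟩
        rwa [← hinj i hi h]
    rw [h1, hVU i]
    exact ⟨fun h g => h g trivial, fun h g _ => h g⟩

/-- The space at the added vertex is a copy of `N`. -/
def extendEquiv (hv : IsEmpty (F.G v)) : ((F.extend v σ τ).G v → N) ≃ₗ[k] N where
  toFun u := u (.inr ⟨(), rfl⟩)
  invFun x := fun _ => x
  map_add' _ _ := rfl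
  map_smul' _ _ := rfl
  left_inv _ := funext fun y => match y with
    | .inl g => (hv.false g).elim
    | .inr _ => rfl
  right_inv _ := rfl

theorem extend_vertex_finrank (hv : IsEmpty (F.G v)) {c : ℕ}
    {U : ∀ i, Submodule k ((F.extend v σ τ).G i → N)}
    (hd : ∀ i, Module.finrank k (U i) = Fintype.card ((F.extend v σ τ).G i) * c) :
    Module.finrank k ((U v).map (extendEquiv hv).toLinearMap) = c := by
  have e : (F.extend v σ τ).G v ≃ Unit :=
    { toFun := fun _ => ()
      invFun := fun _ => .inr ⟨(), rfl⟩
      left_inv := fun y => match y with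
        | .inl g => (hv.false g).elim
        | .inr _ => rfl
      right_inv := fun _ => rfl }
  rw [LinearEquiv.finrank_map_eq, hd, Fintype.card_congr e, Fintype.card_unit, one_mul]

theorem extend_conclude (hv : IsEmpty (F.G v)) {T : Fin r → Module.End k N}
    {U : ∀ i, Submodule k ((F.extend v σ τ).G i → N)} {U₁ : Submodule k N}
    (hW : ∀ i, i ≠ v → ∀ u, u ∈ U i ↔ ∀ g, u (.inl g) ∈ U₁)
    (h₁ : ∀ t, ∀ x ∈ U₁, T t x ∈ U₁)
    (hv' : (U v).map (extendEquiv hv).toLinearMap = U₁) :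
    ∃ U₀ : Submodule k N, (∀ t, ∀ x ∈ U₀, T t x ∈ U₀) ∧
      ∀ i, U i = Submodule.pi Set.univ fun _ => U₀ := by
  refine ⟨U₁, h₁, fun i => ?_⟩
  ext u
  by_cases hi : i = v
  · subst hi
    have h1 : u ∈ U i ↔ extendEquiv hv u ∈ (U i).map (extendEquiv hv).toLinearMap := by
      constructor
      · intro h; exact ⟨u, h, rfl⟩
      · rintro ⟨u', hu', h⟩
        rwa [← (extendEquiv hv).injective h]
    rw [h1, hv']
    constructor
    · rintro h (g | ⟨t, ht⟩) _
      · exact (hv.false g).elim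
      · exact h
    · intro h; exact h _ trivial
  · rw [hW i hi]
    constructor
    · rintro h (g | t) _
      · exact h g
      · exact absurd t.2 hi
    · intro h g; exact h _ trivial

theorem opEval_ite_eq {T : Fin r → Module.End k N} {p : Option (Fin r) → Prop}
    [DecidablePred p] {t₀ : Option (Fin r)} (hp : ∀ t, p t ↔ t = t₀) :
    opEval T (fun t => if p t then 1 else 0) = t₀.elim 1 T := by
  classical
  rw [← opEval_single]
  congr 1
  ext t
  by_cases h : t = t₀
  · subst h; simp [(hp t).2 rfl]
  · rw [Pi.single_eq_of_ne h, if_neg (fun h' => h ((hp t).1 h'))]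

/-- A vertex with `r + 1` arrows, counted with multiplicity, to the support of a full
representation yields a full family with `r` operators. -/
theorem extend_isFullFor_out [Module.Finite k N] (hF : IsFullRep F) (hv : IsEmpty (F.G v))
    {s : Option (Fin r) → Σ (j : Q) (_ : v ⟶ j), F.G j} (hs : Function.Injective s)
    (T : Fin r → Module.End k N) :
    (F.extend v (fun t => some (s t)) fun _ => none).IsFullFor T := by
  classical
  intro c U hU hd
  obtain ⟨U₁, hUd, hW⟩ := extend_exists_base hF hv ⟨(s none).2.2⟩ hU hd
  set X := (U v).map (extendEquiv hv).toLinearMap with hX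
  have hXd : Module.finrank k X = c := extend_vertex_finrank hv hd
  have hmap : ∀ t : Option (Fin r), ∀ x ∈ X, (t.elim 1 T : Module.End k N) x ∈ U₁ := by
    rintro t _ ⟨u, hu, rfl⟩
    have hne : (s t).1 ≠ v := fun h => hv.false (h ▸ (s t).2.2)
    have h1 := (hW _ hne _).1 (hU (s t).2.1 u hu) (s t).2.2
    have h2 : (fun g => u (.inl g) : F.G v → N) = 0 := funext fun g => (hv.false g).elim
    rw [extend_map_inl, h2, map_zero, Pi.zero_apply, zero_add, opEval_ite_eq (t₀ := t)] at h1
    · convert h1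
      have : Unique {_t : Unit // v = v} := ⟨⟨⟨(), rfl⟩⟩, fun _ => rfl⟩
      exact (Fintype.sum_unique (ι := {_t : Unit // v = v}) fun y =>
        (t.elim 1 T : Module.End k N) (u (.inr y))).symm
    · intro t'
      rw [Option.map_some, Option.some_inj]
      constructor
      · intro h
        exact hs (eq_of_heq (Sigma.mk.inj h).2)
      · rintro rfl; rfl
  have hXU : X = U₁ := eq_of_finrank_eq (fun x hx => hmap none x hx) (by rw [hXd, hUd])
  exact extend_conclude hv hW (fun t x hx => hmap (some t) x (hXU ▸ hx)) hXU

theorem extend_isFullFor_in [Module.Finite k N] (hF : IsFullRep F) (hv : IsEmpty (F.G v))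
    {s : Option (Fin r) → Σ (j : Q) (_ : j ⟶ v), F.G j} (hs : Function.Injective s)
    (T : Fin r → Module.End k N) :
    (F.extend v (fun _ => none) fun t => some (s t)).IsFullFor T := by
  classical
  intro c U hU hd
  obtain ⟨U₁, hUd, hW⟩ := extend_exists_base hF hv ⟨(s none).2.2⟩ hU hd
  set X := (U v).map (extendEquiv hv).toLinearMap with hX
  have hXd : Module.finrank k X = c := extend_vertex_finrank hv hd
  have hmap : ∀ t : Option (Fin r), ∀ x ∈ U₁, (t.elim 1 T : Module.End k N) x ∈ X := by
    intro t x hx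
    have hne : (s t).1 ≠ v := fun h => hv.false (h ▸ (s t).2.2)
    let u : (F.extend v (fun _ : Option (Fin r) => none) fun t => some (s t)).G (s t).1 → N :=
      fun y => match y with
        | .inl g => if g = (s t).2.2 then x else 0
        | .inr _ => 0
    have hu : u ∈ U (s t).1 := by
      rw [hW _ hne]
      intro g
      by_cases h : g = (s t).2.2
      · simp only [u, if_pos h]; exact hx
      · simp only [u, if_neg h]; exact Submodule.zero_mem _
    refine ⟨_, hU (s t).2.1 u hu, ?_⟩
    refine (extend_map_inr T (s t).2.1 u ⟨(), rfl⟩).trans ?_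
    rw [Finset.sum_eq_single (s t).2.2]
    · rw [opEval_ite_eq (t₀ := t)]
      · simp [u]
      · intro t'
        rw [Option.map_some, Option.some_inj]
        constructor
        · intro h
          refine hs ?_
          obtain ⟨h1, h2⟩ := Sigma.mk.inj h
          generalize s t' = y at h1 h2
          generalize s t = z at h1 h2
          obtain ⟨i, a, g⟩ := y
          obtain ⟨i', a', g'⟩ := z
          obtain rfl := h1
          exact Sigma.ext rfl (heq_of_eq (eq_of_heq (Sigma.mk.inj (eq_of_heq h2)).2))
        · rintro rfl; rfl
    · intro g _ hg; simp [u, hg]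
    · simp
  have hXU : U₁ = X := eq_of_finrank_eq (fun x hx => hmap none x hx) (by rw [hXd, hUd])
  refine extend_conclude hv hW (fun t x hx => ?_) hXU.symm
  rw [hXU]; exact hmap (some t) x hx

/-- Three arrows, counted with multiplicity, at a vertex outside of the support of a full
representation suffice. -/
theorem hasFullPairFamily_of_three (hF : IsFullRep F) (hv : IsEmpty (F.G v))
    {s : Option (Fin 2) → Σ (j : Q) (_ : v ⟶ j), F.G j} (hs : Function.Injective s) :
    HasFullPairFamily k Q :=
  ⟨F.extend v (fun t => some (s t)) fun _ => none, ⟨v, ⟨.inr ⟨(), rfl⟩⟩⟩,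
    fun _ _ _ _ T _ => extend_isFullFor_out hF hv hs T⟩

/-- Two arrows, counted with multiplicity, at a vertex `v` outside of the support of a full
representation suffice if a further vertex `w` is joined to `v` or to the support. -/
theorem hasFullPairFamily_of_two [Infinite k] (hF : IsFullRep F) (hv : IsEmpty (F.G v))
    (hs : (∃ s : Option (Fin 1) → Σ (j : Q) (_ : v ⟶ j), F.G j, Function.Injective s) ∨
      ∃ s : Option (Fin 1) → Σ (j : Q) (_ : j ⟶ v), F.G j, Function.Injective s)
    {w p : Q} (hw : IsEmpty (F.G w)) (hwv : w ≠ v) (hp : p = v ∨ Nonempty (F.G p))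
    (a : (w ⟶ p) ⊕ (p ⟶ w)) : HasFullPairFamily k Q := by
  rcases hs with ⟨s, hs⟩ | ⟨s, hs⟩
  · refine hasFullPairFamily_of_attach (F.extend v (fun t => some (s t)) fun _ => none)
      (fun N _ _ _ T => extend_isFullFor_out hF hv hs T) (ω := w) (p := p) ⟨?_⟩ ?_ a
    · rintro (g | t)
      · exact hw.false g
      · exact hwv t.2
    · rcases hp with rfl | ⟨⟨g⟩⟩
      · exact ⟨.inr ⟨(), rfl⟩⟩
      · exact ⟨.inl g⟩
  · refine hasFullPairFamily_of_attach (F.extend v (fun _ => none) fun t => some (s t))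
      (fun N _ _ _ T => extend_isFullFor_in hF hv hs T) (ω := w) (p := p) ⟨?_⟩ ?_ a
    · rintro (g | t)
      · exact hw.false g
      · exact hwv t.2
    · rcases hp with rfl | ⟨⟨g⟩⟩
      · exact ⟨.inr ⟨(), rfl⟩⟩
      · exact ⟨.inl g⟩

end Extend

/-! ### Reflections of full representations -/

section Blocks

variable {k : Type*} [Field k] {N : Type*} [AddCommGroup N] [Module k N]

/-- Sequences in `N` which vanish from the index `n` on, as a model of `N ^ n`. -/
def seqSupp (k N : Type*) [Field k] [AddCommGroup N] [Module k N] (n : ℕ) :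
    Submodule k (ℕ → N) where
  carrier := {u | ∀ g, n ≤ g → u g = 0}
  add_mem' hu hv g hg := by simp [hu g hg, hv g hg]
  zero_mem' _ _ := rfl
  smul_mem' c u hu g hg := by simp [hu g hg]

theorem mem_seqSupp {n : ℕ} {u : ℕ → N} : u ∈ seqSupp k N n ↔ ∀ g, n ≤ g → u g = 0 := Iff.rfl

/-- The linear map `N ^ q → N ^ p` given by the upper left `p × q` block of the matrix `m`. -/
def blockMap (N : Type*) [AddCommGroup N] [Module k N] (p q : ℕ) (m : ℕ → ℕ → k) :
    (ℕ → N) →ₗ[k] (ℕ → N) :=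
  LinearMap.pi fun g => if g < p then ∑ g' ∈ Finset.range q, m g g' • LinearMap.proj g' else 0

theorem blockMap_apply (p q : ℕ) (m : ℕ → ℕ → k) (u : ℕ → N) (g : ℕ) :
    blockMap N p q m u g = if g < p then ∑ g' ∈ Finset.range q, m g g' • u g' else 0 := by
  rw [blockMap, LinearMap.pi_apply]
  split_ifs <;> simp

theorem blockMap_mem (p q : ℕ) (m : ℕ → ℕ → k) (u : ℕ → N) :
    blockMap N p q m u ∈ seqSupp k N p := fun g hg => by
  rw [blockMap_apply, if_neg (by omega)]

/-- Extension by zero. -/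
def seqExtend (k N : Type*) [Field k] [AddCommGroup N] [Module k N] (n : ℕ) :
    (Fin n → N) ≃ₗ[k] seqSupp k N n where
  toFun u := ⟨fun g => if h : g < n then u ⟨g, h⟩ else 0, fun g hg => dif_neg (by omega)⟩
  invFun u g := u.1 g
  map_add' u v := by ext g; by_cases h : g < n <;> simp [h]
  map_smul' c u := by ext g; by_cases h : g < n <;> simp [h]
  left_inv u := by ext g; simp
  right_inv u := by
    ext g
    by_cases h : g < n
    · simp [h]
    · simp [h, u.2 g (by omega)]

instance [Module.Finite k N] (n : ℕ) : Module.Finite k (seqSupp k N n) :=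
  Module.Finite.equiv (seqExtend k N n)

theorem finrank_seqSupp [Module.Finite k N] (n : ℕ) :
    Module.finrank k (seqSupp k N n) = n * Module.finrank k N := by
  rw [← (seqExtend k N n).finrank_eq, Module.finrank_pi_fintype]
  simp

/-- The subspace `U₀ ^ n` of `N ^ n`. -/
def seqPow (U₀ : Submodule k N) (n : ℕ) : Submodule k (ℕ → N) :=
  seqSupp k N n ⊓ Submodule.pi Set.univ fun _ => U₀

theorem mem_seqPow {U₀ : Submodule k N} {n : ℕ} {u : ℕ → N} :
    u ∈ seqPow U₀ n ↔ (∀ g, n ≤ g → u g = 0) ∧ ∀ g, u g ∈ U₀ := by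
  simp [seqPow, mem_seqSupp, Submodule.mem_pi]

theorem finrank_seqPow [Module.Finite k N] (U₀ : Submodule k N) (n : ℕ) :
    Module.finrank k (seqPow U₀ n) = n * Module.finrank k U₀ := by
  let e : seqPow U₀ n ≃ₗ[k] seqSupp k U₀ n :=
    { toFun := fun u => ⟨fun g => ⟨u.1 g, (mem_seqPow.1 u.2).2 g⟩, fun g hg =>
        Subtype.ext ((mem_seqPow.1 u.2).1 g hg)⟩
      invFun := fun u => ⟨fun g => (u.1 g).1, mem_seqPow.2 ⟨fun g hg => by rw [u.2 g hg]; rfl,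
        fun g => (u.1 g).2⟩⟩
      map_add' := fun _ _ => rfl
      map_smul' := fun _ _ => rfl
      left_inv := fun _ => rfl
      right_inv := fun _ => rfl }
  rw [e.finrank_eq, finrank_seqSupp]

theorem exists_finrank_eq_between {E : Type*} [AddCommGroup E] [Module k E]
    {R S : Submodule k E} [Module.Finite k S] (h : R ≤ S) {d : ℕ} (hR : Module.finrank k R ≤ d)
    (hS : d ≤ Module.finrank k S) : ∃ X : Submodule k E, R ≤ X ∧ X ≤ S ∧ Module.finrank k X = d := by
  induction d, hR using Nat.le_induction with
  | base => exact ⟨R, le_rfl, h, rfl⟩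
  | succ d hd ih =>
    obtain ⟨X, hRX, hXS, hX⟩ := ih (by omega)
    obtain ⟨x, hxS, hxX⟩ := SetLike.exists_of_lt (lt_of_le_of_ne hXS (by rintro rfl; omega))
    have : Module.Finite k X := Submodule.finiteDimensional_of_le hXS
    refine ⟨X ⊔ k ∙ x, hRX.trans le_sup_left, sup_le hXS (by simpa using hxS), ?_⟩
    have h1 := Submodule.finrank_sup_add_finrank_inf_eq X (k ∙ x)
    have h0 : x ≠ 0 := by rintro rfl; exact hxX X.zero_mem
    have h2 : X ⊓ k ∙ x = ⊥ := by
      rw [Submodule.eq_bot_iff]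
      rintro y ⟨hy, hy'⟩
      obtain ⟨c, rfl⟩ := Submodule.mem_span_singleton.1 hy'
      by_cases hc : c = 0
      · rw [hc, zero_smul]
      · exact absurd ((X.smul_mem_iff hc).1 hy) hxX
    rw [h2, finrank_bot, finrank_span_singleton h0] at h1
    omega

end Blocks

section Reflection

variable {k : Type u} [Field k]

/-- The directed graph on `ℕ` with the list of arrows `L` has a full representation with dimension
vector `z`: matrices `m i j` such that the representations `Z ⊗ N` have the property in
`QuiverFamily.IsFullFor`. -/
def HasFullRep (k : Type u) [Field k] (L : List (ℕ × ℕ)) (z : ℕ → ℕ) : Prop :=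
  ∃ m : ℕ → ℕ → ℕ → ℕ → k, ∀ (N : Type u) [AddCommGroup N] [Module k N] [Module.Finite k N]
    (c : ℕ) (U : ℕ → Submodule k (ℕ → N)), (∀ i, U i ≤ seqSupp k N (z i)) →
    (∀ p ∈ L, ∀ u ∈ U p.1, blockMap N (z p.2) (z p.1) (m p.1 p.2) u ∈ U p.2) →
    (∀ i, Module.finrank k (U i) = z i * c) → ∃ U₀ : Submodule k N, ∀ i, U i = seqPow U₀ (z i)

/-- The simple representations are full. -/
theorem hasFullRep_single (L : List (ℕ × ℕ)) (j : ℕ) : HasFullRep k L (Pi.single j 1) := by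
  classical
  refine ⟨fun _ _ _ _ => 0, fun N _ _ _ c U hU _ hd => ?_⟩
  refine ⟨(U j).map (LinearMap.proj 0), fun i => ?_⟩
  by_cases hi : i = j
  · subst hi
    ext u
    have hU' := hU i
    rw [Pi.single_eq_same] at hU' ⊢
    rw [mem_seqPow]
    constructor
    · intro hu
      refine ⟨hU' hu, fun g => ?_⟩
      rcases Nat.eq_zero_or_pos g with rfl | hg
      · exact ⟨u, hu, rfl⟩
      · rw [hU' hu g hg]; exact Submodule.zero_mem _
    · rintro ⟨hu, hu'⟩
      obtain ⟨u', hu', h⟩ := hu' 0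
      have : u = u' := by
        funext g
        rcases Nat.eq_zero_or_pos g with rfl | hg
        · exact h.symm
        · rw [hu g hg, hU' hu' g hg]
      rw [this]; exact hu'
  · have h1 := hU i
    rw [Pi.single_eq_of_ne hi] at h1 ⊢
    have h0 : ∀ V : Submodule k (ℕ → N), V ≤ seqSupp k N 0 → V = ⊥ := fun V hV =>
      (Submodule.eq_bot_iff _).2 fun u hu => funext fun g => hV hu g (Nat.zero_le _)
    rw [h0 _ h1, h0 (seqPow _ 0) inf_le_left]

/-- The list of arrows in which those ending at `j` are reversed. -/
def flipInto (L : List (ℕ × ℕ)) (j : ℕ) : List (ℕ × ℕ) :=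
  L.map fun p => if p.2 == j then (p.2, p.1) else p

/-- The columns of `κ` are linearly independent vectors in the kernel of the map from the spaces at
the vertices `i ∈ B` to the space at `j`; `ρ` is a left inverse of `κ`. -/
theorem exists_kernel_matrices (B : Finset ℕ) (z : ℕ → ℕ) (n : ℕ) (m : ℕ → ℕ → ℕ → k) :
    ∃ κ ρ : ℕ → ℕ → ℕ → k,
      (∀ g < n, ∀ t < ∑ i ∈ B, z i - n,
        ∑ i ∈ B, ∑ g' ∈ Finset.range (z i), m i g g' * κ i g' t = 0) ∧
      ∀ t < ∑ i ∈ B, z i - n, ∀ t' < ∑ i ∈ B, z i - n,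
        ∑ i ∈ B, ∑ g ∈ Finset.range (z i), ρ i t g * κ i g t' = if t = t' then 1 else 0 := by
  classical
  let X := Σ i : B, Fin (z i)
  have hcard : Fintype.card X = ∑ i ∈ B, z i := by
    rw [Fintype.card_sigma]
    simp only [Fintype.card_fin]
    exact Finset.sum_coe_sort B z
  have hsum : ∀ f : ℕ → ℕ → k, ∑ x : X, f x.1 x.2 = ∑ i ∈ B, ∑ g ∈ Finset.range (z i), f i g := by
    intro f
    rw [Fintype.sum_sigma, ← Finset.sum_coe_sort B]
    exact Finset.sum_congr rfl fun i _ => by rw [Finset.sum_range]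
  let Φ : (X → k) →ₗ[k] (Fin n → k) :=
    LinearMap.pi fun g => ∑ x : X, m x.1 g x.2 • LinearMap.proj x
  have hker : ∑ i ∈ B, z i - n ≤ Module.finrank k (LinearMap.ker Φ) := by
    have h1 := LinearMap.finrank_range_add_finrank_ker Φ
    have h2 := Submodule.finrank_le (LinearMap.range Φ)
    rw [Module.finrank_fintype_fun_eq_card, hcard] at h1
    rw [Module.finrank_fintype_fun_eq_card, Fintype.card_fin] at h2
    omega
  generalize ∑ i ∈ B, z i - n = d at *
  obtain ⟨b, hb⟩ := exists_linearIndependent_of_le_finrank hker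
  let ι : (Fin d → k) →ₗ[k] (X → k) := (LinearMap.ker Φ).subtype ∘ₗ Fintype.linearCombination k b
  have hι : ∀ t, ι (Pi.single t 1) = b t := by
    intro t
    simp [ι, Fintype.linearCombination_apply_single]
  obtain ⟨r, hr⟩ := LinearMap.exists_leftInverse_of_injective ι (by
    rw [LinearMap.ker_eq_bot]
    exact Subtype.val_injective.comp
      (linearIndependent_iff_injective_fintypeLinearCombination.1 hb))
  let κ : ℕ → ℕ → ℕ → k := fun i g t => if h : (∃ _ : i ∈ B, g < z i) ∧ t < d then
    (b ⟨t, h.2⟩).1 ⟨⟨i, h.1.1⟩, ⟨g, h.1.2⟩⟩ else 0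
  let ρ : ℕ → ℕ → ℕ → k := fun i t g => if h : (∃ _ : i ∈ B, g < z i) ∧ t < d then
    r (Pi.single (⟨⟨i, h.1.1⟩, ⟨g, h.1.2⟩⟩ : X) 1) ⟨t, h.2⟩ else 0
  have hκ : ∀ (x : X) (t : ℕ) (ht : t < d), κ x.1 x.2 t = (b ⟨t, ht⟩).1 x := fun x t ht =>
    dif_pos ⟨⟨x.1.2, x.2.2⟩, ht⟩
  have hρ : ∀ (x : X) (t : ℕ) (ht : t < d), ρ x.1 t x.2 = r (Pi.single x 1) ⟨t, ht⟩ :=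
    fun x t ht => dif_pos ⟨⟨x.1.2, x.2.2⟩, ht⟩
  refine ⟨κ, ρ, ?_, ?_⟩
  · intro g hg t ht
    rw [← hsum (fun i g' => m i g g' * κ i g' t)]
    have h1 := congrFun (LinearMap.mem_ker.1 (b ⟨t, ht⟩).2) ⟨g, hg⟩
    simp only [Φ, LinearMap.pi_apply, LinearMap.sum_apply, LinearMap.smul_apply,
      LinearMap.proj_apply, Pi.zero_apply, smul_eq_mul] at h1
    rw [← h1]
    exact Finset.sum_congr rfl fun x _ => by rw [hκ x t ht]
  · intro t ht t' ht'
    rw [← hsum (fun i g => ρ i t g * κ i g t')]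
    have h1 := congrFun (LinearMap.congr_fun hr (Pi.single ⟨t', ht'⟩ 1)) ⟨t, ht⟩
    rw [LinearMap.comp_apply, hι, LinearMap.id_apply, Pi.single_apply] at h1
    simp only [Fin.mk.injEq] at h1
    rw [← h1, LinearMap.pi_apply_eq_sum_univ r, Finset.sum_apply]
    refine Finset.sum_congr rfl fun x _ => ?_
    rw [hκ x t' ht', hρ x t ht, Pi.smul_apply, smul_eq_mul, mul_comm]
    have : (fun y => if x = y then 1 else 0 : X → k) = Pi.single x 1 := by
      funext y
      simp [Pi.single_apply, eq_comm]
    rw [this]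

theorem sum_smul_blockMap {N : Type*} [AddCommGroup N] [Module k N] (B : Finset ℕ) (z : ℕ → ℕ)
    (d : ℕ) (a : ℕ → ℕ → k) (κ : ℕ → ℕ → ℕ → k) (u : ℕ → N) :
    ∑ i ∈ B, ∑ g ∈ Finset.range (z i), a i g • blockMap N (z i) d (κ i) u g =
      ∑ t ∈ Finset.range d, (∑ i ∈ B, ∑ g ∈ Finset.range (z i), a i g * κ i g t) • u t := by
  simp only [Finset.sum_smul]
  rw [Finset.sum_comm]
  refine Finset.sum_congr rfl fun i _ => ?_
  rw [Finset.sum_comm]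
  refine Finset.sum_congr rfl fun g hg => ?_
  rw [blockMap_apply, if_pos (Finset.mem_range.1 hg), Finset.smul_sum]
  simp only [smul_smul]

/-- Reflection at a sink `j` preserves the existence of full representations: the new space at `j`
consists of vectors in the kernel of the map from the adjacent spaces. -/
theorem HasFullRep.reflect {L : List (ℕ × ℕ)} {z : ℕ → ℕ} (h : HasFullRep k L z) {j : ℕ}
    {B : Finset ℕ} (hB : ∀ i, (i, j) ∈ L ↔ i ∈ B) (hj : ∀ p ∈ L, p.1 ≠ j) {i₀ : ℕ} (hi₀ : i₀ ≠ j)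
    (hzi : z i₀ ≠ 0) (hz : z j ≤ ∑ i ∈ B, z i) :
    HasFullRep k (flipInto L j) (Function.update z j (∑ i ∈ B, z i - z j)) := by
  classical
  obtain ⟨m, hm⟩ := h
  obtain ⟨κ, ρ, hκ, hρ⟩ := exists_kernel_matrices B z (z j) fun i => m i j
  obtain ⟨d, hd'⟩ : ∃ d, ∑ i ∈ B, z i - z j = d := ⟨_, rfl⟩
  rw [hd'] at hκ hρ ⊢
  refine ⟨fun a b => if a = j then κ b else m a b, fun N _ _ _ c U hU hst hd => ?_⟩
  have hBj : ∀ i ∈ B, i ≠ j := fun i hi => hj _ ((hB i).2 hi)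
  have hz1 : Function.update z j d j = d := Function.update_self ..
  have hz2 : ∀ i, i ≠ j → Function.update z j d i = z i := fun i hi => Function.update_of_ne hi ..
  have hκU : ∀ i ∈ B, ∀ u ∈ U j, blockMap N (z i) d (κ i) u ∈ U i := by
    intro i hi u hu
    have := hst (j, i) (List.mem_map.2 ⟨(i, j), (hB i).2 hi, by simp⟩) u hu
    rw [hz1, hz2 i (hBj i hi)] at this
    dsimp only at this
    rwa [if_pos rfl] at this
  have hUfin : ∀ i, Module.Finite k (U i) := fun i => Submodule.finiteDimensional_of_le (hU i)
  let Φ : (∀ i : B, U i) →ₗ[k] (ℕ → N) := ∑ i : B,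
    blockMap N (z j) (z i) (m i j) ∘ₗ (U i).subtype ∘ₗ LinearMap.proj i
  let K : U j →ₗ[k] (∀ i : B, U i) := LinearMap.pi fun i =>
    (blockMap N (z i) d (κ i)).restrict (hκU i i.2)
  have hleft : ∀ u ∈ U j, ∀ t < d, u t = ∑ i ∈ B, ∑ g ∈ Finset.range (z i),
      ρ i t g • blockMap N (z i) d (κ i) u g := by
    intro u _ t ht
    rw [sum_smul_blockMap B z d (fun i g => ρ i t g)]
    rw [Finset.sum_eq_single t]
    · rw [hρ t ht t ht, if_pos rfl, one_smul]
    · intro t' ht' hne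
      rw [hρ t ht t' (Finset.mem_range.1 ht'), if_neg hne.symm, zero_smul]
    · intro h'; exact absurd (Finset.mem_range.2 ht) h'
  have hK : Function.Injective K := by
    rw [← LinearMap.ker_eq_bot, LinearMap.ker_eq_bot']
    intro u hu
    ext t
    rcases lt_or_ge t d with ht | ht
    · rw [hleft u u.2 t ht]
      refine Finset.sum_eq_zero fun i hi => Finset.sum_eq_zero fun g _ => ?_
      have : blockMap N (z i) d (κ i) u = 0 := congrArg Subtype.val (congrFun hu ⟨i, hi⟩)
      rw [this, Pi.zero_apply, smul_zero]
    · exact hU j u.2 t (hz1.symm ▸ ht)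
  have hΦK : ∀ u, Φ (K u) = 0 := by
    intro u
    have h1 : Φ (K u) = ∑ i : B, blockMap N (z j) (z i) (m i j) (blockMap N (z i) d (κ i) u) := by
      simp [Φ, K]
    rw [h1, Finset.sum_coe_sort B fun i => blockMap N (z j) (z i) (m i j)
      (blockMap N (z i) d (κ i) u)]
    funext g
    rw [Finset.sum_apply]
    simp only [blockMap_apply _ _ (m _ j)]
    split_ifs with hg
    · rw [sum_smul_blockMap B z d (fun i => m i j g)]
      refine Finset.sum_eq_zero fun t ht => ?_
      rw [hκ g hg t (Finset.mem_range.1 ht), zero_smul]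
    · simp
  have hrange : Module.finrank k (LinearMap.range Φ) ≤ z j * c := by
    have h1 := LinearMap.finrank_range_add_finrank_ker Φ
    have h2 : Module.finrank k (U j) ≤ Module.finrank k (LinearMap.ker Φ) :=
      LinearMap.finrank_le_finrank_of_injective
        (f := K.codRestrict (LinearMap.ker Φ) fun u => LinearMap.mem_ker.2 (hΦK u))
        fun u v huv => hK (congrArg Subtype.val huv)
    have h3 : Module.finrank k (∀ i : B, U i) = (∑ i ∈ B, z i) * c := by
      rw [Module.finrank_pi_fintype, Finset.sum_mul, ← Finset.sum_coe_sort B]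
      exact Finset.sum_congr rfl fun i _ => by rw [hd, hz2 i (hBj i i.2)]
    have h4 : ∑ i ∈ B, z i = d + z j := by omega
    rw [h3, h4, add_mul] at h1
    rw [hd, hz1] at h2
    omega
  have hcN : c ≤ Module.finrank k N := by
    have h1 := Submodule.finrank_mono (hU i₀)
    rw [hd, finrank_seqSupp, hz2 i₀ hi₀] at h1
    exact Nat.le_of_mul_le_mul_left h1 (Nat.pos_of_ne_zero hzi)
  obtain ⟨X, hΦX, hXS, hX⟩ := exists_finrank_eq_between (R := LinearMap.range Φ)
    (S := seqSupp k N (z j)) (by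
      rintro _ ⟨y, rfl⟩
      rw [LinearMap.sum_apply]
      exact Submodule.sum_mem _ fun i _ => blockMap_mem _ _ _ _) hrange
    (by rw [finrank_seqSupp]; exact Nat.mul_le_mul_left _ hcN)
  obtain ⟨U₀, hU₀⟩ := hm N c (Function.update U j X) (fun i => by
      by_cases hi : i = j
      · subst hi; rw [Function.update_self]; exact hXS
      · rw [Function.update_of_ne hi]; exact hz2 i hi ▸ hU i)
    (fun p hp u hu => by
      rw [Function.update_of_ne (hj p hp)] at hu
      by_cases hp2 : p.2 = j
      · rw [hp2, Function.update_self]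
        have hpB : p.1 ∈ B := (hB p.1).1 (hp2 ▸ hp)
        refine hΦX ⟨Pi.single ⟨p.1, hpB⟩ ⟨u, hu⟩, ?_⟩
        rw [LinearMap.sum_apply, Finset.sum_eq_single ⟨p.1, hpB⟩]
        · simp
        · intro i _ hi
          simp [Pi.single_eq_of_ne hi]
        · simp
      · rw [Function.update_of_ne hp2]
        have := hst p (List.mem_map.2 ⟨p, hp, by simp [hp2]⟩) u hu
        rw [hz2 _ hp2, hz2 _ (hj p hp)] at this
        dsimp only at this
        rwa [if_neg (hj p hp)] at this)
    (fun i => by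
      by_cases hi : i = j
      · subst hi; rw [Function.update_self, hX]
      · rw [Function.update_of_ne hi, hd, hz2 i hi])
  have hU₀' : ∀ i, i ≠ j → U i = seqPow U₀ (z i) := fun i hi => by
    rw [← hU₀ i, Function.update_of_ne hi]
  have hc : Module.finrank k U₀ = c := by
    have h1 := hd i₀
    rw [hU₀' i₀ hi₀, finrank_seqPow, hz2 i₀ hi₀] at h1
    exact Nat.eq_of_mul_eq_mul_left (Nat.pos_of_ne_zero hzi) h1
  refine ⟨U₀, fun i => ?_⟩
  by_cases hi : i = j
  · subst hi
    rw [hz1]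
    have hfin : Module.Finite k (seqPow U₀ d) := Submodule.finiteDimensional_of_le inf_le_left
    refine Submodule.eq_of_le_of_finrank_eq (fun u hu => ?_) ?_
    · refine mem_seqPow.2 ⟨hz1 ▸ hU i hu, fun t => ?_⟩
      rcases lt_or_ge t d with ht | ht
      · rw [hleft u hu t ht]
        refine Submodule.sum_mem _ fun l hl => Submodule.sum_mem _ fun g _ =>
          Submodule.smul_mem _ _ ?_
        have h1 := hκU l hl u hu
        rw [hU₀' l (hBj l hl)] at h1
        exact (mem_seqPow.1 h1).2 g
      · rw [hU i hu t (hz1.symm ▸ ht)]; exact Submodule.zero_mem _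
    · rw [hd, finrank_seqPow, hc, hz1]
  · rw [hU₀' i hi, hz2 i hi]

end Reflection

/-! ### Full representations from sequences of reflections -/

/-- The end points of the arrows starting at `j`. -/
def outNeighbours (L : List (ℕ × ℕ)) (j : ℕ) : List ℕ :=
  (L.filter fun p => p.1 == j).map Prod.snd

/-- The list of arrows in which those starting at `j` are reversed. -/
def flipFrom (L : List (ℕ × ℕ)) (j : ℕ) : List (ℕ × ℕ) :=
  L.map fun p => if p.1 == j then (p.2, p.1) else p

/-- Repeated reflections at the first source lead from the arrows `L` and the dimension vector `z`
to a simple root at a source or to a pair which satisfies `b`, in at most as many steps as the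
numerical argument says. -/
def reduces (b : List (ℕ × ℕ) → List ℕ → Bool) : ℕ → List (ℕ × ℕ) → List ℕ → Bool
  | 0, _, _ => false
  | f + 1, L, z => b L z ||
    match (List.range z.length).find? fun j => L.all fun p => p.2 != j with
    | none => false
    | some j =>
      if (z.set j 0).all (· == 0) then z.getD j 0 == 1
      else
        let s := ((outNeighbours L j).map fun i => z.getD i 0).sum
        decide (z.getD j 0 ≤ s) && decide (outNeighbours L j).Nodup &&
          reduces b f (flipFrom L j) (z.set j (s - z.getD j 0))

/-- The property `P` holds for all orientations of the edges in the first list, followed by the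
arrows in the second. -/
def allOrientations (P : List (ℕ × ℕ) → Bool) : List (ℕ × ℕ) → List (ℕ × ℕ) → Bool
  | [], L => P L
  | e :: es, L => allOrientations P es (L ++ [e]) && allOrientations P es (L ++ [(e.2, e.1)])

section Reduce

variable {k : Type u} [Field k]

theorem getD_set_self {z : List ℕ} {j d : ℕ} (hj : j < z.length) : (z.set j d).getD j 0 = d := by
  simp [List.getD_eq_getElem?_getD, hj]

theorem getD_set_ne {z : List ℕ} {i j d : ℕ} (h : i ≠ j) :
    (z.set j d).getD i 0 = z.getD i 0 := by
  simp [List.getD_eq_getElem?_getD, List.getElem?_set_ne h.symm]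

theorem hasFullRep_of_reduces {b : List (ℕ × ℕ) → List ℕ → Bool}
    (hb : ∀ L z, b L z = true → HasFullRep k L fun i => z.getD i 0) :
    ∀ (f : ℕ) (L : List (ℕ × ℕ)) (z : List ℕ), reduces b f L z = true →
      HasFullRep k L fun i => z.getD i 0 := by
  intro f
  induction f with
  | zero => intro L z h; simp [reduces] at h
  | succ f ih =>
    intro L z h
    rw [reduces, Bool.or_eq_true] at h
    rcases h with h | h
    · exact hb L z h
    split at h
    · exact absurd h (by simp)
    rename_i j hfind
    have hsrc : ∀ p ∈ L, p.2 ≠ j := by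
      have := List.find?_some hfind
      simpa using this
    have hjz : j < z.length := List.mem_range.1 (List.mem_of_find?_eq_some hfind)
    split_ifs at h with h0
    · convert hasFullRep_single (k := k) L j using 1
      funext i
      by_cases hi : i = j
      · subst hi; simpa using h
      · rw [Pi.single_eq_of_ne hi, ← getD_set_ne (d := 0) hi]
        rw [List.all_eq_true] at h0
        rcases lt_or_ge i (z.set j 0).length with hl | hl
        · rw [List.getD_eq_getElem _ _ hl]
          simpa using h0 _ (List.getElem_mem hl)
        · exact List.getD_eq_default _ _ hl
    · simp only [Bool.and_eq_true, decide_eq_true_eq] at h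
      obtain ⟨⟨hle, hnd⟩, hred⟩ := h
      have hmem : ∀ i, i ∈ outNeighbours L j ↔ (j, i) ∈ L := by
        intro i; simp [outNeighbours]
      have hne : ∀ i ∈ outNeighbours L j, i ≠ j := fun i hi => hsrc _ ((hmem i).1 hi)
      set s := ((outNeighbours L j).map fun i => z.getD i 0).sum with hs
      obtain ⟨i₀, hi₀, hzi₀⟩ : ∃ i, i ≠ j ∧ z.getD i 0 ≠ 0 := by
        by_contra hcon
        push Not at hcon
        refine h0 (List.all_eq_true.2 fun x hx => ?_)
        obtain ⟨i, hi, rfl⟩ := List.getElem_of_mem hx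
        rw [← List.getD_eq_getElem _ 0 hi]
        by_cases hij : i = j
        · rw [hij, getD_set_self hjz]; rfl
        · rw [getD_set_ne hij, hcon i hij]; rfl
      have hsum : ∑ i ∈ (outNeighbours L j).toFinset, (z.set j (s - z.getD j 0)).getD i 0 = s := by
        rw [List.sum_toFinset _ hnd, hs]
        exact congrArg List.sum (List.map_congr_left fun i hi => getD_set_ne (hne i hi))
      have key := (ih _ _ hred).reflect (j := j) (B := (outNeighbours L j).toFinset) (i₀ := i₀)
        (by
          intro i
          rw [List.mem_toFinset, hmem, flipFrom, List.mem_map]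
          constructor
          · rintro ⟨p, hp, h⟩
            by_cases hpj : p.1 = j
            · simp only [hpj, beq_self_eq_true, if_true, Prod.mk.injEq] at h
              rw [← h.1, ← hpj]; exact hp
            · rw [if_neg (by simpa using hpj)] at h
              exact absurd (by rw [h]) (hsrc p hp)
          · intro h; exact ⟨_, h, by simp⟩)
        (by
          intro p hp
          obtain ⟨q, hq, rfl⟩ := List.mem_map.1 hp
          by_cases hqj : q.1 = j
          · simpa [hqj] using hsrc q hq
          · simp [hqj])
        hi₀ (by rwa [getD_set_ne hi₀]) (by rw [hsum, getD_set_self hjz]; omega)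
      rw [hsum, getD_set_self hjz] at key
      convert key using 1
      · rw [flipInto, flipFrom, List.map_map]
        conv_lhs => rw [← List.map_id L]
        refine List.map_congr_left fun p hp => ?_
        by_cases hpj : p.1 = j
        · obtain ⟨a, c⟩ := p
          dsimp only at hpj
          simp [hpj]
        · simp [hpj, hsrc p hp]
      · funext i
        by_cases hi : i = j
        · subst hi; rw [Function.update_self]; omega
        · rw [Function.update_of_ne hi, getD_set_ne hi]

theorem of_allOrientations {P : List (ℕ × ℕ) → Bool} : ∀ (E L : List (ℕ × ℕ)),
    allOrientations P E L = true → ∀ M : List (ℕ × ℕ),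
      List.Forall₂ (fun e p => p = e ∨ p = (e.2, e.1)) E M → P (L ++ M) = true := by
  intro E
  induction E with
  | nil =>
    intro L h M hM
    rw [List.forall₂_nil_left_iff] at hM
    rw [hM, List.append_nil]; exact h
  | cons e es ih =>
    intro L h M hM
    rw [allOrientations, Bool.and_eq_true] at h
    rw [List.forall₂_cons_left_iff] at hM
    obtain ⟨p, M, hp, hM, rfl⟩ := hM
    rcases hp with rfl | rfl
    · simpa using ih _ h.1 M hM
    · simpa using ih _ h.2 M hM

/-- If the dimension vector `z` reduces to a simple root for the orientation `E`, and all other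
orientations reduce to this one without changing `z`, then there are full representations with
dimension vector `z` for all orientations. -/
theorem hasFullRep_of_orientation {E : List (ℕ × ℕ)} {z : List ℕ} {f : ℕ}
    (h₀ : reduces (fun _ _ => false) f E z = true)
    (h : allOrientations (fun L => reduces (fun L' z' => L' == E && z' == z) f L z) E [] = true)
    {M : List (ℕ × ℕ)} (hM : List.Forall₂ (fun e p => p = e ∨ p = (e.2, e.1)) E M) :
    HasFullRep k M fun i => z.getD i 0 := by
  have h1 : HasFullRep k E fun i => z.getD i 0 := hasFullRep_of_reduces (by simp) f E z h₀
  refine hasFullRep_of_reduces (fun L' z' h' => ?_) f M z (of_allOrientations E [] h M hM)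
  simp only [Bool.and_eq_true, beq_iff_eq] at h'
  rw [h'.1, h'.2]; exact h1

/-- The highest root of `D₄`, for all orientations. -/
theorem hasFullRep_D4 {M : List (ℕ × ℕ)}
    (hM : List.Forall₂ (fun e p => p = e ∨ p = (e.2, e.1)) [(3, 0), (3, 1), (3, 2)] M) :
    HasFullRep k M fun i => [1, 1, 1, 2].getD i 0 :=
  hasFullRep_of_orientation (f := 200) (by decide +kernel) (by decide +kernel) hM

/-- The highest root of `E₆`, for all orientations. -/
theorem hasFullRep_E6 {M : List (ℕ × ℕ)}
    (hM : List.Forall₂ (fun e p => p = e ∨ p = (e.2, e.1))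
      [(5, 0), (0, 1), (1, 2), (0, 3), (3, 4)] M) :
    HasFullRep k M fun i => [3, 2, 1, 2, 1, 2].getD i 0 :=
  hasFullRep_of_orientation (f := 200) (by decide +kernel) (by decide +kernel) hM

/-- The highest root of `E₇`, for all orientations. -/
theorem hasFullRep_E7 {M : List (ℕ × ℕ)}
    (hM : List.Forall₂ (fun e p => p = e ∨ p = (e.2, e.1))
      [(6, 1), (1, 0), (0, 2), (2, 3), (3, 4), (0, 5)] M) :
    HasFullRep k M fun i => [4, 3, 3, 2, 1, 2, 2].getD i 0 :=
  hasFullRep_of_orientation (f := 200) (by decide +kernel) (by decide +kernel) hM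

/-- The highest root of `E₈`, for all orientations. -/
theorem hasFullRep_E8 {M : List (ℕ × ℕ)}
    (hM : List.Forall₂ (fun e p => p = e ∨ p = (e.2, e.1))
      [(7, 3), (3, 2), (2, 1), (1, 0), (0, 4), (4, 5), (0, 6)] M) :
    HasFullRep k M fun i => [6, 5, 4, 3, 4, 2, 3, 2].getD i 0 :=
  hasFullRep_of_orientation (f := 200) (by decide +kernel) (by decide +kernel) hM

end Reduce

/-! ### Full representations supported on configurations of vertices -/

section Transfer

variable {k : Type u} [Field k] {Q : Type*} [Quiver Q]

/-- There is an arrow between `x` and `y`, in either direction. -/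
def QuiverAdj (x y : Q) : Prop := Nonempty (x ⟶ y) ∨ Nonempty (y ⟶ x)

theorem QuiverAdj.symm {x y : Q} (h : QuiverAdj x y) : QuiverAdj y x := Or.symm h

/-- A full representation of the directed graph `L` yields one of `Q` if the vertices `f i` of `Q`
are labelled, by a monotone function `lab`, with the vertices of `L` in such a way that vertices
with the same label are joined by arrows, and that the arrows of `L` lift to arrows of `Q`. The
maps at arrows between vertices with the same label are identities. -/
theorem exists_isFullRep_of_labels {L : List (ℕ × ℕ)} {z : ℕ → ℕ} (h : HasFullRep k L z)
    {f : ℕ → Q} {n : ℕ} (hf : ∀ i < n, ∀ j < n, f i = f j → i = j) {lab : ℕ → ℕ}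
    (hlab : Monotone lab) (hadj : ∀ i, i + 1 < n → lab i = lab (i + 1) → QuiverAdj (f i) (f (i + 1)))
    (hL : ∀ p ∈ L, p.1 ≠ p.2 ∧ ∃ i < n, ∃ j < n, lab i = p.1 ∧ lab j = p.2 ∧
      Nonempty (f i ⟶ f j))
    (hz : ∀ i, z i ≠ 0 → ∃ j < n, lab j = i) :
    ∃ F : QuiverFamily k Q 0, IsFullRep F ∧ (∀ i < n, Fintype.card (F.G (f i)) = z (lab i)) ∧
      ∀ x, (∀ i < n, f i ≠ x) → IsEmpty (F.G x) := by
  classical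
  obtain ⟨m, hm⟩ := h
  obtain ⟨π, hπ, hπ'⟩ : ∃ π : Q → Option ℕ, (∀ i < n, π (f i) = some (lab i)) ∧
      ∀ x, (∀ i < n, f i ≠ x) → π x = none := by
    refine ⟨fun x => if h : ∃ i, i < n ∧ f i = x then some (lab h.choose) else none,
      fun i hi => ?_, fun x hx => ?_⟩
    · have h : ∃ i', i' < n ∧ f i' = f i := ⟨i, hi, rfl⟩
      beta_reduce
      rw [dif_pos h, hf _ h.choose_spec.1 _ hi h.choose_spec.2]
    · beta_reduce
      rw [dif_neg]
      rintro ⟨i, hi, h⟩; exact hx i hi h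
  let F : QuiverFamily k Q 0 :=
    { G := fun x => Fin ((π x).elim 0 z)
      coeff := fun {x y} _ g g' _ => if π x = π y then (if (g : ℕ) = g' then 1 else 0) else
        m ((π x).getD 0) ((π y).getD 0) g g' }
  refine ⟨F, ?_, ?_, ?_⟩
  · intro N _ _ _ T c U hU hd
    let W : Q → Submodule k (ℕ → N) := fun x =>
      (U x).map ((seqSupp k N ((π x).elim 0 z)).subtype ∘ₗ
        (seqExtend k N ((π x).elim 0 z)).toLinearMap)
    have hval : ∀ x (u : F.G x → N) (g : ℕ), (seqExtend k N ((π x).elim 0 z) u).1 g =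
      if h : g < (π x).elim 0 z then u ⟨g, h⟩ else 0 := fun _ _ _ => rfl
    have hWle : ∀ x, W x ≤ seqSupp k N ((π x).elim 0 z) := by
      rintro x _ ⟨u, -, rfl⟩
      exact (seqExtend k N ((π x).elim 0 z) u).2
    have hinj : ∀ x, Function.Injective ((seqSupp k N ((π x).elim 0 z)).subtype ∘ₗ
        (seqExtend k N ((π x).elim 0 z)).toLinearMap) := fun x =>
      (Submodule.injective_subtype _).comp (seqExtend k N ((π x).elim 0 z)).injective
    have hWd : ∀ x, Module.finrank k (W x) = (π x).elim 0 z * c := by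
      intro x
      rw [← (Submodule.equivMapOfInjective _ (hinj x) _).finrank_eq, hd]
      congr 1
      exact Fintype.card_fin _
    have hmap : ∀ {x y : Q} (a : x ⟶ y) (u : F.G x → N) (g : F.G y), F.map T a u g =
        ∑ g' : Fin ((π x).elim 0 z), (if π x = π y then (if (g : ℕ) = g' then 1 else 0) else
          m ((π x).getD 0) ((π y).getD 0) g g') • u g' := by
      intro x y a u g
      rw [QuiverFamily.map_apply]
      refine Finset.sum_congr rfl fun g' _ => ?_
      rw [Finset.univ_eq_empty, Finset.sum_empty, add_zero]
    have hsame : ∀ {x y : Q}, (x ⟶ y) → π x = π y → W x = W y := by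
      intro x y a hxy
      have hfin : Module.Finite k (W y) := Submodule.finiteDimensional_of_le (hWle y)
      refine Submodule.eq_of_le_of_finrank_eq ?_ (by rw [hWd, hWd, hxy])
      rintro _ ⟨u, hu, rfl⟩
      refine ⟨_, hU a u hu, funext fun g => ?_⟩
      refine (hval y _ g).trans (Eq.trans ?_ (hval x u g).symm)
      by_cases hg : g < (π x).elim 0 z
      · rw [dif_pos hg, dif_pos (hxy ▸ hg), hmap, Finset.sum_eq_single ⟨g, hg⟩]
        · rw [if_pos hxy, if_pos rfl, one_smul]
        · intro g' _ hg'
          rw [if_pos hxy, if_neg (fun h => hg' (Fin.ext h.symm)), zero_smul]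
        · simp
      · rw [dif_neg hg, dif_neg (hxy ▸ hg)]
    have hfib : ∀ i j, i ≤ j → j < n → lab i = lab j → W (f i) = W (f j) := by
      intro i j hij
      induction j, hij using Nat.le_induction with
      | base => intros; rfl
      | succ j hij ih =>
        intro hj hl
        have h1 : lab i = lab j := le_antisymm (hlab hij) (hl ▸ hlab j.le_succ)
        rw [ih (by omega) h1]
        have h2 : lab j = lab (j + 1) := h1 ▸ hl
        have h3 : π (f j) = π (f (j + 1)) := by rw [hπ j (by omega), hπ _ hj, h2]
        rcases hadj j hj h2 with ⟨⟨a⟩⟩ | ⟨⟨a⟩⟩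
        · exact hsame a h3
        · exact (hsame a h3.symm).symm
    obtain ⟨V, hV, hV'⟩ : ∃ V : ℕ → Submodule k (ℕ → N), (∀ i < n, V (lab i) = W (f i)) ∧
        ∀ l, (∀ i < n, lab i ≠ l) → V l = ⊥ := by
      refine ⟨fun l => if h : ∃ i, i < n ∧ lab i = l then W (f h.choose) else ⊥,
        fun i hi => ?_, fun l hl => ?_⟩
      · have h : ∃ i', i' < n ∧ lab i' = lab i := ⟨i, hi, rfl⟩
        beta_reduce
        rw [dif_pos h]
        rcases le_total h.choose i with hle | hle
        · exact hfib _ _ hle hi h.choose_spec.2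
        · exact (hfib _ _ hle h.choose_spec.1 h.choose_spec.2.symm).symm
      · beta_reduce
        rw [dif_neg]
        rintro ⟨i, hi, h⟩; exact hl i hi h
    have hnone : ∀ l, (∀ i < n, lab i ≠ l) → z l = 0 := by
      intro l hl
      by_contra h0
      obtain ⟨j, hj, h⟩ := hz l h0
      exact hl j hj h
    obtain ⟨U₀, hU₀⟩ := hm N c V
      (fun l => by
        by_cases hl : ∃ i < n, lab i = l
        · obtain ⟨i, hi, rfl⟩ := hl
          have := hWle (f i)
          rwa [hπ i hi, ← hV i hi] at this
        · push Not at hl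
          rw [hV' l hl]; exact bot_le)
      (fun p hp u hu => by
        obtain ⟨hne, i, hi, j, hj, hli, hlj, ⟨a⟩⟩ := hL p hp
        rw [← hli, ← hlj] at hne ⊢
        rw [← hli, hV i hi] at hu
        rw [hV j hj]
        obtain ⟨u, hu, rfl⟩ := hu
        refine ⟨_, hU a u hu, funext fun g => ?_⟩
        refine (hval _ _ g).trans ?_
        have e1 : (π (f i)).elim 0 z = z (lab i) := by rw [hπ i hi]; rfl
        have e2 : (π (f j)).elim 0 z = z (lab j) := by rw [hπ j hj]; rfl
        have e3 : π (f i) ≠ π (f j) := by rw [hπ i hi, hπ j hj]; simpa using hne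
        rw [← e1, ← e2, blockMap_apply]
        by_cases hg : g < (π (f j)).elim 0 z
        · rw [dif_pos hg, if_pos hg, hmap, Finset.sum_range]
          refine Finset.sum_congr rfl fun g' _ => ?_
          rw [if_neg e3]
          have h1 : (π (f i)).getD 0 = lab i := by rw [hπ i hi]; rfl
          have h2 : (π (f j)).getD 0 = lab j := by rw [hπ j hj]; rfl
          rw [h1, h2]
          congr 1
          exact ((hval (f i) u g').trans (dif_pos g'.2)).symm
        · rw [dif_neg hg, if_neg hg])
      (fun l => by
        by_cases hl : ∃ i < n, lab i = l
        · obtain ⟨i, hi, rfl⟩ := hl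
          rw [hV i hi, hWd, hπ i hi]; rfl
        · push Not at hl
          rw [hV' l hl, hnone l hl, finrank_bot, zero_mul])
    refine ⟨U₀, fun t => t.elim0, fun x => ?_⟩
    ext u
    by_cases hx : ∃ i < n, f i = x
    · obtain ⟨i, hi, rfl⟩ := hx
      have h1 : u ∈ U (f i) ↔ (seqExtend k N ((π (f i)).elim 0 z) u).1 ∈ W (f i) := by
        constructor
        · intro h; exact ⟨u, h, rfl⟩
        · rintro ⟨u', hu', h⟩
          rwa [← hinj (f i) h]
      rw [h1, ← hV i hi, hU₀, mem_seqPow]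
      constructor
      · intro h g _
        have := h.2 g
        rw [hval] at this
        rwa [dif_pos g.2] at this
      · intro h
        refine ⟨fun g hg => ?_, fun g => ?_⟩
        · rw [hval, dif_neg]
          rw [hπ i hi]
          exact not_lt.2 hg
        · rw [hval]
          split_ifs with hg
          · exact h ⟨g, hg⟩ trivial
          · exact U₀.zero_mem
    · push Not at hx
      have hemp : IsEmpty (F.G x) := by
        have : (π x).elim 0 z = 0 := by rw [hπ' x hx]; rfl
        exact ⟨fun g => absurd g.2 (by omega)⟩
      have : u = 0 := funext fun g => (hemp.false g).elim
      rw [this]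
      exact ⟨fun _ => Submodule.zero_mem _, fun _ => Submodule.zero_mem _⟩
  · intro i hi
    refine (Fintype.card_fin _).trans ?_
    rw [hπ i hi]; rfl
  · intro x hx
    have : (π x).elim 0 z = 0 := by rw [hπ' x hx]; rfl
    exact ⟨fun g => absurd g.2 (by omega)⟩

end Transfer

/-! ### Configurations of vertices in a wild quiver -/

section Configurations

variable {k : Type u} [Field k] {Q : Type*} [Quiver Q]

theorem IsAcyclicQuiver.isEmpty_hom (hQ : IsAcyclicQuiver Q) {a b : Q} (f : a ⟶ b) :
    IsEmpty (b ⟶ a) :=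
  ⟨fun g => by simpa using hQ a ((Quiver.Hom.toPath f).comp (Quiver.Hom.toPath g))⟩

theorem QuiverAdj.ne (hQ : IsAcyclicQuiver Q) {a b : Q} (h : QuiverAdj a b) : a ≠ b := by
  rintro rfl
  rcases h with ⟨⟨f⟩⟩ | ⟨⟨f⟩⟩ <;> exact (hQ.isEmpty_hom f).false f

/-- All arrows between two vertices of an acyclic quiver have the same direction. -/
theorem exists_injective_of_le_edgeMultiplicity [∀ i j : Q, Finite (i ⟶ j)]
    (hQ : IsAcyclicQuiver Q) {a b : Q} {m : ℕ} (h : m ≤ edgeMultiplicity a b) :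
    (∃ s : Fin m → (a ⟶ b), Function.Injective s) ∨ ∃ s : Fin m → (b ⟶ a), Function.Injective s := by
  have key : ∀ {x y : Q}, m ≤ Nat.card (x ⟶ y) → ∃ s : Fin m → (x ⟶ y), Function.Injective s := by
    intro x y hxy
    let e := Finite.equivFin (x ⟶ y)
    exact ⟨fun t => e.symm (Fin.castLE hxy t), e.symm.injective.comp (Fin.castLE_injective hxy)⟩
  rw [edgeMultiplicity] at h
  rcases isEmpty_or_nonempty (a ⟶ b) with h0 | ⟨⟨f⟩⟩
  · rw [Nat.card_of_isEmpty, zero_add] at h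
    exact .inr (key h)
  · have := hQ.isEmpty_hom f
    rw [Nat.card_of_isEmpty (α := b ⟶ a), add_zero] at h
    exact .inl (key h)

/-- One-dimensional spaces on a connected set of vertices. -/
theorem exists_isFullRep_thin (k : Type u) [Field k] {f : ℕ → Q} {n : ℕ} (hn : 0 < n)
    (hf : ∀ i < n, ∀ j < n, f i = f j → i = j)
    (hadj : ∀ i, i + 1 < n → QuiverAdj (f i) (f (i + 1))) :
    ∃ F : QuiverFamily k Q 0, IsFullRep F ∧ (∀ i < n, Nonempty (F.G (f i))) ∧
      ∀ x, (∀ i < n, f i ≠ x) → IsEmpty (F.G x) := by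
  obtain ⟨F, hF, h1, h2⟩ := exists_isFullRep_of_labels (hasFullRep_single (k := k) [] 0) hf
    (lab := fun _ => 0) monotone_const (fun i hi _ => hadj i hi) (by simp) (fun i hi => ⟨0, hn, by
      by_contra h
      exact hi (Pi.single_eq_of_ne (Ne.symm h) _)⟩)
  refine ⟨F, hF, fun i hi => ?_, h2⟩
  rw [← Fintype.card_pos_iff, h1 i hi]
  simp

theorem hasFullPairFamily_of_three_le [∀ i j : Q, Finite (i ⟶ j)] (hQ : IsAcyclicQuiver Q)
    {a b : Q} (h : 3 ≤ edgeMultiplicity a b) : HasFullPairFamily k Q := by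
  have key : ∀ {x y : Q}, (∃ s : Fin 3 → (x ⟶ y), Function.Injective s) →
      HasFullPairFamily k Q := by
    rintro x y ⟨s, hs⟩
    have hxy : x ≠ y := QuiverAdj.ne hQ (.inl ⟨s 0⟩)
    obtain ⟨F, hF, h1, h2⟩ := exists_isFullRep_thin k (f := fun _ => y) one_pos
      (fun i hi j hj _ => by omega) (fun i hi => by omega)
    obtain ⟨g⟩ := h1 0 one_pos
    refine hasFullPairFamily_of_three hF (v := x) (h2 x fun _ _ => hxy.symm)
      (s := fun t => ⟨y, s (finSuccEquiv 2 |>.symm t), g⟩) fun t t' h => ?_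
    simpa [hs.eq_iff] using h
  rcases exists_injective_of_le_edgeMultiplicity hQ h with h | h
  · exact key h
  · exact key h

theorem hasFullPairFamily_of_two_le [Infinite k] [∀ i j : Q, Finite (i ⟶ j)]
    (hQ : IsAcyclicQuiver Q) {a b : Q} (h : 2 ≤ edgeMultiplicity a b) {w : Q} (hwa : w ≠ a)
    (hwb : w ≠ b) (hw : QuiverAdj w a ∨ QuiverAdj w b) : HasFullPairFamily k Q := by
  have key : ∀ {x y : Q}, (∃ s : Fin 2 → (x ⟶ y), Function.Injective s) → w ≠ x → w ≠ y →
      QuiverAdj w x ∨ QuiverAdj w y → HasFullPairFamily k Q := by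
    rintro x y ⟨s, hs⟩ hwx hwy hw
    have hxy : x ≠ y := QuiverAdj.ne hQ (.inl ⟨s 0⟩)
    obtain ⟨F, hF, h1, h2⟩ := exists_isFullRep_thin k (f := fun _ => y) one_pos
      (fun i hi j hj _ => by omega) (fun i hi => by omega)
    have hg := h1 0 one_pos
    have hs' : ∃ s : Option (Fin 1) → Σ (j : Q) (_ : x ⟶ j), F.G j, Function.Injective s := by
      refine ⟨fun t => ⟨y, s (finSuccEquiv 1 |>.symm t), hg.some⟩, fun t t' h => ?_⟩
      simpa [hs.eq_iff] using h
    rcases hw with (⟨⟨c⟩⟩ | ⟨⟨c⟩⟩) | (⟨⟨c⟩⟩ | ⟨⟨c⟩⟩)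
    · exact hasFullPairFamily_of_two hF (h2 x fun _ _ => hxy.symm) (.inl hs')
        (h2 w fun _ _ => hwy.symm) hwx (.inl rfl) (.inl c)
    · exact hasFullPairFamily_of_two hF (h2 x fun _ _ => hxy.symm) (.inl hs')
        (h2 w fun _ _ => hwy.symm) hwx (.inl rfl) (.inr c)
    · exact hasFullPairFamily_of_two hF (h2 x fun _ _ => hxy.symm) (.inl hs')
        (h2 w fun _ _ => hwy.symm) hwx (.inr hg) (.inl c)
    · exact hasFullPairFamily_of_two hF (h2 x fun _ _ => hxy.symm) (.inl hs')
        (h2 w fun _ _ => hwy.symm) hwx (.inr hg) (.inr c)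
  rcases exists_injective_of_le_edgeMultiplicity hQ h with h | h
  · exact key h hwa hwb hw
  · exact key h hwb hwa hw.symm

/-- The vertex `w` is not among the first `n` terms of `f` but is joined to one of them. -/
def IsAttached (f : ℕ → Q) (n : ℕ) (w : Q) : Prop :=
  (∀ i < n, f i ≠ w) ∧ ∃ i < n, QuiverAdj w (f i)

/-- If the last of `n + 1` vertices has two slots in the support of a full representation on
the others, a further vertex suffices. -/
theorem hasFullPairFamily_of_isAttached [Infinite k] {f : ℕ → Q} {n : ℕ}
    (hf : ∀ i < n + 1, ∀ j < n + 1, f i = f j → i = j) {F : QuiverFamily k Q 0} (hF : IsFullRep F)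
    (hne : ∀ i < n, Nonempty (F.G (f i))) (hemp : ∀ x, (∀ i < n, f i ≠ x) → IsEmpty (F.G x))
    (hs : (∃ s : Option (Fin 1) → Σ (j : Q) (_ : f n ⟶ j), F.G j, Function.Injective s) ∨
      ∃ s : Option (Fin 1) → Σ (j : Q) (_ : j ⟶ f n), F.G j, Function.Injective s)
    {w : Q} (hw : IsAttached f (n + 1) w) : HasFullPairFamily k Q := by
  classical
  obtain ⟨hw, i, hi, hwi⟩ := hw
  refine hasFullPairFamily_of_two hF (hemp _ fun i hi h => ?_) hs (hemp w fun i hi => hw i (by omega))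
    (hw n n.lt_succ_self).symm (p := f i) ?_ ?_
  · exact absurd (hf i (by omega) n (by omega) h) (by omega)
  · rcases Nat.lt_succ_iff_lt_or_eq.1 hi with hi | rfl
    · exact .inr (hne i hi)
    · exact .inl rfl
  · exact (if h : Nonempty (w ⟶ f i) then .inl h.some else .inr (hwi.resolve_left h).some)

/-- A cycle with a further vertex; `f n` is a source of the cycle. -/
theorem hasFullPairFamily_of_cycle [Infinite k] {f : ℕ → Q} {n : ℕ} (hn : 2 ≤ n)
    (hf : ∀ i < n + 1, ∀ j < n + 1, f i = f j → i = j)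
    (hadj : ∀ i, i + 1 < n → QuiverAdj (f i) (f (i + 1)))
    (h₁ : Nonempty (f n ⟶ f 0)) (h₂ : Nonempty (f n ⟶ f (n - 1))) {w : Q}
    (hw : IsAttached f (n + 1) w) : HasFullPairFamily k Q := by
  obtain ⟨F, hF, h3, h4⟩ := exists_isFullRep_thin k (f := f) (n := n) (by omega)
    (fun i hi j hj => hf i (by omega) j (by omega)) hadj
  refine hasFullPairFamily_of_isAttached hf hF h3 h4 (.inl ?_) hw
  obtain ⟨a⟩ := h₁
  obtain ⟨b⟩ := h₂
  obtain ⟨g⟩ := h3 0 (by omega)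
  obtain ⟨g'⟩ := h3 (n - 1) (by omega)
  have hne : f 0 ≠ f (n - 1) := fun h =>
    absurd (hf 0 (by omega) (n - 1) (by omega) h) (by omega)
  let s : Option (Fin 1) → Σ (j : Q) (_ : f n ⟶ j), F.G j := fun t =>
    t.elim ⟨f 0, a, g⟩ fun _ => ⟨f (n - 1), b, g'⟩
  refine ⟨s, fun t t' h => ?_⟩
  rcases t with _ | t <;> rcases t' with _ | t'
  · rfl
  · exact absurd (congrArg Sigma.fst h) hne
  · exact absurd (congrArg Sigma.fst h) hne.symm
  · rw [Subsingleton.elim t t']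

/-- A configuration supporting a root for all orientations, a vertex joined to a two-dimensional
space, and a further vertex. -/
theorem hasFullPairFamily_of_root [Infinite k] {E : List (ℕ × ℕ)} {z : ℕ → ℕ}
    (hE : ∀ M : List (ℕ × ℕ), List.Forall₂ (fun e p => p = e ∨ p = (e.2, e.1)) E M →
      HasFullRep k M z)
    {f : ℕ → Q} {n : ℕ} (hf : ∀ i < n + 1, ∀ j < n + 1, f i = f j → i = j) {lab : ℕ → ℕ}
    (hlab : Monotone lab) (hadj : ∀ i, i + 1 < n → lab i = lab (i + 1) → QuiverAdj (f i) (f (i + 1)))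
    (hEf : ∀ e ∈ E, e.1 ≠ e.2 ∧ ∃ i < n, ∃ j < n, lab i = e.1 ∧ lab j = e.2 ∧
      QuiverAdj (f i) (f j))
    (hz : ∀ l, z l ≠ 0 → ∃ j < n, lab j = l) (hpos : ∀ i < n, z (lab i) ≠ 0)
    {p : ℕ} (hp : p < n) (hzp : z (lab p) = 2) (hvp : QuiverAdj (f n) (f p)) {w : Q}
    (hw : IsAttached f (n + 1) w) : HasFullPairFamily k Q := by
  obtain ⟨M, hM, hML⟩ : ∃ M : List (ℕ × ℕ),
      List.Forall₂ (fun e p => p = e ∨ p = (e.2, e.1)) E M ∧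
      ∀ p ∈ M, p.1 ≠ p.2 ∧ ∃ i < n, ∃ j < n, lab i = p.1 ∧ lab j = p.2 ∧
        Nonempty (f i ⟶ f j) := by
    clear hE
    induction E with
    | nil => exact ⟨[], .nil, by simp⟩
    | cons e E ih =>
      obtain ⟨M, hM, hML⟩ := ih fun e he => hEf e (List.mem_cons_of_mem _ he)
      obtain ⟨hne, i, hi, j, hj, hli, hlj, hij⟩ := hEf e List.mem_cons_self
      rcases hij with hij | hij
      · refine ⟨e :: M, .cons (.inl rfl) hM, fun p hp => ?_⟩
        rcases List.mem_cons.1 hp with rfl | hp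
        · exact ⟨hne, i, hi, j, hj, hli, hlj, hij⟩
        · exact hML p hp
      · refine ⟨(e.2, e.1) :: M, .cons (.inr rfl) hM, fun p hp => ?_⟩
        rcases List.mem_cons.1 hp with rfl | hp
        · exact ⟨hne.symm, j, hj, i, hi, hlj, hli, hij⟩
        · exact hML p hp
  obtain ⟨F, hF, h1, h2⟩ := exists_isFullRep_of_labels (hE M hM)
    (fun i hi j hj => hf i (by omega) j (by omega)) hlab hadj hML hz
  have hne : ∀ i < n, Nonempty (F.G (f i)) := fun i hi => by
    rw [← Fintype.card_pos_iff, h1 i hi]; exact Nat.pos_of_ne_zero (hpos i hi)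
  refine hasFullPairFamily_of_isAttached hf hF hne h2 ?_ hw
  have e : Option (Fin 1) ≃ F.G (f p) := Fintype.equivOfCardEq (by rw [h1 p hp, hzp]; rfl)
  rcases hvp with ⟨⟨a⟩⟩ | ⟨⟨a⟩⟩
  · refine .inl ⟨fun t => ⟨f p, a, e t⟩, fun t t' h => ?_⟩
    simpa using h
  · refine .inr ⟨fun t => ⟨f p, a, e t⟩, fun t t' h => ?_⟩
    simpa using h

/-- The first `n` terms of `f` are distinct, and terms are in the relation `R` according to the
list `L`. -/
structure IsConfig {V : Type*} (R : V → V → Prop) (f : ℕ → V) (n : ℕ) (L : List (ℕ × ℕ)) :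
    Prop where
  inj : ∀ i < n, ∀ j < n, f i = f j → i = j
  adj : ∀ e ∈ L, R (f e.1) (f e.2)

theorem IsConfig.quiverAdj {f : ℕ → Q} {n : ℕ} {L : List (ℕ × ℕ)} (h : IsConfig QuiverAdj f n L) {i j : ℕ}
    (hij : (i, j) ∈ L ∨ (j, i) ∈ L) : QuiverAdj (f i) (f j) :=
  hij.elim (fun h' => h.adj _ h') fun h' => (h.adj _ h').symm

theorem mem_pathEdges {m i j : ℕ} : (i, j) ∈ pathEdges m ↔ j = i + 1 ∧ j < m := by
  simp only [pathEdges, List.mem_map, List.mem_range, Prod.mk.injEq]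
  constructor
  · rintro ⟨a, ha, rfl, rfl⟩; exact ⟨rfl, by omega⟩
  · rintro ⟨rfl, h⟩; exact ⟨i, by omega, rfl, rfl⟩

theorem IsAttached.comp {f : ℕ → Q} {n : ℕ} {w : Q} (hw : IsAttached f n w) {σ : ℕ → ℕ}
    (hσ : ∀ i < n, σ i < n) (hσ' : ∀ j < n, ∃ i < n, σ i = j) : IsAttached (f ∘ σ) n w := by
  refine ⟨fun i hi => hw.1 _ (hσ i hi), ?_⟩
  obtain ⟨j, hj, hwj⟩ := hw.2
  obtain ⟨i, hi, rfl⟩ := hσ' j hj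
  exact ⟨i, hi, hwj⟩

/-- A configuration in which the root is supported on the vertices `σ 0, …, σ (n - 1)`. -/
theorem IsConfig.hasFullPairFamily [Infinite k] {E : List (ℕ × ℕ)} {z : ℕ → ℕ}
    (hE : ∀ M : List (ℕ × ℕ), List.Forall₂ (fun e p => p = e ∨ p = (e.2, e.1)) E M →
      HasFullRep k M z)
    {f : ℕ → Q} {n : ℕ} {L : List (ℕ × ℕ)} (hf : IsConfig QuiverAdj f (n + 1) L) {σ : ℕ → ℕ}
    (hσ : ∀ i < n + 1, σ i < n + 1) (hσ' : ∀ j < n + 1, ∃ i < n + 1, σ i = j)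
    {lab : ℕ → ℕ} (hlab : Monotone lab)
    (hadj : ∀ i, i + 1 < n → lab i = lab (i + 1) → (σ i, σ (i + 1)) ∈ L ∨ (σ (i + 1), σ i) ∈ L)
    (hEf : ∀ e ∈ E, e.1 ≠ e.2 ∧ ∃ i < n, ∃ j < n, lab i = e.1 ∧ lab j = e.2 ∧
      ((σ i, σ j) ∈ L ∨ (σ j, σ i) ∈ L))
    (hz : ∀ l, z l ≠ 0 → ∃ j < n, lab j = l) (hpos : ∀ i < n, z (lab i) ≠ 0)
    {p : ℕ} (hp : p < n) (hzp : z (lab p) = 2) (hvp : (σ n, σ p) ∈ L ∨ (σ p, σ n) ∈ L) {w : Q}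
    (hw : IsAttached f (n + 1) w) : HasFullPairFamily k Q := by
  refine hasFullPairFamily_of_root hE (f := f ∘ σ) ?_ hlab (fun i hi h => hf.quiverAdj (hadj i hi h))
    (fun e he => ?_) hz hpos hp hzp (hf.quiverAdj hvp) (hw.comp hσ hσ')
  · have hinj : Function.Injective fun i : Fin (n + 1) => (⟨σ i, hσ i i.2⟩ : Fin (n + 1)) := by
      rw [Finite.injective_iff_surjective]
      intro j
      obtain ⟨i, hi, h⟩ := hσ' j j.2
      exact ⟨⟨i, hi⟩, Fin.ext h⟩
    intro i hi j hj h
    have h1 := hf.inj _ (hσ i hi) _ (hσ j hj) h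
    exact congrArg Fin.val (@hinj ⟨i, hi⟩ ⟨j, hj⟩ (Fin.ext h1))
  · obtain ⟨hne, i, hi, j, hj, hli, hlj, hij⟩ := hEf e he
    exact ⟨hne, i, hi, j, hj, hli, hlj, hf.quiverAdj hij⟩

theorem getD_ne_zero_of_lt {l : List ℕ} {i : ℕ} (h : l.getD i 0 ≠ 0) : i < l.length := by
  by_contra hi
  exact h (List.getD_eq_default _ _ (not_lt.1 hi))

theorem IsConfig.hasFullPairFamily_D [Infinite k] {f : ℕ → Q} {m : ℕ}
    (hf : IsConfig QuiverAdj f (m + 5) ((1, m + 3) :: (m + 1, m + 4) :: pathEdges (m + 3))) {w : Q}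
    (hw : IsAttached f (m + 5) w) : HasFullPairFamily k Q := by
  let σ : ℕ → ℕ := fun i => if i = 0 then 0 else if i = 1 then m + 3 else if i = 2 then m + 2 else
    if i = m + 4 then m + 4 else i - 2
  have hL : ∀ i j, (i, j) ∈ (1, m + 3) :: (m + 1, m + 4) :: pathEdges (m + 3) ↔
      (i = 1 ∧ j = m + 3) ∨ (i = m + 1 ∧ j = m + 4) ∨ (j = i + 1 ∧ j < m + 3) := by
    intro i j
    rw [List.mem_cons, List.mem_cons, mem_pathEdges, Prod.mk.injEq, Prod.mk.injEq]
  have h0 : σ 0 = 0 := rfl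
  have h1 : σ 1 = m + 3 := rfl
  have h2 : σ 2 = m + 2 := rfl
  have h4 : σ (m + 4) = m + 4 := by
    dsimp only [σ]
    rw [if_neg (by omega), if_neg (by omega), if_neg (by omega), if_pos rfl]
  have h3 : ∀ i, 3 ≤ i → i < m + 4 → σ i = i - 2 := by
    intro i hi hi'
    dsimp only [σ]
    rw [if_neg (by omega), if_neg (by omega), if_neg (by omega), if_neg (by omega)]
  clear_value σ
  have hlen : ∀ l, l < 4 → ∃ j < m + 4, min j 3 = l := fun l hl => ⟨l, by omega, by omega⟩
  refine hf.hasFullPairFamily (n := m + 4) (fun M hM => hasFullRep_D4 hM) (σ := σ)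
    (lab := fun i => min i 3) ?_ ?_ ?_ ?_ ?_ ?_ ?_ (p := m + 3) ?_ ?_ ?_ hw
  · intro i hi
    rcases (show i = 0 ∨ i = 1 ∨ i = 2 ∨ i = m + 4 ∨ (3 ≤ i ∧ i < m + 4) by omega) with
      rfl | rfl | rfl | rfl | ⟨hi1, hi2⟩
    · omega
    · omega
    · omega
    · omega
    · rw [h3 i hi1 hi2]; omega
  · intro j hj
    rcases (show j = 0 ∨ j = m + 3 ∨ j = m + 2 ∨ j = m + 4 ∨ (1 ≤ j ∧ j < m + 2) by omega) with
      rfl | rfl | rfl | rfl | ⟨hj1, hj2⟩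
    · exact ⟨0, by omega, h0⟩
    · exact ⟨1, by omega, h1⟩
    · exact ⟨2, by omega, h2⟩
    · exact ⟨m + 4, by omega, h4⟩
    · exact ⟨j + 2, by omega, h3 _ (by omega) (by omega)⟩
  · intro i j hij; exact min_le_min_right 3 hij
  · intro i hi hl
    have hi3 : 3 ≤ i := by omega
    rw [hL, hL, h3 i hi3 (by omega), h3 (i + 1) (by omega) (by omega)]
    omega
  · intro e he
    simp only [List.mem_cons, List.not_mem_nil, or_false] at he
    rcases he with rfl | rfl | rfl
    · refine ⟨by decide, 3, by omega, 0, by omega, rfl, rfl, ?_⟩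
      rw [hL, hL, h0, h3 3 le_rfl (by omega)]; omega
    · refine ⟨by decide, 3, by omega, 1, by omega, rfl, rfl, ?_⟩
      rw [hL, hL, h1, h3 3 le_rfl (by omega)]; omega
    · refine ⟨by decide, m + 3, by omega, 2, by omega, by simp, rfl, ?_⟩
      rw [hL, hL, h2, h3 (m + 3) (by omega) (by omega)]; omega
  · intro l hl; exact hlen l (getD_ne_zero_of_lt hl)
  · intro i _
    have : min i 3 < 4 := by omega
    generalize min i 3 = l at *
    interval_cases l <;> decide
  · omega
  · rw [min_eq_right (by omega)]; rfl
  · rw [hL, hL, h4, h3 (m + 3) (by omega) (by omega)]; omega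

theorem IsConfig.hasFullPairFamily_E6 [Infinite k] {f : ℕ → Q}
    (hf : IsConfig QuiverAdj f 7 ((2, 5) :: (5, 6) :: pathEdges 5)) {w : Q} (hw : IsAttached f 7 w) :
    HasFullPairFamily k Q :=
  hf.hasFullPairFamily (n := 6) (fun M hM => hasFullRep_E6 hM)
    (σ := fun i => [2, 1, 0, 3, 4, 5, 6].getD i 0) (by decide) (by decide) (lab := id) monotone_id
    (fun i _ h => absurd h (by simp)) (by decide) (fun l hl => ⟨l, getD_ne_zero_of_lt hl, rfl⟩)
    (by decide) (p := 5) (by decide) (by decide) (by decide) hw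

theorem IsConfig.hasFullPairFamily_E7 [Infinite k] {f : ℕ → Q}
    (hf : IsConfig QuiverAdj f 8 ((3, 7) :: pathEdges 7)) {w : Q} (hw : IsAttached f 8 w) :
    HasFullPairFamily k Q :=
  hf.hasFullPairFamily (n := 7) (fun M hM => hasFullRep_E7 hM)
    (σ := fun i => [3, 2, 4, 5, 6, 7, 1, 0].getD i 0) (by decide) (by decide) (lab := id)
    monotone_id (fun i _ h => absurd h (by simp)) (by decide)
    (fun l hl => ⟨l, getD_ne_zero_of_lt hl, rfl⟩) (by decide) (p := 6) (by decide) (by decide)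
    (by decide) hw

theorem IsConfig.hasFullPairFamily_E8 [Infinite k] {f : ℕ → Q}
    (hf : IsConfig QuiverAdj f 9 ((2, 8) :: pathEdges 8)) {w : Q} (hw : IsAttached f 9 w) :
    HasFullPairFamily k Q :=
  hf.hasFullPairFamily (n := 8) (fun M hM => hasFullRep_E8 hM)
    (σ := fun i => [2, 3, 4, 5, 1, 0, 8, 6, 7].getD i 0) (by decide) (by decide) (lab := id)
    monotone_id (fun i _ h => absurd h (by simp)) (by decide)
    (fun l hl => ⟨l, getD_ne_zero_of_lt hl, rfl⟩) (by decide) (p := 7) (by decide) (by decide)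
    (by decide) hw

end Configurations

/-! ### Connected graphs which contain no Euclidean diagram -/

section Graphs

variable {T : Type*} {G : SimpleGraph T}

/-- A labelling of all vertices for which adjacency is given by the list `L` of edges. -/
theorem hasShape_of_adj_iff {E : T → T → ℕ} (hE₁ : ∀ a b, G.Adj a b → E a b = 1)
    (hE₀ : ∀ a b, ¬ G.Adj a b → E a b = 0) {f : ℕ → T} {n : ℕ}
    (hinj : ∀ i < n, ∀ j < n, f i = f j → i = j) (hsurj : ∀ x, ∃ i < n, f i = x)
    {L : List (ℕ × ℕ)} (hL : L.Nodup) (hL' : ∀ i j, (i, j) ∈ L → (j, i) ∉ L)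
    (hadj : ∀ i < n, ∀ j < n, (G.Adj (f i) (f j) ↔ (i, j) ∈ L ∨ (j, i) ∈ L)) :
    HasShape E n L := by
  let e : Fin n ≃ T := Equiv.ofBijective (fun i => f i) ⟨fun i j h => Fin.ext (hinj i i.2 j j.2 h),
    fun x => by obtain ⟨i, hi, h⟩ := hsurj x; exact ⟨⟨i, hi⟩, h⟩⟩
  refine ⟨e.symm, fun a b => ?_⟩
  obtain ⟨i, rfl⟩ := e.surjective a
  obtain ⟨j, rfl⟩ := e.surjective b
  rw [e.symm_apply_apply, e.symm_apply_apply, hL.count, hL.count]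
  have h := hadj i i.2 j j.2
  by_cases h1 : ((i : ℕ), (j : ℕ)) ∈ L
  · rw [if_pos h1, if_neg (hL' _ _ h1)]; exact hE₁ _ _ (h.2 (.inl h1))
  by_cases h2 : ((j : ℕ), (i : ℕ)) ∈ L
  · rw [if_neg h1, if_pos h2]; exact hE₁ _ _ (h.2 (.inr h2))
  · rw [if_neg h1, if_neg h2]
    exact hE₀ _ _ fun h' => (h.1 h').elim h1 h2

/-- In a tree it suffices that the edges in the list are present, as there are no others. -/
theorem hasShape_of_isTree [Finite T] (hG : G.IsTree) {E : T → T → ℕ}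
    (hE₁ : ∀ a b, G.Adj a b → E a b = 1) (hE₀ : ∀ a b, ¬ G.Adj a b → E a b = 0) {f : ℕ → T} {n : ℕ}
    {L : List (ℕ × ℕ)} (hf : IsConfig G.Adj f n L) (hsurj : ∀ x, ∃ i < n, f i = x)
    (hL : L.Nodup) (hL' : ∀ e ∈ L, e.1 < e.2 ∧ e.2 < n) (hn : L.length + 1 = n) :
    HasShape E n L := by
  classical
  have := Fintype.ofFinite T
  refine hasShape_of_adj_iff hE₁ hE₀ hf.inj hsurj hL (fun i j h h' => ?_) fun i hi j hj =>
    ⟨fun h => ?_, ?_⟩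
  · have h1 := (hL' _ h).1
    have h2 := (hL' _ h').1
    dsimp only at h1 h2
    omega
  · let φ : ℕ × ℕ → Sym2 T := fun e => s(f e.1, f e.2)
    have hφ : Set.InjOn φ L.toFinset := by
      intro e he e' he' hee
      have h1 := hL' e (by simpa using he)
      have h2 := hL' e' (by simpa using he')
      rcases Sym2.eq_iff.1 hee with ⟨h3, h4⟩ | ⟨h3, h4⟩
      · exact Prod.ext (hf.inj _ (by omega) _ (by omega) h3) (hf.inj _ (by omega) _ (by omega) h4)
      · have h5 := hf.inj _ (by omega) _ (by omega) h3
        have h6 := hf.inj _ (by omega) _ (by omega) h4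
        omega
    have hsub : L.toFinset.image φ ⊆ G.edgeFinset := by
      intro x hx
      obtain ⟨e, he, rfl⟩ := Finset.mem_image.1 hx
      rw [SimpleGraph.mem_edgeFinset]
      exact hf.adj e (by simpa using he)
    have hcard : Fintype.card T = n := by
      rw [← Fintype.card_fin n]
      exact (Fintype.card_congr (Equiv.ofBijective (fun i : Fin n => f i)
        ⟨fun i j h => Fin.ext (hf.inj i i.2 j j.2 h),
          fun x => by obtain ⟨i, hi, h⟩ := hsurj x; exact ⟨⟨i, hi⟩, h⟩⟩)).symm
    have heq : L.toFinset.image φ = G.edgeFinset := by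
      refine Finset.eq_of_subset_of_card_le hsub ?_
      have h1 := hG.card_edgeFinset
      rw [Finset.card_image_of_injOn hφ, List.toFinset_card_of_nodup hL]
      omega
    have h1 : s(f i, f j) ∈ G.edgeFinset := by rw [SimpleGraph.mem_edgeFinset]; exact h
    rw [← heq] at h1
    obtain ⟨e, he, hee⟩ := Finset.mem_image.1 h1
    have he' : e ∈ L := by simpa using he
    have h2 := hL' e he'
    rcases Sym2.eq_iff.1 hee with ⟨h3, h4⟩ | ⟨h3, h4⟩
    · rw [← hf.inj _ (by omega) _ hi h3, ← hf.inj _ (by omega) _ hj h4]; exact .inl he'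
    · rw [← hf.inj _ (by omega) _ hj h3, ← hf.inj _ (by omega) _ hi h4]; exact .inr he'
  · rintro (h | h)
    · exact hf.adj _ h
    · exact (hf.adj _ h).symm

/-- In a connected graph, some vertex outside of a nonempty proper set of vertices is adjacent to a
vertex in the set. -/
theorem exists_adj_of_not_surj (hG : G.Connected) {f : ℕ → T} {n : ℕ} (hn : 0 < n)
    (hf : ¬ ∀ x, ∃ i < n, f i = x) : ∃ w, (∀ i < n, f i ≠ w) ∧ ∃ i < n, G.Adj w (f i) := by
  push Not at hf
  obtain ⟨x, hx⟩ := hf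
  obtain ⟨p⟩ := hG.preconnected (f 0) x
  obtain ⟨d, -, ⟨i, hi, h1⟩, h2⟩ := p.exists_boundary_dart {y | ∃ i < n, f i = y}
    ⟨0, hn, rfl⟩ (by rintro ⟨i, hi, h⟩; exact hx i hi h)
  refine ⟨d.snd, fun i hi h => h2 ⟨i, hi, h⟩, i, hi, ?_⟩
  rw [h1]
  exact d.adj.symm

theorem nodup_pathEdges (m : ℕ) : (pathEdges m).Nodup :=
  List.nodup_range.map fun i j h => by simpa using h

theorem length_pathEdges (m : ℕ) : (pathEdges m).length = m - 1 := by simp [pathEdges]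

/-! ### Cycles -/

/-- The vertices `f 0, …, f (n - 1)` form a cycle, as a subgraph. -/
def IsCycleSeq (G : SimpleGraph T) (f : ℕ → T) (n : ℕ) : Prop :=
  3 ≤ n ∧ IsConfig G.Adj f n ((n - 1, 0) :: pathEdges n)

theorem isAcyclic_of_not_isCycleSeq (h : ∀ f n, ¬ IsCycleSeq G f n) : G.IsAcyclic := by
  intro v p hp
  have h3 := hp.three_le_length
  refine h p.getVert p.length ⟨h3, fun i hi j hj hij => ?_, fun e he => ?_⟩
  · exact hp.getVert_injOn' (by rw [Set.mem_ofPred_eq]; omega)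
      (by rw [Set.mem_ofPred_eq]; omega) hij
  · rcases List.mem_cons.1 he with rfl | he
    · have := p.adj_getVert_succ (i := p.length - 1) (by omega)
      rw [Nat.sub_add_cancel (by omega), p.getVert_length] at this
      simpa using this
    · obtain ⟨i, j⟩ := e
      obtain ⟨rfl, hj⟩ := mem_pathEdges.1 he
      exact p.adj_getVert_succ (by omega)

/-- A shortest cycle has no chords. -/
theorem adj_iff_of_shortest {f : ℕ → T} {n : ℕ} (hf : IsCycleSeq G f n)
    (hmin : ∀ g m, IsCycleSeq G g m → n ≤ m) {i j : ℕ} (hi : i < n) (hj : j < n) :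
    G.Adj (f i) (f j) ↔
      (i, j) ∈ (n - 1, 0) :: pathEdges n ∨ (j, i) ∈ (n - 1, 0) :: pathEdges n := by
  refine ⟨fun h => ?_, ?_⟩
  · have key : ∀ {i j}, i < j → j < n → G.Adj (f i) (f j) →
        (i, j) ∈ (n - 1, 0) :: pathEdges n ∨ (j, i) ∈ (n - 1, 0) :: pathEdges n := by
      intro i j hij hj h
      rw [List.mem_cons, List.mem_cons, mem_pathEdges, mem_pathEdges, Prod.mk.injEq, Prod.mk.injEq]
      by_contra hcon
      have hij' : i + 1 < j := by omega
      have := hmin (fun t => f (i + t)) (j - i + 1) ⟨by omega, fun a ha b hb hab => ?_,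
        fun e he => ?_⟩
      · omega
      · have := hf.2.inj _ (by omega) _ (by omega) hab
        omega
      · rcases List.mem_cons.1 he with rfl | he
        · dsimp only
          rw [show i + (j - i + 1 - 1) = j by omega]
          exact h.symm
        · obtain ⟨a, b⟩ := e
          obtain ⟨rfl, hb⟩ := mem_pathEdges.1 he
          exact hf.2.adj (i + a, i + (a + 1))
            (List.mem_cons_of_mem _ (mem_pathEdges.2 ⟨by omega, by omega⟩))
    rcases lt_trichotomy i j with hij | rfl | hij
    · exact key hij hj h
    · exact absurd h (G.loopless.irrefl _)
    · exact (key hij hi h.symm).symm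
  · rintro (h | h)
    · exact hf.2.adj _ h
    · exact (hf.2.adj _ h).symm

theorem hasShape_of_cycle {E : T → T → ℕ}
    (hE₁ : ∀ a b, G.Adj a b → E a b = 1) (hE₀ : ∀ a b, ¬ G.Adj a b → E a b = 0) {f : ℕ → T} {n : ℕ}
    (hf : IsCycleSeq G f n) (hmin : ∀ g m, IsCycleSeq G g m → n ≤ m)
    (hsurj : ∀ x, ∃ i < n, f i = x) : HasShape E n ((n - 1, 0) :: pathEdges n) := by
  have hn := hf.1
  refine hasShape_of_adj_iff hE₁ hE₀ hf.2.inj hsurj ?_ ?_ fun i hi j hj =>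
    adj_iff_of_shortest hf hmin hi hj
  · refine List.nodup_cons.2 ⟨fun h => ?_, nodup_pathEdges n⟩
    have := mem_pathEdges.1 h
    omega
  · intro i j
    rw [List.mem_cons, List.mem_cons, mem_pathEdges, mem_pathEdges, Prod.mk.injEq, Prod.mk.injEq]
    omega

/-! ### Stars -/

/-- Three paths `c l 0, …, c l (p l)` of positive length with common first vertex, and otherwise
disjoint. -/
structure IsStar (G : SimpleGraph T) (c : Fin 3 → ℕ → T) (p : Fin 3 → ℕ) : Prop where
  pos : ∀ l, 1 ≤ p l
  center : ∀ l l', c l 0 = c l' 0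
  adj : ∀ l i, i < p l → G.Adj (c l i) (c l (i + 1))
  inj : ∀ l i l' i', i ≤ p l → i' ≤ p l' → c l i = c l' i' → (i = 0 ∧ i' = 0) ∨ (l = l' ∧ i = i')

theorem IsStar.sum_le [Finite T] {c : Fin 3 → ℕ → T} {p : Fin 3 → ℕ} (h : IsStar G c p) :
    ∑ l, p l ≤ Nat.card T := by
  have := Fintype.ofFinite T
  rw [Nat.card_eq_fintype_card]
  have h1 : Fintype.card (Σ l, Fin (p l)) = ∑ l, p l := by simp
  rw [← h1]
  refine Fintype.card_le_of_injective (fun x => c x.1 (x.2 + 1)) ?_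
  rintro ⟨l, i⟩ ⟨l', i'⟩ hh
  rcases h.inj l (i + 1) l' (i' + 1) (by omega) (by omega) hh with h2 | ⟨rfl, h2⟩
  · omega
  · have : i = i' := Fin.ext (by omega)
    rw [this]

theorem IsStar.perm {c : Fin 3 → ℕ → T} {p : Fin 3 → ℕ} (h : IsStar G c p)
    (σ : Equiv.Perm (Fin 3)) : IsStar G (c ∘ σ) (p ∘ σ) where
  pos l := h.pos (σ l)
  center l l' := h.center _ _
  adj l i hi := h.adj (σ l) i hi
  inj l i l' i' hi hi' hh := by
    rcases h.inj (σ l) i (σ l') i' hi hi' hh with h1 | ⟨h1, h2⟩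
    · exact .inl h1
    · exact .inr ⟨σ.injective h1, h2⟩

/-- A vertex attached to an inner vertex of a star yields a diagram of type `D̃`. -/
theorem IsStar.exists_config_D {c : Fin 3 → ℕ → T} {p : Fin 3 → ℕ} (h : IsStar G c p) {w : T}
    (hw : ∀ l i, i ≤ p l → c l i ≠ w) {l : Fin 3} {m : ℕ} (hm : m < p l) (hwm : G.Adj w (c l m)) :
    ∃ f, IsConfig G.Adj f (m + 5) ((1, m + 3) :: (m + 1, m + 4) :: pathEdges (m + 3)) := by
  obtain ⟨hl1, hl2, hl3⟩ : l + 1 ≠ l ∧ l + 2 ≠ l ∧ l + 1 ≠ l + 2 := by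
    clear hm hwm; revert l; decide
  have hp1 := h.pos (l + 1)
  have hp2 := h.pos (l + 2)
  let f : ℕ → T := fun i => if i = 0 then c (l + 1) 1 else if i = m + 3 then c (l + 2) 1 else
    if i = m + 4 then w else c l (i - 1)
  have h0 : f 0 = c (l + 1) 1 := rfl
  have h3 : f (m + 3) = c (l + 2) 1 := by
    dsimp only [f]; rw [if_neg (by omega), if_pos rfl]
  have h4 : f (m + 4) = w := by
    dsimp only [f]; rw [if_neg (by omega), if_neg (by omega), if_pos rfl]
  have h1 : ∀ i, 1 ≤ i → i < m + 3 → f i = c l (i - 1) := by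
    intro i hi hi'
    dsimp only [f]; rw [if_neg (by omega), if_neg (by omega), if_neg (by omega)]
  clear_value f
  refine ⟨f, ⟨?_, ?_⟩⟩
  · have hlt : ∀ i j, i < j → j < m + 5 → f i ≠ f j := by
      intro i j hij hj
      by_cases hj4 : j = m + 4
      · rw [hj4, h4]
        rcases (show i = 0 ∨ i = m + 3 ∨ (1 ≤ i ∧ i < m + 3) by omega) with rfl | rfl | ⟨hi, hi'⟩
        · rw [h0]; exact hw _ _ hp1
        · rw [h3]; exact hw _ _ hp2
        · rw [h1 i hi hi']; exact hw _ _ (by omega)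
      by_cases hj3 : j = m + 3
      · rw [hj3, h3]
        rcases (show i = 0 ∨ (1 ≤ i ∧ i < m + 3) by omega) with rfl | ⟨hi, hi'⟩
        · rw [h0]
          intro hh
          rcases h.inj _ _ _ _ hp1 hp2 hh with h5 | h5
          · omega
          · exact hl3 h5.1
        · rw [h1 i hi hi']
          intro hh
          rcases h.inj _ _ _ _ (by omega) hp2 hh with h5 | h5
          · omega
          · exact hl2 h5.1.symm
      · rw [h1 j (by omega) (by omega)]
        rcases (show i = 0 ∨ (1 ≤ i ∧ i < m + 3) by omega) with rfl | ⟨hi, hi'⟩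
        · rw [h0]
          intro hh
          rcases h.inj _ _ _ _ hp1 (by omega) hh with h5 | h5
          · omega
          · exact hl1 h5.1
        · rw [h1 i hi hi']
          intro hh
          rcases h.inj _ _ _ _ (by omega) (by omega) hh with h5 | h5 <;> omega
    intro i hi j hj hij
    rcases lt_trichotomy i j with hlt' | rfl | hlt'
    · exact absurd hij (hlt i j hlt' hj)
    · rfl
    · exact absurd hij.symm (hlt j i hlt' hi)
  · rintro ⟨i, j⟩ he
    rw [List.mem_cons, List.mem_cons, mem_pathEdges, Prod.mk.injEq, Prod.mk.injEq] at he
    dsimp only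
    rcases he with ⟨rfl, rfl⟩ | ⟨rfl, rfl⟩ | ⟨rfl, hj⟩
    · rw [h1 1 le_rfl (by omega), h3, Nat.sub_self, h.center l (l + 2)]
      exact h.adj _ 0 (by omega)
    · rw [h1 (m + 1) (by omega) (by omega), h4, Nat.add_sub_cancel]
      exact hwm.symm
    · rcases Nat.eq_zero_or_pos i with rfl | hi
      · rw [h0, h1 1 le_rfl (by omega), Nat.sub_self, h.center l (l + 1)]
        exact (h.adj _ 0 (by omega)).symm
      · rw [h1 i hi (by omega), h1 (i + 1) (by omega) hj]
        have := h.adj l (i - 1) (by omega)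
        rwa [show i - 1 + 1 = i + 1 - 1 by omega] at this

/-- A vertex attached to the end of an arm yields a larger star. -/
theorem IsStar.extend {c : Fin 3 → ℕ → T} {p : Fin 3 → ℕ} (h : IsStar G c p) {w : T}
    (hw : ∀ l i, i ≤ p l → c l i ≠ w) {l : Fin 3} (hwl : G.Adj w (c l (p l))) :
    IsStar G (fun l' i => if l' = l ∧ i = p l + 1 then w else c l' i)
      (fun l' => if l' = l then p l + 1 else p l') where
  pos l' := by split_ifs; exacts [by omega, h.pos l']
  center a b := by
    rw [if_neg (by omega), if_neg (by omega)]
    exact h.center a b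
  adj a i hi := by
    by_cases ha : a = l
    · subst ha
      rw [if_pos rfl] at hi
      rw [if_neg (by omega)]
      by_cases hi' : i = p a
      · rw [if_pos ⟨rfl, by omega⟩, hi']; exact hwl.symm
      · rw [if_neg (by omega)]; exact h.adj a i (by omega)
    · rw [if_neg (fun h => ha h.1), if_neg (fun h => ha h.1)]
      rw [if_neg ha] at hi
      exact h.adj a i hi
  inj a i b j hi hj hab := by
    have key : ∀ {a i}, i ≤ (if a = l then p l + 1 else p a) → ¬ (a = l ∧ i = p l + 1) →
        i ≤ p a := by
      intro a i hi ha
      by_cases hal : a = l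
      · subst hal
        rw [if_pos rfl] at hi
        omega
      · rwa [if_neg hal] at hi
    by_cases ha : a = l ∧ i = p l + 1 <;> by_cases hb : b = l ∧ j = p l + 1
    · exact .inr ⟨ha.1.trans hb.1.symm, ha.2.trans hb.2.symm⟩
    · rw [if_pos ha, if_neg hb] at hab
      exact absurd hab.symm (hw b j (key hj hb))
    · rw [if_neg ha, if_pos hb] at hab
      exact absurd hab (hw a i (key hi ha))
    · rw [if_neg ha, if_neg hb] at hab
      exact h.inj a i b j (key hi ha) (key hj hb) hab

/-- The numbering of a star in which the arms `l₁` and `l₂`, cut off after `q₁` and `q₂` edges,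
form a path and are followed by the arm `l₀`. -/
def starSeq (c : Fin 3 → ℕ → T) (l₀ l₁ l₂ : Fin 3) (q₁ q₂ : ℕ) (i : ℕ) : T :=
  if i < q₁ then c l₁ (q₁ - i) else if i ≤ q₁ + q₂ then c l₂ (i - q₁) else c l₀ (i - (q₁ + q₂))

theorem IsStar.starSeq_inj {c : Fin 3 → ℕ → T} {p : Fin 3 → ℕ} (h : IsStar G c p)
    {l₀ l₁ l₂ : Fin 3} (h01 : l₀ ≠ l₁) (h02 : l₀ ≠ l₂) (h12 : l₁ ≠ l₂) {q₀ q₁ q₂ : ℕ}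
    (h0 : q₀ ≤ p l₀) (h1 : q₁ ≤ p l₁) (h2 : q₂ ≤ p l₂) :
    ∀ i < q₁ + q₂ + 1 + q₀, ∀ j < q₁ + q₂ + 1 + q₀,
      starSeq c l₀ l₁ l₂ q₁ q₂ i = starSeq c l₀ l₁ l₂ q₁ q₂ j → i = j := by
  intro i hi j hj hij
  simp only [starSeq] at hij
  split_ifs at hij <;>
    rcases h.inj _ _ _ _ (by omega) (by omega) hij with h5 | h5 <;> omega

theorem IsStar.starSeq_adj {c : Fin 3 → ℕ → T} {p : Fin 3 → ℕ} (h : IsStar G c p)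
    {l₀ l₁ l₂ : Fin 3} {q₁ q₂ : ℕ} (h1 : q₁ ≤ p l₁) (h2 : q₂ ≤ p l₂) {i : ℕ} (hi : i < q₁ + q₂) :
    G.Adj (starSeq c l₀ l₁ l₂ q₁ q₂ i) (starSeq c l₀ l₁ l₂ q₁ q₂ (i + 1)) := by
  rcases lt_trichotomy (i + 1) q₁ with hlt | heq | hgt
  · rw [starSeq, starSeq, if_pos (by omega), if_pos hlt]
    have := h.adj l₁ (q₁ - (i + 1)) (by omega)
    rwa [show q₁ - (i + 1) + 1 = q₁ - i by omega, G.adj_comm] at this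
  · rw [starSeq, starSeq, if_pos (by omega), if_neg (by omega), if_pos (by omega),
      show q₁ - i = 1 by omega, show i + 1 - q₁ = 0 by omega, h.center l₂ l₁]
    exact (h.adj l₁ 0 (by omega)).symm
  · rw [starSeq, starSeq, if_neg (by omega), if_pos (by omega), if_neg (by omega),
      if_pos (by omega), show i + 1 - q₁ = i - q₁ + 1 by omega]
    exact h.adj l₂ _ (by omega)

theorem IsStar.starSeq_adj_center {c : Fin 3 → ℕ → T} {p : Fin 3 → ℕ} (h : IsStar G c p)
    {l₀ l₁ l₂ : Fin 3} {q₁ q₂ : ℕ} :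
    G.Adj (starSeq c l₀ l₁ l₂ q₁ q₂ q₁) (starSeq c l₀ l₁ l₂ q₁ q₂ (q₁ + q₂ + 1)) := by
  rw [starSeq, starSeq, if_neg (by omega), if_pos (by omega), if_neg (by omega),
    if_neg (by omega), Nat.sub_self, Nat.add_sub_cancel_left, h.center l₂ l₀]
  exact h.adj l₀ 0 (h.pos l₀)

/-- A part of a star with arms of length `1`, `q₁`, `q₂`. -/
theorem IsStar.config_one {c : Fin 3 → ℕ → T} {p : Fin 3 → ℕ} (h : IsStar G c p)
    {l₀ l₁ l₂ : Fin 3} (h01 : l₀ ≠ l₁) (h02 : l₀ ≠ l₂) (h12 : l₁ ≠ l₂) {q₁ q₂ : ℕ}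
    (h1 : q₁ ≤ p l₁) (h2 : q₂ ≤ p l₂) :
    IsConfig G.Adj (starSeq c l₀ l₁ l₂ q₁ q₂) (q₁ + q₂ + 2)
      ((q₁, q₁ + q₂ + 1) :: pathEdges (q₁ + q₂ + 1)) := by
  refine ⟨h.starSeq_inj h01 h02 h12 (q₀ := 1) (h.pos l₀) h1 h2, ?_⟩
  rintro ⟨i, j⟩ he
  rw [List.mem_cons, mem_pathEdges, Prod.mk.injEq] at he
  rcases he with ⟨rfl, rfl⟩ | ⟨rfl, hj⟩
  · exact h.starSeq_adj_center
  · exact h.starSeq_adj h1 h2 (by omega)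

/-- A part of a star with three arms of length `2`. -/
theorem IsStar.config_E6 {c : Fin 3 → ℕ → T} {p : Fin 3 → ℕ} (h : IsStar G c p)
    (hp : ∀ l, 2 ≤ p l) :
    IsConfig G.Adj (starSeq c 0 1 2 2 2) 7 ((2, 5) :: (5, 6) :: pathEdges 5) := by
  refine ⟨h.starSeq_inj (by decide) (by decide) (by decide) (q₀ := 2) (hp 0) (hp 1) (hp 2), ?_⟩
  rintro ⟨i, j⟩ he
  rw [List.mem_cons, List.mem_cons, mem_pathEdges, Prod.mk.injEq, Prod.mk.injEq] at he
  rcases he with ⟨rfl, rfl⟩ | ⟨rfl, rfl⟩ | ⟨rfl, hj⟩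
  · exact h.starSeq_adj_center
  · exact h.adj 0 1 (hp 0)
  · exact h.starSeq_adj (hp 1) (hp 2) (by omega)

/-- The whole star, if the arm `l₀` has length `1`. -/
theorem IsStar.starSeq_surj {c : Fin 3 → ℕ → T} {p : Fin 3 → ℕ} (h : IsStar G c p)
    {l₀ l₁ l₂ : Fin 3} (hl : ∀ l, l = l₀ ∨ l = l₁ ∨ l = l₂) (h0 : p l₀ = 1)
    (hsurj : ∀ x, ∃ l i, i ≤ p l ∧ c l i = x) (x : T) :
    ∃ i < p l₁ + p l₂ + 2, starSeq c l₀ l₁ l₂ (p l₁) (p l₂) i = x := by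
  obtain ⟨l, i, hi, rfl⟩ := hsurj x
  have hcen : starSeq c l₀ l₁ l₂ (p l₁) (p l₂) (p l₁) = c l₂ 0 := by
    rw [starSeq, if_neg (by omega), if_pos (by omega), Nat.sub_self]
  rcases Nat.eq_zero_or_pos i with rfl | hi0
  · exact ⟨p l₁, by omega, by rw [hcen, h.center]⟩
  rcases hl l with rfl | rfl | rfl
  · refine ⟨p l₁ + p l₂ + 1, by omega, ?_⟩
    rw [starSeq, if_neg (by omega), if_neg (by omega)]
    congr 1
    omega
  · refine ⟨p l - i, by omega, ?_⟩
    rw [starSeq, if_pos (by omega)]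
    congr 1
    omega
  · refine ⟨p l₁ + i, by omega, ?_⟩
    rw [starSeq, if_neg (by omega), if_pos (by omega)]
    congr 1
    omega

end Graphs

/-! ### Trees -/

section Trees

variable {T : Type*} {G : SimpleGraph T}

theorem exists_maximal_isStar [Finite T] (h : ∃ c p, IsStar G c p) :
    ∃ c p, IsStar G c p ∧ ∀ c' p', IsStar G c' p' → ∑ l, p' l ≤ ∑ l, p l := by
  let S : Set ℕ := {s | ∃ c p, IsStar G c p ∧ ∑ l, p l = s}
  have hb : BddAbove S := ⟨Nat.card T, by rintro _ ⟨c, p, hcp, rfl⟩; exact hcp.sum_le⟩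
  have hne : S.Nonempty := by
    obtain ⟨c, p, hcp⟩ := h
    exact ⟨_, c, p, hcp, rfl⟩
  obtain ⟨c, p, hcp, hs⟩ := Nat.sSup_mem hne hb
  exact ⟨c, p, hcp, fun c' p' h' => hs ▸ le_csSup hb ⟨c', p', h', rfl⟩⟩

/-- A connected graph without vertices of degree at least three and without cycles is a path. -/
theorem exists_path_of_not_isStar [Finite T] (hG : G.Connected) (h : ∀ c p, ¬ IsStar G c p) :
    ∃ f n, 1 ≤ n ∧ IsConfig G.Adj f n (pathEdges n) ∧ ∀ x, ∃ i < n, f i = x := by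
  have := Fintype.ofFinite T
  let S : Set ℕ := {n | 1 ≤ n ∧ ∃ f, IsConfig G.Adj f n (pathEdges n)}
  have hb : BddAbove S := by
    refine ⟨Fintype.card T, ?_⟩
    rintro n ⟨-, f, hf⟩
    rw [← Fintype.card_fin n]
    exact Fintype.card_le_of_injective (fun i : Fin n => f i)
      fun i j hij => Fin.ext (hf.inj i i.2 j j.2 hij)
  have hne : S.Nonempty := by
    obtain ⟨x⟩ := hG.nonempty
    exact ⟨1, le_rfl, fun _ => x, fun i hi j hj _ => by omega, by simp [pathEdges]⟩
  obtain ⟨hn, f, hf⟩ := Nat.sSup_mem hne hb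
  have hmax : ∀ m ∈ S, m ≤ sSup S := fun m hm => le_csSup hb hm
  set n := sSup S
  refine ⟨f, n, hn, hf, ?_⟩
  by_contra hsurj
  obtain ⟨w, hw, i, hi, hwi⟩ := exists_adj_of_not_surj hG (by omega) hsurj
  have hadj : ∀ i, i + 1 < n → G.Adj (f i) (f (i + 1)) := fun i hi =>
    hf.adj (i, i + 1) (mem_pathEdges.2 ⟨rfl, hi⟩)
  by_cases hlast : i + 1 = n
  · refine absurd (hmax (n + 1) ⟨by omega, fun j => if j = n then w else f j, ?_, ?_⟩) (by omega)
    · intro a ha b hb hab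
      by_cases han : a = n <;> by_cases hbn : b = n
      · omega
      · rw [if_pos han, if_neg hbn] at hab
        exact absurd hab.symm (hw b (by omega))
      · rw [if_neg han, if_pos hbn] at hab
        exact absurd hab (hw a (by omega))
      · rw [if_neg han, if_neg hbn] at hab
        exact hf.inj a (by omega) b (by omega) hab
    · rintro ⟨a, b⟩ he
      obtain ⟨rfl, hb⟩ := mem_pathEdges.1 he
      dsimp only
      rw [if_neg (by omega)]
      by_cases han : a + 1 = n
      · rw [if_pos han, show a = i by omega]; exact hwi.symm
      · rw [if_neg han]; exact hadj a (by omega)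
  by_cases hfirst : i = 0
  · subst hfirst
    refine absurd (hmax (n + 1) ⟨by omega, fun j => if j = 0 then w else f (j - 1), ?_, ?_⟩)
      (by omega)
    · intro a ha b hb hab
      by_cases han : a = 0 <;> by_cases hbn : b = 0
      · omega
      · rw [if_pos han, if_neg hbn] at hab
        exact absurd hab.symm (hw _ (by omega))
      · rw [if_neg han, if_pos hbn] at hab
        exact absurd hab (hw _ (by omega))
      · rw [if_neg han, if_neg hbn] at hab
        have := hf.inj _ (by omega) _ (by omega) hab
        omega
    · rintro ⟨a, b⟩ he
      obtain ⟨rfl, hb⟩ := mem_pathEdges.1 he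
      dsimp only
      rw [if_neg (Nat.succ_ne_zero a), Nat.add_sub_cancel]
      by_cases han : a = 0
      · rw [if_pos han, han]; exact hwi
      · rw [if_neg han]
        have := hadj (a - 1) (by omega)
        rwa [Nat.sub_add_cancel (by omega)] at this
  · have h1 := hadj i (by omega)
    have h2 := hadj (i - 1) (by omega)
    rw [Nat.sub_add_cancel (by omega)] at h2
    have hne : f (i + 1) ≠ f (i - 1) := fun hh => by
      have := hf.inj _ (by omega) _ (by omega) hh
      omega
    have hw1 : f (i + 1) ≠ w := hw _ (by omega)
    have hw2 : f (i - 1) ≠ w := hw _ (by omega)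
    let y : Fin 3 → T := ![f (i + 1), f (i - 1), w]
    have hy : Function.Injective y := by
      intro a b hab
      fin_cases a <;> fin_cases b <;> simp_all [y]
    have hya : ∀ l, G.Adj (f i) (y l) := by
      intro l
      fin_cases l
      · exact h1
      · exact h2.symm
      · exact hwi.symm
    refine h (fun l t => if t = 0 then f i else y l) (fun _ => 1)
      ⟨fun _ => le_rfl, fun _ _ => rfl, fun l t ht => ?_, fun l t l' t' ht ht' hh => ?_⟩
    · rw [if_pos (by omega), if_neg (by omega)]; exact hya l
    · by_cases ht0 : t = 0 <;> by_cases ht0' : t' = 0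
      · exact .inl ⟨ht0, ht0'⟩
      · rw [if_pos ht0, if_neg ht0'] at hh
        exact absurd hh (hya l').ne
      · rw [if_neg ht0, if_pos ht0'] at hh
        exact absurd hh.symm (hya l).ne
      · rw [if_neg ht0, if_neg ht0'] at hh
        exact .inr ⟨hy hh, by omega⟩

/-- The list `L` describes the edges of a tree of type `D̃` or `Ẽ` with `n` vertices. -/
def IsEuclideanTreeList (n : ℕ) (L : List (ℕ × ℕ)) : Prop :=
  (∃ m, n = m + 5 ∧ L = (1, m + 3) :: (m + 1, m + 4) :: pathEdges (m + 3)) ∨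
  (n = 7 ∧ L = (2, 5) :: (5, 6) :: pathEdges 5) ∨ (n = 8 ∧ L = (3, 7) :: pathEdges 7) ∨
  (n = 9 ∧ L = (2, 8) :: pathEdges 8)

variable {E : T → T → ℕ}

theorem IsEuclideanTreeList.isEuclidean [Finite T] {n : ℕ} {L : List (ℕ × ℕ)}
    (hL : IsEuclideanTreeList n L) (hG : G.IsTree) (hE₁ : ∀ a b, G.Adj a b → E a b = 1)
    (hE₀ : ∀ a b, ¬ G.Adj a b → E a b = 0) {f : ℕ → T} (hf : IsConfig G.Adj f n L)
    (hsurj : ∀ x, ∃ i < n, f i = x) : IsEuclidean E := by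
  rcases hL with ⟨m, rfl, rfl⟩ | ⟨rfl, rfl⟩ | ⟨rfl, rfl⟩ | ⟨rfl, rfl⟩
  · refine .inr (.inl ⟨m + 4, by omega, ?_⟩)
    refine hasShape_of_isTree hG hE₁ hE₀ hf hsurj ?_ ?_ ?_
    · refine List.nodup_cons.2 ⟨fun h => ?_, List.nodup_cons.2 ⟨fun h => ?_, nodup_pathEdges _⟩⟩
      · rw [List.mem_cons, mem_pathEdges, Prod.mk.injEq] at h
        omega
      · rw [mem_pathEdges] at h
        omega
    · rintro ⟨i, j⟩ he
      rw [List.mem_cons, List.mem_cons, mem_pathEdges, Prod.mk.injEq, Prod.mk.injEq] at he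
      dsimp only
      omega
    · simp [length_pathEdges]
  · exact .inr (.inr (.inl (hasShape_of_isTree hG hE₁ hE₀ hf hsurj (by decide) (by decide) rfl)))
  · exact .inr (.inr (.inr (.inl
      (hasShape_of_isTree hG hE₁ hE₀ hf hsurj (by decide) (by decide) rfl))))
  · exact .inr (.inr (.inr (.inr
      (hasShape_of_isTree hG hE₁ hE₀ hf hsurj (by decide) (by decide) rfl))))

/-- A star which exhausts the tree and has an arm of length one is a Dynkin diagram or contains a
diagram of type `Ẽ₇` or `Ẽ₈`. -/
theorem IsStar.isDynkin_or [Finite T] (hG : G.IsTree) (hE₁ : ∀ a b, G.Adj a b → E a b = 1)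
    (hE₀ : ∀ a b, ¬ G.Adj a b → E a b = 0) {c : Fin 3 → ℕ → T} {p : Fin 3 → ℕ}
    (h : IsStar G c p) (hsurj : ∀ x, ∃ l i, i ≤ p l ∧ c l i = x) (h0 : p 0 = 1)
    (h12 : p 1 ≤ p 2) :
    IsDynkin E ∨ ∃ f n L, IsEuclideanTreeList n L ∧ IsConfig G.Adj f n L := by
  have hp1 := h.pos 1
  have hp2 := h.pos 2
  have hone : ∀ {q₁ q₂}, q₁ ≤ p 1 → q₂ ≤ p 2 → IsConfig G.Adj (starSeq c 0 1 2 q₁ q₂) (q₁ + q₂ + 2)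
      ((q₁, q₁ + q₂ + 1) :: pathEdges (q₁ + q₂ + 1)) := fun h1 h2 =>
    h.config_one (by decide) (by decide) (by decide) h1 h2
  by_cases h3 : 3 ≤ p 1
  · exact .inr ⟨_, 8, _, .inr (.inr (.inl ⟨rfl, rfl⟩)), hone (q₁ := 3) (q₂ := 3) h3 (h3.trans h12)⟩
  by_cases h4 : p 1 = 1
  · left; right; left
    refine ⟨p 2 + 3, by omega, ?_⟩
    have h5 := h.config_one (l₀ := 0) (l₁ := 2) (l₂ := 1) (by decide) (by decide) (by decide)
      (q₁ := p 2) (q₂ := p 1) le_rfl le_rfl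
    have h6 := h.starSeq_surj (l₀ := 0) (l₁ := 2) (l₂ := 1) (by decide) h0 hsurj
    rw [h4] at h5 h6
    refine hasShape_of_isTree hG hE₁ hE₀ h5 h6 ?_ ?_ ?_
    · refine List.nodup_cons.2 ⟨fun h => ?_, nodup_pathEdges _⟩
      rw [mem_pathEdges] at h
      omega
    · rintro ⟨i, j⟩ he
      rw [List.mem_cons, mem_pathEdges, Prod.mk.injEq] at he
      dsimp only
      omega
    · simp [length_pathEdges]
  have h4 : p 1 = 2 := by omega
  by_cases h5 : 5 ≤ p 2
  · exact .inr ⟨_, 9, _, .inr (.inr (.inr ⟨rfl, rfl⟩)), hone (q₁ := 2) (q₂ := 5) h4.ge h5⟩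
  left; right; right
  have h6 := hone (q₁ := p 1) (q₂ := p 2) le_rfl le_rfl
  have h7 := h.starSeq_surj (l₀ := 0) (l₁ := 1) (l₂ := 2) (by decide) h0 hsurj
  rcases (show p 2 = 2 ∨ p 2 = 3 ∨ p 2 = 4 by omega) with h8 | h8 | h8 <;> rw [h4, h8] at h6 h7
  · exact .inl (hasShape_of_isTree hG hE₁ hE₀ h6 h7 (by decide) (by decide) rfl)
  · exact .inr (.inl (hasShape_of_isTree hG hE₁ hE₀ h6 h7 (by decide) (by decide) rfl))
  · exact .inr (.inr (hasShape_of_isTree hG hE₁ hE₀ h6 h7 (by decide) (by decide) rfl))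

/-- A tree is a Dynkin diagram or contains a Euclidean diagram: consider a star with arms of
maximal total length. -/
theorem isDynkin_or_exists_config [Finite T] (hG : G.IsTree)
    (hE₁ : ∀ a b, G.Adj a b → E a b = 1) (hE₀ : ∀ a b, ¬ G.Adj a b → E a b = 0) :
    IsDynkin E ∨ ∃ f n L, IsEuclideanTreeList n L ∧ IsConfig G.Adj f n L := by
  by_cases hstar : ∃ c p, IsStar G c p
  · obtain ⟨c, p, hcp, hmax⟩ := exists_maximal_isStar hstar
    by_cases hsurj : ∀ x, ∃ l i, i ≤ p l ∧ c l i = x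
    · let σ := Tuple.sort p
      have hmono : Monotone (p ∘ σ) := Tuple.monotone_sort p
      have h := hcp.perm σ
      have hsurj' : ∀ x, ∃ l i, i ≤ (p ∘ σ) l ∧ (c ∘ σ) l i = x := by
        intro x
        obtain ⟨l, i, hi, rfl⟩ := hsurj x
        exact ⟨σ.symm l, i, by simpa using hi, by simp⟩
      by_cases h2 : 2 ≤ (p ∘ σ) 0
      · exact .inr ⟨_, 7, _, .inr (.inl ⟨rfl, rfl⟩),
          h.config_E6 fun l => h2.trans (hmono (Fin.zero_le l))⟩
      · have := h.pos 0
        exact h.isDynkin_or hG hE₁ hE₀ hsurj' (by omega) (hmono (by decide))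
    · have hw : ∃ w, (∀ l i, i ≤ p l → c l i ≠ w) ∧ ∃ l i, i ≤ p l ∧ G.Adj w (c l i) := by
        push Not at hsurj
        obtain ⟨x, hx⟩ := hsurj
        obtain ⟨q⟩ := hG.connected.preconnected (c 0 0) x
        obtain ⟨d, -, ⟨l, i, hi, h1⟩, h2⟩ := q.exists_boundary_dart {y | ∃ l i, i ≤ p l ∧ c l i = y}
          ⟨0, 0, Nat.zero_le _, rfl⟩ (by rintro ⟨l, i, hi, h⟩; exact hx l i hi h)
        refine ⟨d.snd, fun l i hi h => h2 ⟨l, i, hi, h⟩, l, i, hi, ?_⟩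
        rw [h1]
        exact d.adj.symm
      obtain ⟨w, hw, l, i, hi, hwi⟩ := hw
      rcases hi.lt_or_eq with hi | rfl
      · obtain ⟨f, hf⟩ := hcp.exists_config_D hw hi hwi
        exact .inr ⟨f, _, _, .inl ⟨i, rfl, rfl⟩, hf⟩
      · have h1 := hmax _ _ (hcp.extend hw hwi)
        have h2 : ∑ l', p l' < ∑ l', if l' = l then p l + 1 else p l' := by
          refine Finset.sum_lt_sum (fun l' _ => ?_) ⟨l, Finset.mem_univ _, ?_⟩
          · split_ifs with hl
            · rw [hl]; omega
            · exact le_rfl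
          · rw [if_pos rfl]; omega
        omega
  · push Not at hstar
    obtain ⟨f, n, hn, hf, hsurj⟩ := exists_path_of_not_isStar hG.connected hstar
    refine .inl (.inl ⟨n, hn, hasShape_of_isTree hG hE₁ hE₀ hf hsurj (nodup_pathEdges n) ?_ ?_⟩)
    · rintro ⟨i, j⟩ he
      rw [mem_pathEdges] at he
      dsimp only
      omega
    · rw [length_pathEdges]; omega

end Trees

/-! ### Wild quivers -/

section Wild

variable {Q : Type*} [Quiver Q]

/-- The underlying simple graph of a component of an acyclic quiver. -/
def componentGraph (hQ : IsAcyclicQuiver Q) (C : Quiver.WeaklyConnectedComponent Q) :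
    SimpleGraph {i : Q // Quiver.WeaklyConnectedComponent.mk i = C} where
  Adj a b := QuiverAdj a.1 b.1
  symm := ⟨fun _ _ h => h.symm⟩
  loopless := ⟨fun _ h => h.ne hQ rfl⟩

theorem componentGraph_connected (hQ : IsAcyclicQuiver Q) (C : Quiver.WeaklyConnectedComponent Q) :
    (componentGraph hQ C).Connected := by
  have key : ∀ {x y : Q} (_ : @Quiver.Path (Quiver.Symmetrify Q) _ x y)
      (hx : Quiver.WeaklyConnectedComponent.mk x = C)
      (hy : Quiver.WeaklyConnectedComponent.mk y = C),
      (componentGraph hQ C).Reachable ⟨x, hx⟩ ⟨y, hy⟩ := by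
    intro x y p hx
    induction p with
    | nil => intro _; exact SimpleGraph.Reachable.refl _
    | @cons b c p e ih =>
      intro hy
      have hb : Quiver.WeaklyConnectedComponent.mk (b : Q) = C := by
        rw [← hx]
        exact ((Quiver.WeaklyConnectedComponent.eq x b).2 ⟨p⟩).symm
      refine (ih hb).trans (SimpleGraph.Adj.reachable ?_)
      rcases e with e | e
      · exact .inl ⟨e⟩
      · exact .inr ⟨e⟩
  obtain ⟨x, hx⟩ : ∃ x : Q, Quiver.WeaklyConnectedComponent.mk x = C := Quotient.exists_rep C
  have : Nonempty {i : Q // Quiver.WeaklyConnectedComponent.mk i = C} := ⟨⟨x, hx⟩⟩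
  refine ⟨fun a b => ?_⟩
  obtain ⟨p⟩ := (Quiver.WeaklyConnectedComponent.eq a.1 b.1).1 (a.2.trans b.2.symm)
  exact key p a.2 b.2

/-- A nonempty set of vertices of a finite acyclic quiver contains a source. -/
theorem IsAcyclicQuiver.exists_source [Finite Q] (hQ : IsAcyclicQuiver Q) {S : Set Q}
    (hS : S.Nonempty) : ∃ x ∈ S, ∀ y ∈ S, IsEmpty (y ⟶ x) := by
  let R : Q → Q → Prop := fun x y => ∃ p : Quiver.Path x y, p.length ≠ 0
  have h1 : IsTrans Q R := ⟨fun x y z ⟨p, hp⟩ ⟨q, _⟩ => ⟨p.comp q, by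
    rw [Quiver.Path.length_comp]; omega⟩⟩
  have h2 : Std.Irrefl R := ⟨fun x ⟨p, hp⟩ => hp (hQ x p)⟩
  obtain ⟨x, hx, hmin⟩ := (Finite.wellFounded_of_trans_of_irrefl R).has_min S hS
  exact ⟨x, hx, fun y hy => ⟨fun a => hmin y hy ⟨a.toPath, by simp⟩⟩⟩

variable (k : Type u) [Field k] [Infinite k]

/-- A cycle and a further vertex. The cycle is rotated such that its last vertex is a source. -/
theorem hasFullPairFamily_of_isConfig_cycle [Finite Q] (hQ : IsAcyclicQuiver Q) {f : ℕ → Q} {n : ℕ}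
    (hn : 3 ≤ n) (hf : IsConfig QuiverAdj f n ((n - 1, 0) :: pathEdges n)) {w : Q}
    (hw : IsAttached f n w) : HasFullPairFamily k Q := by
  obtain ⟨_, ⟨i₀, hi₀, rfl⟩, hsrc⟩ := hQ.exists_source (S := {x | ∃ i < n, f i = x})
    ⟨f 0, 0, by omega, rfl⟩
  have hcyc : ∀ a b, a < n → b < n → (b = a + 1 ∨ (a = n - 1 ∧ b = 0)) → QuiverAdj (f a) (f b) := by
    rintro a b ha hb (rfl | ⟨rfl, rfl⟩)
    · exact hf.adj (a, a + 1) (List.mem_cons_of_mem _ (mem_pathEdges.2 ⟨rfl, hb⟩))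
    · exact hf.adj (n - 1, 0) List.mem_cons_self
  let ρ : ℕ → ℕ := fun j => if j + (i₀ + 1) < n then j + (i₀ + 1) else j + (i₀ + 1) - n
  have hρ : ∀ j, j < n → (j + (i₀ + 1) < n ∧ ρ j = j + (i₀ + 1)) ∨
      (n ≤ j + (i₀ + 1) ∧ ρ j = j + (i₀ + 1) - n) := by
    intro j _
    dsimp only [ρ]
    split_ifs with h
    · exact .inl ⟨h, rfl⟩
    · exact .inr ⟨by omega, rfl⟩
  clear_value ρ
  obtain ⟨n, rfl⟩ : ∃ m, n = m + 1 := ⟨n - 1, by omega⟩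
  have hlast : ρ n = i₀ := by have := hρ n (by omega); omega
  have hstep : ∀ j, j + 1 < n + 1 → QuiverAdj (f (ρ j)) (f (ρ (j + 1))) := by
    intro j hj
    have h1 := hρ j (by omega)
    have h2 := hρ (j + 1) hj
    exact hcyc _ _ (by omega) (by omega) (by omega)
  refine hasFullPairFamily_of_cycle (f := f ∘ ρ) (n := n) (by omega) ?_
    (fun i hi => hstep i (by omega)) ?_ ?_ (hw.comp ?_ ?_)
  · intro i hi j hj hij
    have h1 := hρ i hi
    have h2 := hρ j hj
    have h3 := hf.inj _ (by omega) _ (by omega) hij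
    omega
  · have h1 := hρ 0 (by omega)
    have h2 := hρ n (by omega)
    have h3 := hcyc (ρ n) (ρ 0) (by omega) (by omega) (by omega)
    refine h3.resolve_right ?_
    rw [hlast, not_nonempty_iff]
    exact hsrc _ ⟨_, by omega, rfl⟩
  · have h1 := hρ (n - 1) (by omega)
    have h3 := hstep (n - 1) (by omega)
    rw [Nat.sub_add_cancel (by omega)] at h3
    refine h3.resolve_left ?_
    rw [hlast, not_nonempty_iff]
    exact hsrc _ ⟨_, by omega, rfl⟩
  · intro i hi
    have := hρ i hi
    omega
  · intro j hj
    by_cases h : j < i₀ + 1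
    · refine ⟨j + (n + 1) - (i₀ + 1), by omega, ?_⟩
      have := hρ (j + (n + 1) - (i₀ + 1)) (by omega)
      omega
    · refine ⟨j - (i₀ + 1), by omega, ?_⟩
      have := hρ (j - (i₀ + 1)) (by omega)
      omega

theorem edgeMultiplicity_comm (a b : Q) : edgeMultiplicity a b = edgeMultiplicity b a :=
  add_comm _ _

theorem edgeMultiplicity_pos_iff [∀ i j : Q, Finite (i ⟶ j)] {a b : Q} :
    0 < edgeMultiplicity a b ↔ QuiverAdj a b := by
  rw [edgeMultiplicity, add_pos_iff, Nat.card_pos_iff, Nat.card_pos_iff, QuiverAdj]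
  exact or_congr (and_iff_left inferInstance) (and_iff_left inferInstance)

theorem hasFullPairFamily_of_isWildQuiver [Finite Q] [∀ i j : Q, Finite (i ⟶ j)]
    (hQ : IsAcyclicQuiver Q) (hwild : IsWildQuiver Q) : HasFullPairFamily k Q := by
  obtain ⟨C, hD, hE⟩ := hwild
  set T := {i : Q // Quiver.WeaklyConnectedComponent.mk i = C}
  have hconn := componentGraph_connected hQ C
  have hadj : ∀ a b : T, (componentGraph hQ C).Adj a b ↔ 0 < edgeMultiplicity a.1 b.1 := fun a b =>
    edgeMultiplicity_pos_iff.symm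
  have hself : ∀ a : T, edgeMultiplicity a.1 a.1 = 0 := fun a => by
    by_contra h
    exact (edgeMultiplicity_pos_iff.1 (Nat.pos_of_ne_zero h)).ne hQ rfl
  have hval : ∀ {f : ℕ → T} {n : ℕ} {L : List (ℕ × ℕ)},
      IsConfig (componentGraph hQ C).Adj f n L → IsConfig QuiverAdj (fun i => (f i).1) n L :=
    fun h => ⟨fun i hi j hj hij => h.inj i hi j hj (Subtype.ext hij), h.adj⟩
  have hatt : ∀ {f : ℕ → T} {n : ℕ}, 0 < n → (¬ ∀ x, ∃ i < n, f i = x) →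
      ∃ w, IsAttached (fun i => (f i).1) n w := by
    intro f n hn h
    obtain ⟨w, hw, i, hi, hwi⟩ := exists_adj_of_not_surj hconn hn h
    exact ⟨w.1, fun i hi h => hw i hi (Subtype.ext h), i, hi, hwi⟩
  by_cases h3 : ∃ a b : T, 3 ≤ edgeMultiplicity a.1 b.1
  · obtain ⟨a, b, h⟩ := h3
    exact hasFullPairFamily_of_three_le hQ h
  push Not at h3
  by_cases h2 : ∃ a b : T, 2 ≤ edgeMultiplicity a.1 b.1
  · obtain ⟨a, b, h⟩ := h2
    have hab : a ≠ b := by rintro rfl; rw [hself] at h; omega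
    have h2 : edgeMultiplicity a.1 b.1 = 2 := le_antisymm (Nat.lt_succ_iff.1 (h3 a b)) h
    let f : ℕ → T := fun i => if i = 0 then a else b
    by_cases hsurj : ∀ x, ∃ i < 2, f i = x
    · refine absurd (.inl ⟨1, le_rfl, ?_⟩) hE
      let e : Fin 2 ≃ T := Equiv.ofBijective (fun i => f i) ⟨fun i j hij => by
          fin_cases i <;> fin_cases j <;> simp_all [f, hab.symm],
        fun x => by obtain ⟨i, hi, h⟩ := hsurj x; exact ⟨⟨i, hi⟩, h⟩⟩
      have he0 : e 0 = a := rfl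
      have he1 : e 1 = b := rfl
      refine ⟨e.symm, fun x y => ?_⟩
      obtain ⟨i, rfl⟩ := e.surjective x
      obtain ⟨j, rfl⟩ := e.surjective y
      rw [e.symm_apply_apply, e.symm_apply_apply]
      fin_cases i <;> fin_cases j
      · exact hself _
      · exact h2
      · exact (edgeMultiplicity_comm _ _).trans h2
      · exact hself _
    · obtain ⟨w, hw, i, hi, hwi⟩ := hatt two_pos hsurj
      refine hasFullPairFamily_of_two_le hQ h (w := w) (hw 0 two_pos).symm
        (hw 1 one_lt_two).symm ?_
      rcases (show i = 0 ∨ i = 1 by omega) with rfl | rfl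
      · exact .inl hwi
      · exact .inr hwi
  push Not at h2
  have hE₁ : ∀ a b : T, (componentGraph hQ C).Adj a b → edgeMultiplicity a.1 b.1 = 1 := by
    intro a b h
    have := (hadj a b).1 h
    have := h2 a b
    omega
  have hE₀ : ∀ a b : T, ¬ (componentGraph hQ C).Adj a b → edgeMultiplicity a.1 b.1 = 0 := by
    intro a b h
    rw [hadj] at h
    omega
  by_cases hcyc : ∃ n, ∃ f, IsCycleSeq (componentGraph hQ C) f n
  · classical
    obtain ⟨f, hf⟩ := Nat.find_spec hcyc
    have hmin : ∀ g m, IsCycleSeq (componentGraph hQ C) g m → Nat.find hcyc ≤ m :=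
      fun g m h => Nat.find_min' hcyc ⟨g, h⟩
    generalize Nat.find hcyc = n at *
    have hn := hf.1
    by_cases hsurj : ∀ x, ∃ i < n, f i = x
    · refine absurd (.inl ⟨n - 1, by omega, ?_⟩) hE
      rw [Nat.sub_add_cancel (by omega)]
      exact hasShape_of_cycle hE₁ hE₀ hf hmin hsurj
    · obtain ⟨w, hw⟩ := hatt (by omega) hsurj
      exact hasFullPairFamily_of_isConfig_cycle k hQ hn (hval hf.2) hw
  · have htree : (componentGraph hQ C).IsTree :=
      ⟨hconn, isAcyclic_of_not_isCycleSeq fun f n h => hcyc ⟨n, f, h⟩⟩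
    obtain ⟨f, n, L, hL, hf⟩ := (isDynkin_or_exists_config htree hE₁ hE₀).resolve_left hD
    by_cases hsurj : ∀ x, ∃ i < n, f i = x
    · exact absurd (hL.isEuclidean htree hE₁ hE₀ hf hsurj) hE
    · have hn : 0 < n := by
        rcases hL with ⟨m, rfl, -⟩ | ⟨rfl, -⟩ | ⟨rfl, -⟩ | ⟨rfl, -⟩ <;> omega
      obtain ⟨w, hw⟩ := hatt hn hsurj
      rcases hL with ⟨m, rfl, rfl⟩ | ⟨rfl, rfl⟩ | ⟨rfl, rfl⟩ | ⟨rfl, rfl⟩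
      · exact (hval hf).hasFullPairFamily_D hw
      · exact (hval hf).hasFullPairFamily_E6 hw
      · exact (hval hf).hasFullPairFamily_E7 hw
      · exact (hval hf).hasFullPairFamily_E8 hw

end Wild

end

theorem mainTheorem1 {k : Type u} [Field k] [IsAlgClosed k]
    {Q : Type*} [Quiver Q] [Finite Q] [∀ i j : Q, Finite (i ⟶ j)]
    (hacyclic : IsAcyclicQuiver Q) (hwild : IsWildQuiver Q)
    (n : ℕ) (V : Set (ℙ k (Fin (n + 1) → k))) (hV : IsProjectiveVariety V) :
    ∃ (M : QuiverRep k Q) (d : Q → ℕ) (e : V ≃ QuiverGrassmannian M d),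
      IsVarietyIso (projectiveInclusion V) (quiverPlucker M d) e := by
  have : Infinite k := IsAlgClosed.instInfinite
  obtain ⟨F, ⟨i₀, hi₀⟩, hF⟩ := hasFullPairFamily_of_isWildQuiver k hacyclic hwild
  exact F.exists_isVarietyIso hF i₀ hV
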